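/- Let $K$ be a field of characteristic $0$ with algebraic closure $\overline K$, let $n\ge 1$, $d\ge 0$, and let $f\in K[x_1,\dots,x_n]$ be a homogeneous polynomial of degree $d$ given by a black box, which returns $f(a)$ on input $a\in K^n$. Let $\mathfrak g_f\subseteq M_n(K)$ be the Lie algebra of $f$, i.e. the tangent space at the identity of the group of matrices $A$ with $f(Ax)=f(x)$. Consider the following randomized algorithm, with input $n$, $d$, the black box for $f$, and a parameter $N\in\mathbb N$; it draws random elements independently and uniformly from $\{0,1,\dots,N\}\subseteq K$. 1. Compute a basis $B_1,\dots,B_k$ of $\mathfrak g_f$, as the space of the matrices $(a_{ij})$ such that $\sum_{i,j}a_{ij}\,x_j\,\partial f/\partial x_i$ vanishes at $n^2$ random points; the partial derivatives are computed by interpolation on lines. 2. Reject if $k\ne n-1$. 3. Check that $B_1,\dots,B_{n-1}$ commute pairwise and are all diagonalizable over $\overline K$ (i.e. that their minimal polynomials have only simple roots). If so, accept; otherwise reject. 4. If accepted, find an invertible matrix $A$ such that all matrices $AB_iA^{-1}$ are diagonal, by computing the eigenvalues of a random linear combination of the $B_i$ and bases of its (left) eigenspaces. 5. Find the vector $\alpha=(\alpha_1,\dots,\alpha_n)$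 with $\sum_i\alpha_i=d$ that is orthogonal to the diagonals of the matrices $AB_iA^{-1}$. 6. Output the factorization $f(x)=\lambda\, l_1(x)^{\alpha_1}\cdots l_n(x)^{\alpha_n}$, where the linear form $l_i$ is given by the $i$-th row of $A$ and $\lambda$ is computed from the value of $f$ at one random point. The cost of the algorithm is measured by the number of arithmetic operations and zero tests in $\overline K$, calls to the black box and random draws; computing the list of the distinct eigenvalues of an $m\times m$ matrix is a primitive operation, charged $m^2$ steps. **Theorem.** There are constants $C,c\in\mathbb N$ such that for all $K$, $n$, $d$, $f$ and $N$ as above the following holds. (a) For all random choices the algorithm makes at most $C(n+d)^c$ steps, with at most one eigenvalue computation. (b) With probability at least $1-C(n+d)^c/(N+1)$ the following are all true: the matrices computed in step 1 form a basis of $\mathfrak g_f$; the algorithm accepts if and only if $f$ can be written over $\overline K$ as $f=l_1^{\alpha_1}\cdots l_n^{\alpha_n}$ with linearly independent linear forms $l_1,\dots,l_n$ and exponents $\alpha_i\ge 1$; if $f$ can be written in this way, then the algorithm outputs a nonzero $\lambda\in\overline K$, linearly independent linear forms $l_i$ over $\overline K$ and integers $\alpha_i\ge 1$ with $f=\lambda\,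 l_1^{\alpha_1}\cdots l_n^{\alpha_n}$ (and $\lambda$ becomes $1$ after a suitable scaling of the $l_i$); and if $f$ cannot be written in this way, then it outputs no factorization. -/

import Mathlib

universe u v w

/-! ## The computation model

Randomized algebraic programs with a black box. A program handles elements of a type `F` of
scalars about which it knows nothing: it can only combine them by arithmetic operations, compare
them to zero, hand them to the black box, draw random integers, and ask for the eigenvalues of a
square matrix. A program that is defined for all types `F` at once thus has no other access to
scalars. Integers that steer the loops (sizes, indices, counters) are kept outside `F`. -/

/-- The four arithmetic operations. -/
inductive ArithOp where
  | add
  | sub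
  | mul
  | div

/-- The value of an arithmetic operation in a field. -/
def ArithOp.eval {L : Type u} [Field L] : ArithOp → L → L → L
  | .add, x, y => x + y
  | .sub, x, y => x - y
  | .mul, x, y => x * y
  | .div, x, y => x / y

/-- Programs over the scalars `F`, with a black box that takes `n` arguments and with outputs in
`α`. In each instruction the last argument is the continuation. -/
inductive Prog (F : Type u) (n : ℕ) (α : Type v) : Type (max u v) where
  /-- stop, with output `a` -/
  | ret (a : α) : Prog F n α
  /-- the integer constant `k` -/
  | lit (k : ℕ) (next : F → Prog F n α) : Prog F n α
  /-- one arithmetic operation -/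
  | op (o : ArithOp) (x y : F) (next : F → Prog F n α) : Prog F n α
  /-- one test for zero -/
  | isZero (x : F) (next : Bool → Prog F n α) : Prog F n α
  /-- one call to the black box -/
  | query (x : Fin n → F) (next : F → Prog F n α) : Prog F n α
  /-- `m` independent uniform random elements of `{0, 1, …, N}` -/
  | rand (m N : ℕ) (next : (Fin m → F) → Prog F n α) : Prog F n α
  /-- the list of the distinct eigenvalues of an `m × m` matrix -/
  | eig (m : ℕ) (M : Matrix (Fin m) (Fin m) F) (next : List F → Prog F n α) : Prog F n α

/-- What a run of a program yields: its output, the number of its steps, and the number of its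
eigenvalue computations. -/
structure RunResult (α : Type v) where
  output : α
  steps : ℕ
  eigenCalls : ℕ

/-- Charge `s` further steps and `e` further eigenvalue computations. -/
def RunResult.charge {α : Type v} (s e : ℕ) (r : RunResult α) : RunResult α :=
  ⟨r.output, r.steps + s, r.eigenCalls + e⟩

open scoped Classical in
/-- The distribution of the result of a run, in the field `L`, with black box `O` and eigenvalue
solver `E`. Each constant, arithmetic operation, zero test, black-box call and random draw is one
step; an eigenvalue computation for an `m × m` matrix is charged `m * m` steps and is also counted
separately. -/
noncomputable def Prog.run {L : Type u} [Field L] {n : ℕ} {α : Type v}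
    (O : (Fin n → L) → L) (E : (m : ℕ) → Matrix (Fin m) (Fin m) L → List L) :
    Prog L n α → PMF (RunResult α)
  | .ret a => PMF.pure ⟨a, 0, 0⟩
  | .lit k next => (Prog.run O E (next (k : L))).map (RunResult.charge 1 0)
  | .op o x y next => (Prog.run O E (next (o.eval x y))).map (RunResult.charge 1 0)
  | .isZero x next => (Prog.run O E (next (decide (x = 0)))).map (RunResult.charge 1 0)
  | .query x next => (Prog.run O E (next (O x))).map (RunResult.charge 1 0)
  | .rand m N next => (PMF.uniformOfFintype (Fin m → Fin (N + 1))).bind fun r =>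
      (Prog.run O E (next fun i => ((r i : ℕ) : L))).map (RunResult.charge m 0)
  | .eig m M next => (Prog.run O E (next (E m M))).map (RunResult.charge (m * m) 1)

namespace Prog

variable {F : Type u} {n : ℕ} {α : Type v} {β : Type w}

/-- Sequential composition. -/
def bind : Prog F n α → (α → Prog F n β) → Prog F n β
  | .ret a, k => k a
  | .lit c next, k => .lit c fun x => (next x).bind k
  | .op o x y next, k => .op o x y fun z => (next z).bind k
  | .isZero x next, k => .isZero x fun b => (next b).bind k
  | .query x next, k => .query x fun y => (next y).bind k
  | .rand m N next, k => .rand m N fun r => (next r).bind k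
  | .eig m M next, k => .eig m M fun l => (next l).bind k

/-! ### Loops -/

/-- Compute the entries of a vector one after the other. -/
def tabulate : (m : ℕ) → (Fin m → Prog F n α) → Prog F n (Fin m → α)
  | 0, _ => .ret fun i => i.elim0
  | m + 1, g => (g 0).bind fun a => (tabulate m fun i => g i.succ).bind fun v =>
      .ret (Fin.cons a v)

/-- Apply a program to each entry of a list. -/
def mapList (g : α → Prog F n β) : List α → Prog F n (List β)
  | [] => .ret []
  | a :: l => (g a).bind fun b => (mapList g l).bind fun l' => .ret (b :: l')

/-- Does the test `g` succeed on all entries of the list? -/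
def allList (g : α → Prog F n Bool) : List α → Prog F n Bool
  | [] => .ret true
  | a :: l => (g a).bind fun b => if b then allList g l else .ret false

/-- The sum of `m` scalars. -/
def sum : (m : ℕ) → (Fin m → Prog F n F) → Prog F n F
  | 0, _ => .lit 0 .ret
  | m + 1, g => (g 0).bind fun a => (sum m fun i => g i.succ).bind fun s => .op .add a s .ret

/-- The product of `m` scalars. -/
def prod : (m : ℕ) → (Fin m → Prog F n F) → Prog F n F
  | 0, _ => .lit 1 .ret
  | m + 1, g => (g 0).bind fun a => (prod m fun i => g i.succ).bind fun s => .op .mul a s .ret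

/-! ### Linear algebra -/

/-- The product `∑ i, u i * v i`. -/
def dot {m : ℕ} (u v : Fin m → F) : Prog F n F :=
  sum m fun i => .op .mul (u i) (v i) .ret

/-- The vector `u - q • v`. -/
def subMul {m : ℕ} (u : Fin m → F) (q : F) (v : Fin m → F) : Prog F n (Fin m → F) :=
  tabulate m fun i => .op .mul q (v i) fun z => .op .sub (u i) z .ret

/-- From a basis of a subspace compute a basis of the subspace of its vectors `v` that satisfy the
further equation `∑ i, w i * v i = 0`. -/
def kernelStep {m : ℕ} (w : Fin m → F) : List (Fin m → F) → Prog F n (List (Fin m → F))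
  | [] => .ret []
  | v :: V => (dot w v).bind fun c => .isZero c fun b =>
      if b then (kernelStep w V).bind fun V' => .ret (v :: V')
      else mapList (fun u => (dot w u).bind fun c' => .op .div c' c fun q => subMul u q v) V

/-- Impose the equations with the given coefficient rows one after the other. -/
def kernelFrom {m : ℕ} : List (Fin m → F) → List (Fin m → F) → Prog F n (List (Fin m → F))
  | [], V => .ret V
  | w :: W, V => (kernelStep w V).bind fun V' => kernelFrom W V'

/-- A basis of the null space of the matrix with the given rows. -/
def kernel {m : ℕ} (W : List (Fin m → F)) : Prog F n (List (Fin m → F)) :=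
  (mapList (fun i : Fin m => tabulate m fun j => .lit (if i = j then 1 else 0) .ret)
    (List.finRange m)).bind fun V => kernelFrom W V

/-- The product of two square matrices. -/
def matMul {m : ℕ} (A B : Matrix (Fin m) (Fin m) F) : Prog F n (Matrix (Fin m) (Fin m) F) :=
  tabulate m fun i => tabulate m fun j => dot (A i) fun l => B l j

/-- Are two square matrices equal? -/
def matEq {m : ℕ} (A B : Matrix (Fin m) (Fin m) F) : Prog F n Bool :=
  allList (fun i => allList (fun j => .op .sub (A i j) (B i j) fun z => .isZero z .ret)
    (List.finRange m)) (List.finRange m)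

/-- Do two square matrices commute? -/
def commuteTest {m : ℕ} (A B : Matrix (Fin m) (Fin m) F) : Prog F n Bool :=
  (matMul A B).bind fun P => (matMul B A).bind fun Q => matEq P Q

/-- Given the powers `1, M, …, M ^ k` in `P`, look for the first linear relation
`∑ c l • M ^ l = 0` between the powers of `M`, in which the `c l` are, up to a common factor, the
coefficients of the minimal polynomial `p` of `M`. Then `p` has only simple roots, i.e. `p` and
its derivative are coprime, if and only if the matrix `p' (M)` is invertible. -/
def diagonalizableFrom {m : ℕ} (M : Matrix (Fin m) (Fin m) F) :
    (fuel : ℕ) → (k : ℕ) → (Fin (k + 1) → Matrix (Fin m) (Fin m) F) → Prog F n Bool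
  | fuel, k, P =>
    (kernel ((List.finRange m).flatMap fun i => (List.finRange m).map fun j => fun l => P l i j)).bind
      fun V => match V, fuel with
        | c :: _, _ =>
          (tabulate m fun i => tabulate m fun j => sum k fun l =>
            .lit (l.val + 1) fun z => .op .mul z (c l.succ) fun z =>
              .op .mul z (P l.castSucc i j) .ret).bind fun D : Fin m → Fin m → F =>
          (kernel (List.ofFn D)).bind fun V' => .ret V'.isEmpty
        | [], 0 => .ret false
        | [], fuel + 1 => (matMul (P (Fin.last k)) M).bind fun Q =>
            diagonalizableFrom M fuel (k + 1) (Fin.snoc (α := fun _ => Matrix (Fin m) (Fin m) F) P Q)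

/-- Is the matrix `M` diagonalizable over the algebraic closure? -/
def diagonalizableTest {m : ℕ} (M : Matrix (Fin m) (Fin m) F) : Prog F n Bool :=
  (tabulate m fun i => tabulate m fun j => .lit (if i = j then 1 else 0) .ret).bind
    fun I : Matrix (Fin m) (Fin m) F => diagonalizableFrom M m 0 fun _ => I

/-- The scalar `q` with `u = q • v`, for vectors such that `v ≠ 0` and `u` is a multiple of `v`. The
vectors are given as the list of the pairs `(u i, v i)`. -/
def ratio : List (F × F) → Prog F n F
  | [] => .lit 0 .ret
  | (x, y) :: l => .isZero y fun b => if b then ratio l else .op .div x y .ret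

/-- The first integer of a list that is equal to the scalar `x`. -/
def findNat (x : F) : List ℕ → Prog F n (Option ℕ)
  | [] => .ret none
  | e :: l => .lit e fun z => .op .sub x z fun z => .isZero z fun b =>
      if b then .ret (some e) else findNat x l

/-! ### Step 1: a basis of the Lie algebra -/

/-- The coefficients `w k` (`k < d`) with `g' (0) = ∑ k, w k * (g (k + 1) - g 0)` for all
polynomials `g` in one variable of degree at most `d`, i.e.
`w k = 1 / (k + 1) * ∏ j ≠ k, (j + 1) / ((j + 1) - (k + 1))`. -/
def weights (d : ℕ) : Prog F n (Fin d → F) :=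
  tabulate d fun k => prod d fun j =>
    if j = k then .lit 1 fun x => .lit (k.val + 1) fun y => .op .div x y .ret
    else .lit (j.val + 1) fun x => .lit (k.val + 1) fun y => .op .sub x y fun z => .op .div x z .ret

/-- The partial derivative of `f` with respect to the `i`-th variable at the point `a`, by
interpolation of `f` on a line through `a`. Here `fa` is the value of `f` at `a`. -/
def partialDeriv {d : ℕ} (wts : Fin d → F) (a : Fin n → F) (fa : F) (i : Fin n) : Prog F n F :=
  sum d fun k =>
    (tabulate n fun j =>
      if j = i then .lit (k.val + 1) fun t => .op .add (a j) t .ret else .ret (a j)).bind fun x =>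
    .query x fun y => .op .sub y fa fun z => .op .mul (wts k) z .ret

/-- The values at the point `a` of the `n * n` polynomials `x_j * ∂f / ∂x_i`. -/
def lieRow {d : ℕ} (wts : Fin d → F) (a : Fin n → F) : Prog F n (Fin (n * n) → F) :=
  .query a fun fa => (tabulate n fun i => partialDeriv wts a fa i).bind fun D =>
    tabulate (n * n) fun p =>
      .op .mul (a (finProdFinEquiv.symm p).2) (D (finProdFinEquiv.symm p).1) .ret

/-- A basis of the Lie algebra of `f`, as the space of the linear relations between the values of
the polynomials `x_j * ∂f / ∂x_i` at `n * n` random points. -/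
def lieBasis (d N : ℕ) : Prog F n (List (Matrix (Fin n) (Fin n) F)) :=
  (weights d).bind fun wts => .rand (n * n * n) N fun r =>
    (tabulate (n * n) fun p => lieRow wts fun j => r (finProdFinEquiv (p, j))).bind fun W =>
    (kernel (List.ofFn W)).bind fun V =>
    .ret (V.map fun a => Matrix.of fun i j => a (finProdFinEquiv (i, j)))

/-! ### Steps 2 and 3: the decision -/

/-- Check that there are `n - 1` matrices, that they commute, and that they are all diagonalizable
over the algebraic closure. -/
def decisionTest (B : List (Matrix (Fin n) (Fin n) F)) : Prog F n Bool :=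
  if B.length + 1 = n then
    (allList (fun M => allList (fun M' => commuteTest M M') B) B).bind fun b =>
      if b then allList diagonalizableTest B else .ret false
  else .ret false

/-! ### Step 4: simultaneous diagonalization -/

/-- Find a matrix `A` such that all matrices `A * M * A⁻¹` with `M` in `B` are diagonal: the rows of
`A` are eigenvectors of the transpose of a random linear combination `R` of the matrices in `B`. -/
def simulDiag (N : ℕ) (B : List (Matrix (Fin n) (Fin n) F)) :
    Prog F n (Option (Matrix (Fin n) (Fin n) F)) :=
  .rand B.length N fun r =>
  (tabulate n fun i => tabulate n fun j => sum B.length fun t =>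
    .op .mul (r t) (B.get t i j) .ret).bind fun R : Fin n → Fin n → F =>
  .eig n (Matrix.of R) fun mus =>
  (mapList (fun mu =>
    (tabulate n fun i => tabulate n fun j =>
      if i = j then .op .sub (R j i) mu .ret else .ret (R j i)).bind fun S : Fin n → Fin n → F =>
    kernel (List.ofFn S)) mus).bind fun Vs =>
  if h : Vs.flatten.length = n then
    .ret (some (Matrix.of fun i => Vs.flatten.get (i.cast h.symm)))
  else .ret none

/-! ### Step 5: the exponents -/

/-- The vectors on the diagonals of the matrices `A * M * A⁻¹` with `M` in `B`. As `A * M` is equal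
to `diag (q) * A`, the scalar `q k` is the ratio of the `k`-th rows of `A * M` and `A`. -/
def diagonals (A : Matrix (Fin n) (Fin n) F) (B : List (Matrix (Fin n) (Fin n) F)) :
    Prog F n (List (Fin n → F)) :=
  mapList (fun M => (matMul A M).bind fun P =>
    tabulate n fun k => ratio (List.ofFn fun j => (P k j, A k j))) B

/-- The vector that is orthogonal to the given vectors, normalized to have the sum `d`, and read as
a vector of positive integers. -/
def exponents (d : ℕ) (D : List (Fin n → F)) : Prog F n (Option (Fin n → ℕ)) :=
  (kernel D).bind fun V => match V with
    | [a] => (sum n fun k => .ret (a k)).bind fun s => .isZero s fun b =>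
        if b then .ret none else
        (tabulate n fun k => .lit d fun z => .op .mul (a k) z fun z => .op .div z s fun z =>
          findNat z (List.range' 1 d)).bind fun e =>
        if ∀ k, (e k).isSome then .ret (some fun k => (e k).getD 0) else .ret none
    | _ => .ret none

/-! ### Step 6: the constant factor -/

/-- The scalar `c` with `f (x) = c * m (A * x)`, where `m` is the monomial with exponents `e`, from
the value of `f` at one random point. -/
def constantFactor (N : ℕ) (A : Matrix (Fin n) (Fin n) F) (e : Fin n → ℕ) : Prog F n (Option F) :=
  .rand n N fun a => .query a fun y =>
  (tabulate n fun k => dot (A k) a).bind fun l =>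
  (prod n fun k => prod (e k) fun _ => .ret (l k)).bind fun z =>
  .isZero z fun b => if b then .ret none else .op .div y z fun c => .ret (some c)

end Prog

/-- The data of a factorization `scalar * ∏ i, (l i) ^ (exponents i)`, where the coefficients of the
linear form `l i` are the `i`-th row of the matrix. -/
structure Factorization (F : Type u) (n : ℕ) where
  scalar : F
  forms : Matrix (Fin n) (Fin n) F
  exponents : Fin n → ℕ

/-- The output of the algorithm: the basis of the Lie algebra, the decision, and the
factorization. -/
structure LieOutput (F : Type u) (n : ℕ) where
  basis : List (Matrix (Fin n) (Fin n) F)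
  accepted : Bool
  factorization : Option (Factorization F n)

/-- Steps 4 to 6 of the algorithm. -/
def factorizationFrom {F : Type u} {n : ℕ} (d N : ℕ) (B : List (Matrix (Fin n) (Fin n) F)) :
    Prog F n (Option (Factorization F n)) :=
  (Prog.simulDiag N B).bind fun A? => match A? with
    | none => .ret none
    | some A => (Prog.diagonals A B).bind fun D => (Prog.exponents d D).bind fun e? => match e? with
      | none => .ret none
      | some e => (Prog.constantFactor N A e).bind fun c? => .ret (c?.map fun c => ⟨c, A, e⟩)

/-- The Lie-algebra factorization algorithm for homogeneous polynomials of degree `d` in `n`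
variables. Random integers are drawn from `{0, 1, …, N}`. -/
def lieAlgorithm (F : Type u) (n d N : ℕ) : Prog F n (LieOutput F n) :=
  (Prog.lieBasis d N).bind fun B => (Prog.decisionTest B).bind fun b =>
    if b then (factorizationFrom d N B).bind fun fac? => .ret ⟨B, true, fac?⟩
    else .ret ⟨B, false, none⟩

/-! ## The mathematical notions -/

/-- `O` is a black box for `f`: it returns the value of `f` at each point with coordinates in `K`.
(Nothing is assumed about its answers at other points.) -/
def IsBlackBox {K : Type u} {L : Type v} [Field K] [Field L] [Algebra K L] {n : ℕ}
    (f : MvPolynomial (Fin n) K) (O : (Fin n → L) → L) : Prop :=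
  ∀ x : Fin n → K, O (fun i => algebraMap K L (x i)) = algebraMap K L (MvPolynomial.eval x f)

/-- `E` computes the eigenvalues of square matrices: it lists each eigenvalue once, in any order. -/
def IsEigenvalueSolver {L : Type u} [Field L]
    (E : (m : ℕ) → Matrix (Fin m) (Fin m) L → List L) : Prop :=
  ∀ (m : ℕ) (M : Matrix (Fin m) (Fin m) L),
    (E m M).Nodup ∧ ∀ μ : L, μ ∈ E m M ↔ Module.End.HasEigenvalue (Matrix.toLin' M) μ

/-- The linear form with the given coefficients. -/
noncomputable def linForm {R : Type u} [CommRing R] {n : ℕ} (a : Fin n → R) :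
    MvPolynomial (Fin n) R :=
  ∑ j, MvPolynomial.C (a j) * MvPolynomial.X j

/-- The polynomial `f (A.x)`, for a matrix `A` with entries in a `K`-algebra. -/
noncomputable def substMatrix {K : Type u} {R : Type v} [Field K] [CommRing R] [Algebra K R] {n : ℕ}
    (f : MvPolynomial (Fin n) K) (A : Matrix (Fin n) (Fin n) R) : MvPolynomial (Fin n) R :=
  MvPolynomial.aeval (fun i => linForm (A i)) f

/-- The Lie algebra of `f`: the tangent space at the identity of the group of the matrices `A` with
`f (A.x) = f (x)`, i.e. the set of the matrices `A` such that `1 + ε A` satisfies this equation over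
the dual numbers. -/
def lieAlgebraOf {K : Type u} [Field K] {n : ℕ} (f : MvPolynomial (Fin n) K) :
    Set (Matrix (Fin n) (Fin n) K) :=
  {A | substMatrix f
      ((1 : Matrix (Fin n) (Fin n) (DualNumber K)) + A.map fun a => a • (DualNumber.eps : DualNumber K))
    = MvPolynomial.map (algebraMap K (DualNumber K)) f}

/-- Over `L`, the polynomial `f` is a product of powers, with positive exponents, of `n` linearly
independent linear forms. -/
def HasIndependentFactorization {K : Type u} (L : Type v) [Field K] [Field L] [Algebra K L] {n : ℕ}
    (f : MvPolynomial (Fin n) K) : Prop :=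
  ∃ (l : Fin n → Fin n → L) (e : Fin n → ℕ), LinearIndependent L l ∧ (∀ i, 1 ≤ e i) ∧
    MvPolynomial.map (algebraMap K L) f = ∏ i, linForm (l i) ^ e i

/-- `fac` is a factorization of `f` into a nonzero scalar and powers, with positive exponents, of
`n` linearly independent linear forms; and the scalar can be made `1` by scaling these forms. -/
def Factorization.IsFor {K : Type u} {L : Type v} [Field K] [Field L] [Algebra K L] {n : ℕ}
    (fac : Factorization L n) (f : MvPolynomial (Fin n) K) : Prop :=
  fac.scalar ≠ 0 ∧ LinearIndependent L (fun i => fac.forms i) ∧ (∀ i, 1 ≤ fac.exponents i) ∧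
    MvPolynomial.map (algebraMap K L) f =
      MvPolynomial.C fac.scalar * ∏ i, linForm (fac.forms i) ^ fac.exponents i ∧
    ∃ c : Fin n → L, (∀ i, c i ≠ 0) ∧
      MvPolynomial.map (algebraMap K L) f =
        ∏ i, linForm (fun j => c i * fac.forms i j) ^ fac.exponents i

/-- The list `B` of matrices over `L` consists of the matrices of a `K`-basis of the Lie algebra
of `f`. -/
def IsLieBasis {K : Type u} {L : Type v} [Field K] [Field L] [Algebra K L] {n : ℕ}
    (B : List (Matrix (Fin n) (Fin n) L)) (f : MvPolynomial (Fin n) K) : Prop :=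
  ∃ b : List (Matrix (Fin n) (Fin n) K), B = b.map (fun M => M.map (algebraMap K L)) ∧
    LinearIndependent K b.get ∧
    (Submodule.span K (Set.range b.get) : Set (Matrix (Fin n) (Fin n) K)) = lieAlgebraOf f

/-- The output is correct for the input `f`: the basis is one of the Lie algebra of `f`, the
algorithm accepts if and only if a factorization exists over `L`, it then outputs one, and it outputs
none otherwise. -/
def LieOutput.IsCorrect {K : Type u} {L : Type v} [Field K] [Field L] [Algebra K L] {n : ℕ}
    (out : LieOutput L n) (f : MvPolynomial (Fin n) K) : Prop :=
  IsLieBasis out.basis f ∧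
  (out.accepted = true ↔ HasIndependentFactorization L f) ∧
  (HasIndependentFactorization L f → ∃ fac, out.factorization = some fac ∧ fac.IsFor f) ∧
  (¬ HasIndependentFactorization L f → out.factorization = none)

/-! ## Program logic -/

namespace Prog

variable {L : Type u} [Field L] {n : ℕ} {α : Type v} {β : Type w}
  {O : (Fin n → L) → L} {E : (m : ℕ) → Matrix (Fin m) (Fin m) L → List L}

/-! Write `D_A f = ∑ a_ij x_j ∂f/∂x_i`. Since `f((1 + εA)x) = f + ε D_A f` over the dual numbers,
the Lie algebra of `f` is the space of linear relations among the `n²` polynomials `x_j ∂f/∂x_i`,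
and a linear change of variables conjugates it.

The criterion is settled in eigencoordinates. If all variables occur in a monomial `x^e`, the terms
`x_j ∂_i x^e` with `i ≠ j` are distinct monomials, so its Lie algebra consists of the diagonal
matrices `diag(q)` with `q ⊥ e`, a space of dimension `n - 1`. Conversely, suppose that the Lie
algebra of a homogeneous `g` consists of diagonal matrices and has dimension `n - 1`. Each exponent
vector in the support of `g` is orthogonal to the same hyperplane of diagonals, so these vectors are
proportional; having the same degree they are equal, and `g` is a monomial. A missing variable would
produce an off-diagonal element, so all variables occur (`eq_monomial_of_lieSubmodule`). Over an
algebraically closed field commuting matrices with separable minimal polynomials are simultaneously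
diagonalizable, which gives `IsBasisOfLie.criterion`.

Randomness enters three times, each time through Schwartz–Zippel. Random points miss a relation only
if a certain determinant of degree at most `n²(d + 1)` vanishes (`exists_polynomial_relations`). A
random combination of the basis has a repeated eigenvalue only if a product of at most `n²` linear
forms vanishes; these forms are nonzero because the diagonals span `e^⊥`, which separates any two
coordinates (`simulDiag_failProb_le`). The last point is useless only if `f` vanishes there. When
nothing fails, the left eigenspaces of the combination are lines spanned by the linear forms, the
diagonals have orthogonal complement spanned by `e`, and one value of `f` gives the scalar.

The basis is defined over `K` although the computation takes place in `L`: the sample points are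
integral and elimination commutes with field embeddings (`kernelFn_map`).

Two program logics carry this over to the algorithm. `Spec` bounds the cost and describes the output
on every run; `failProb` adds up failure probabilities along sequential composition. Once the random
numbers are drawn each stage is deterministic, so the same description of its continuation serves
both logics. -/

theorem run_bind (p : Prog L n α) (k : α → Prog L n β) :
    (p.bind k).run O E = (p.run O E).bind fun r =>
      ((k r.output).run O E).map (RunResult.charge r.steps r.eigenCalls) := by
  -- The common induction step of all instructions: a charge made in front of a composition can be
  -- moved onto its first component, because charges add up.
  have key (q : Prog L n α) (k : α → Prog L n β) (s e : ℕ)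
      (h : (q.bind k).run O E = (q.run O E).bind fun r =>
        ((k r.output).run O E).map (RunResult.charge r.steps r.eigenCalls)) :
      ((q.bind k).run O E).map (RunResult.charge s e) =
        ((q.run O E).map (RunResult.charge s e)).bind fun r =>
        ((k r.output).run O E).map (RunResult.charge r.steps r.eigenCalls) := by
    rw [h, PMF.map_bind, PMF.bind_map]
    congr 1
    funext r
    rw [PMF.map_comp, Function.comp_apply]
    congr 1
    funext x
    simp [RunResult.charge, add_assoc]
  induction p with
  | ret a =>
    have : (RunResult.charge 0 0 : RunResult β → RunResult β) = id := by
      funext r; simp [RunResult.charge]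
    simp [bind, run, PMF.pure_bind, this, PMF.map_id]
  | lit c next ih => exact key _ _ _ _ (ih _)
  | op o x y next ih => exact key _ _ _ _ (ih _)
  | isZero x next ih => exact key _ _ _ _ (ih _)
  | query x next ih => exact key _ _ _ _ (ih _)
  | rand m N next ih =>
    simp only [bind, run, PMF.bind_bind]
    congr 1
    funext r
    exact key _ _ _ _ (ih _)
  | eig m M next ih => exact key _ _ _ _ (ih _)

/-- Every run of `p` takes at most `s` steps and `e` eigenvalue computations, and its output
satisfies `Q`. -/
def Spec (O : (Fin n → L) → L) (E : (m : ℕ) → Matrix (Fin m) (Fin m) L → List L)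
    (p : Prog L n α) (s e : ℕ) (Q : α → Prop) : Prop :=
  ∀ r ∈ (p.run O E).support, r.steps ≤ s ∧ r.eigenCalls ≤ e ∧ Q r.output

/-! ### Cost and output rules for instructions, loops and basic matrix arithmetic. -/

namespace Spec

variable {p : Prog L n α} {s s' e e' m N : ℕ} {Q Q' : α → Prop} {R : β → Prop}

theorem mono (h : Spec O E p s e Q) (hs : s ≤ s') (he : e ≤ e') (hQ : ∀ a, Q a → Q' a) :
    Spec O E p s' e' Q' := fun r hr =>
  ⟨(h r hr).1.trans hs, (h r hr).2.1.trans he, hQ _ (h r hr).2.2⟩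

theorem post (h : Spec O E p s e Q) (hQ : ∀ a, Q a → Q' a) : Spec O E p s e Q' :=
  h.mono le_rfl le_rfl hQ

theorem steps_le (h : Spec O E p s e Q) (hs : s ≤ s') : Spec O E p s' e Q :=
  h.mono hs le_rfl fun _ => id

theorem ret {a : α} (h : Q a) : Spec O E (.ret a) s e Q := by
  intro r hr
  simp only [run, PMF.support_pure, Set.mem_singleton_iff] at hr
  subst hr
  exact ⟨Nat.zero_le _, Nat.zero_le _, h⟩

theorem of_map (h : Spec O E p s e Q) {c c' : ℕ} {r : RunResult α}
    (hr : r ∈ ((p.run O E).map (RunResult.charge c c')).support) :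
    r.steps ≤ s + c ∧ r.eigenCalls ≤ e + c' ∧ Q r.output := by
  rw [PMF.support_map] at hr
  obtain ⟨r, hr, rfl⟩ := hr
  obtain ⟨h1, h2, h3⟩ := h r hr
  exact ⟨Nat.add_le_add_right h1 _, Nat.add_le_add_right h2 _, h3⟩

theorem lit {k : ℕ} {next : L → Prog L n α} (h : Spec O E (next k) s e Q) :
    Spec O E (.lit k next) (s + 1) e Q := fun _ hr => h.of_map hr

theorem op {o : ArithOp} {x y : L} {next : L → Prog L n α}
    (h : Spec O E (next (o.eval x y)) s e Q) :
    Spec O E (.op o x y next) (s + 1) e Q := fun _ hr => h.of_map hr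

theorem isZero {x : L} {next : Bool → Prog L n α}
    (h : ∀ b : Bool, (b = true ↔ x = 0) → Spec O E (next b) s e Q) :
    Spec O E (.isZero x next) (s + 1) e Q := fun _ hr => (h _ (by simp)).of_map hr

theorem query {x : Fin n → L} {next : L → Prog L n α} (h : Spec O E (next (O x)) s e Q) :
    Spec O E (.query x next) (s + 1) e Q := fun _ hr => h.of_map hr

theorem rand {next : (Fin m → L) → Prog L n α}
    (h : ∀ r : Fin m → Fin (N + 1), Spec O E (next fun i => ((r i : ℕ) : L)) s e Q) :
    Spec O E (.rand m N next) (s + m) e Q := by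
  intro r hr
  simp only [run, PMF.mem_support_bind_iff] at hr
  obtain ⟨x, -, hx⟩ := hr
  exact (h x).of_map hx

theorem eig {M : Matrix (Fin m) (Fin m) L} {next : List L → Prog L n α}
    (h : Spec O E (next (E m M)) s e Q) :
    Spec O E (.eig m M next) (s + m * m) (e + 1) Q := fun _ hr => h.of_map hr

theorem bind {k : α → Prog L n β} (h : Spec O E p s e Q)
    (hk : ∀ a, Q a → Spec O E (k a) s' e' R) :
    Spec O E (p.bind k) (s + s') (e + e') R := by
  intro r hr
  rw [run_bind, PMF.mem_support_bind_iff] at hr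
  obtain ⟨r0, h0, h1⟩ := hr
  obtain ⟨a1, a2, a3⟩ := h r0 h0
  obtain ⟨b1, b2, b3⟩ := (hk _ a3).of_map h1
  exact ⟨by omega, by omega, b3⟩

/-- Composition of programs without eigenvalue computations. -/
theorem bind₀ {k : α → Prog L n β} (h : Spec O E p s 0 Q)
    (hk : ∀ a, Q a → Spec O E (k a) s' e' R) :
    Spec O E (p.bind k) (s + s') e' R :=
  (h.bind hk).mono le_rfl (by simp) fun _ => id

theorem tabulate_pred {g : Fin m → Prog L n α} {Q : Fin m → α → Prop}
    (h : ∀ i, Spec O E (g i) s 0 (Q i)) :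
    Spec O E (tabulate m g) (m * s) 0 (fun a => ∀ i, Q i (a i)) := by
  induction m with
  | zero => exact ret fun i => i.elim0
  | succ m ih =>
    refine ((h 0).bind₀ fun a ha => (ih fun i => h i.succ).bind₀ fun v hv =>
      ret (s := 0) ?_).steps_le (by rw [add_zero, Nat.succ_mul, add_comm])
    exact fun i => Fin.cases ha hv i

theorem tabulate {g : Fin m → Prog L n α} {a : Fin m → α}
    (h : ∀ i, Spec O E (g i) s 0 (· = a i)) :
    Spec O E (tabulate m g) (m * s) 0 (· = a) :=
  (tabulate_pred h).post fun _ hb => funext hb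

theorem mapList {g : α → Prog L n β} {φ : α → β} {l : List α}
    (h : ∀ a ∈ l, Spec O E (g a) s 0 (· = φ a)) :
    Spec O E (mapList g l) (l.length * s) 0 (· = l.map φ) := by
  induction l with
  | nil => exact ret rfl
  | cons x l ih =>
    refine ((h x (by simp)).bind₀ fun b hb => (ih fun a ha => h a (by simp [ha])).bind₀
      fun l' hl' => ret (s := 0) ?_).steps_le (by simp; ring_nf; rfl)
    rw [hb, hl', List.map_cons]

theorem allList {g : α → Prog L n Bool} {P : α → Prop} {l : List α}
    (h : ∀ a ∈ l, Spec O E (g a) s 0 (fun b => b = true ↔ P a)) :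
    Spec O E (allList g l) (l.length * s) 0 (fun b => b = true ↔ ∀ a ∈ l, P a) := by
  induction l with
  | nil => exact ret (by simp)
  | cons x l ih =>
    refine ((h x (by simp)).bind₀ (s' := l.length * s) fun b hb => ?_).steps_le
      (by simp; ring_nf; rfl)
    cases b with
    | true =>
      simp only [if_true]
      exact (ih fun a ha => h a (by simp [ha])).post fun b hb' => by simp_all
    | false => exact ret (by simp_all)

theorem sum {g : Fin m → Prog L n L} {a : Fin m → L} (h : ∀ i, Spec O E (g i) s 0 (· = a i)) :
    Spec O E (Prog.sum m g) (m * (s + 1) + 1) 0 (· = ∑ i, a i) := by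
  induction m with
  | zero => exact (lit (ret (by simp))).steps_le (Nat.le_refl (0 + 1)) |>.steps_le (by simp)
  | succ m ih =>
    refine ((h 0).bind₀ fun a ha => (ih fun i => h i.succ).bind₀ fun v hv =>
      op (ret (s := 0) ?_)).steps_le (by ring_nf; rfl)
    rw [Fin.sum_univ_succ, ha, hv, ArithOp.eval]

theorem prod {g : Fin m → Prog L n L} {a : Fin m → L} (h : ∀ i, Spec O E (g i) s 0 (· = a i)) :
    Spec O E (Prog.prod m g) (m * (s + 1) + 1) 0 (· = ∏ i, a i) := by
  induction m with
  | zero => exact (lit (ret (by simp))).steps_le (Nat.le_refl (0 + 1)) |>.steps_le (by simp)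
  | succ m ih =>
    refine ((h 0).bind₀ fun a ha => (ih fun i => h i.succ).bind₀ fun v hv =>
      op (ret (s := 0) ?_)).steps_le (by ring_nf; rfl)
    rw [Fin.prod_univ_succ, ha, hv, ArithOp.eval]

theorem dot {u v : Fin m → L} : Spec O E (Prog.dot u v) (m * 2 + 1) 0 (· = u ⬝ᵥ v) :=
  sum fun _ => op (ret rfl)

theorem matMul {A B : Matrix (Fin m) (Fin m) L} :
    Spec O E (Prog.matMul A B) (m * (m * (m * 2 + 1))) 0 (· = A * B) :=
  tabulate fun _ => tabulate fun _ => dot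

theorem commuteTest {A B : Matrix (Fin m) (Fin m) L} :
    Spec O E (Prog.commuteTest A B) (2 * (m * (m * (m * 2 + 1))) + m * (m * 2)) 0
      (fun b => b = true ↔ A * B = B * A) := by
  refine (matMul.bind₀ fun P hP => matMul.bind₀ (s' := m * (m * 2)) fun Q hQ => ?_).steps_le
    (by ring_nf; rfl)
  refine ((allList (P := fun i => ∀ j ∈ List.finRange m, P i j = Q i j) fun i _ =>
    allList fun j _ => op (isZero fun b hb => ret (s := 0) ?_)).post fun b hb => ?_).steps_le
    (by simp)
  · rw [hb, ArithOp.eval, sub_eq_zero]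
  · rw [hb, ← hP, ← hQ, ← Matrix.ext_iff]
    simp

end Spec

/-! ### Failure probabilities -/

/-- The probability that the output of `p` does not satisfy `Q`. -/
noncomputable def failProb (O : (Fin n → L) → L)
    (E : (m : ℕ) → Matrix (Fin m) (Fin m) L → List L) (p : Prog L n α) (Q : α → Prop) : ENNReal :=
  (p.run O E).toOuterMeasure {r | ¬ Q r.output}

/-- A union bound: outside `G` the conditional probability is estimated by `1`, inside by `ε'`, and
`p` has total mass `1`. -/
theorem toOuterMeasure_bind_le {α : Type v} {β : Type w} (p : PMF α) (k : α → PMF β) (G : Set α)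
    (s : Set β) {ε ε' : ENNReal} (hp : p.toOuterMeasure Gᶜ ≤ ε)
    (hk : ∀ a ∈ G, (k a).toOuterMeasure s ≤ ε') : (p.bind k).toOuterMeasure s ≤ ε + ε' := by
  classical
  rw [PMF.toOuterMeasure_bind_apply]
  calc ∑' a, p a * (k a).toOuterMeasure s
      ≤ ∑' a, (Gᶜ.indicator p a + p a * ε') := by
        refine ENNReal.tsum_le_tsum fun a => ?_
        by_cases ha : a ∈ G
        · exact (mul_le_mul_right (hk a ha) _).trans le_add_self
        · rw [Set.indicator_of_mem (by simpa using ha)]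
          refine le_add_right ?_
          have : (k a).toOuterMeasure s ≤ 1 := by
            rw [PMF.toOuterMeasure_apply, ← (k a).tsum_coe]
            exact ENNReal.tsum_le_tsum fun b => Set.indicator_le_self _ _ _
          exact (mul_le_mul_right this _).trans (mul_one _).le
    _ = p.toOuterMeasure Gᶜ + ε' := by
        rw [ENNReal.tsum_add, ENNReal.tsum_mul_right, p.tsum_coe, one_mul,
          PMF.toOuterMeasure_apply]
    _ ≤ ε + ε' := by gcongr

/-- The bridge between the two logics: a property of all outcomes in the support fails with
probability zero. -/
theorem Spec.failProb_le {p : Prog L n α} {s e : ℕ} {Q : α → Prop} (h : Spec O E p s e Q)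
    (ε : ENNReal) : failProb O E p Q ≤ ε := by
  refine le_trans (le_of_eq ?_) (zero_le (a := ε))
  rw [failProb, PMF.toOuterMeasure_apply_eq_zero_iff, Set.disjoint_left]
  exact fun r hr hr' => hr' (h r hr).2.2

theorem failProb_bind_le {p : Prog L n α} {k : α → Prog L n β} {Q : α → Prop} {R : β → Prop}
    {ε ε' : ENNReal} (hp : failProb O E p Q ≤ ε) (hk : ∀ a, Q a → failProb O E (k a) R ≤ ε') :
    failProb O E (p.bind k) R ≤ ε + ε' := by
  rw [failProb, run_bind]
  refine toOuterMeasure_bind_le _ _ {r : RunResult α | Q r.output} _ hp fun r hr => ?_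
  rw [PMF.toOuterMeasure_map_apply]
  exact hk _ hr

theorem Spec.failProb_bind_le {p : Prog L n α} {k : α → Prog L n β} {s e : ℕ} {Q : α → Prop}
    {R : β → Prop} {ε : ENNReal} (hp : Spec O E p s e Q)
    (hk : ∀ a, Q a → failProb O E (k a) R ≤ ε) : failProb O E (p.bind k) R ≤ ε := by
  simpa using Prog.failProb_bind_le (hp.failProb_le 0) hk

theorem failProb_rand_le {m N : ℕ} {next : (Fin m → L) → Prog L n α} {Q : α → Prop}
    {ε ε' : ENNReal} (G : Set (Fin m → Fin (N + 1)))
    (hG : (PMF.uniformOfFintype (Fin m → Fin (N + 1))).toOuterMeasure Gᶜ ≤ ε)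
    (h : ∀ r ∈ G, failProb O E (next fun i => ((r i : ℕ) : L)) Q ≤ ε') :
    failProb O E (.rand m N next) Q ≤ ε + ε' := by
  rw [failProb, run]
  refine toOuterMeasure_bind_le _ _ G _ hG fun r hr => ?_
  rw [PMF.toOuterMeasure_map_apply]
  exact h _ hr

/-- The Schwartz–Zippel lemma for random integers. -/
theorem uniform_eval_eq_zero_le [CharZero L] {m N D : ℕ} {p : MvPolynomial (Fin m) L} (hp : p ≠ 0)
    (hD : p.totalDegree ≤ D) :
    (PMF.uniformOfFintype (Fin m → Fin (N + 1))).toOuterMeasure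
      {r | MvPolynomial.eval (fun i => ((r i : ℕ) : L)) p ≠ 0}ᶜ ≤
      (D : ENNReal) / ((N + 1 : ℕ) : ENNReal) := by
  classical
  set ι : Fin (N + 1) → L := fun k => ((k : ℕ) : L) with hι
  -- Characteristic zero keeps the `N + 1` integers distinct in `L`, so counting draws is the same
  -- as counting points of a grid over a set of size `N + 1`.
  have hinj : Function.Injective ι := fun a b h => Fin.ext (Nat.cast_injective h)
  set S : Finset L := Finset.univ.image ι
  have hS : S.card = N + 1 := by
    rw [Finset.card_image_of_injective _ hinj, Finset.card_univ, Fintype.card_fin]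
  set T : Finset (Fin m → Fin (N + 1)) :=
    Finset.univ.filter fun r => MvPolynomial.eval (fun i => ι (r i)) p = 0 with hT
  have hTS : T.card ≤
      ((Fintype.piFinset fun _ => S).filter fun x => MvPolynomial.eval x p = 0).card := by
    refine Finset.card_le_card_of_injOn (fun r i => ι (r i)) (fun r hr => ?_) fun a _ b _ h => ?_
    · have hr' : MvPolynomial.eval (fun i => ι (r i)) p = 0 := by simpa [hT] using hr
      simp [S, hr']
    · exact funext fun i => hinj (congrFun h i)
  have hsz := MvPolynomial.schwartz_zippel_totalDegree hp S
  rw [hS] at hsz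
  have hcard : T.card * (N + 1) ≤ D * (N + 1) ^ m := by
    have h1 : (T.card : ℚ≥0) / ((N + 1 : ℕ) : ℚ≥0) ^ m ≤ (D : ℚ≥0) / ((N + 1 : ℕ) : ℚ≥0) :=
      le_trans (by gcongr) (hsz.trans (by gcongr))
    rw [div_le_div_iff₀ (by positivity) (by positivity)] at h1
    exact_mod_cast h1
  have hset : {r : Fin m → Fin (N + 1) | MvPolynomial.eval (fun i => ((r i : ℕ) : L)) p ≠ 0}ᶜ =
      (T : Set (Fin m → Fin (N + 1))) := by
    ext r
    simp [hT, hι]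
  rw [hset, PMF.toOuterMeasure_uniformOfFintype_apply]
  have hb : ((N + 1 : ℕ) : ENNReal) ≠ 0 := by simp
  have hb' : ((N + 1 : ℕ) : ENNReal) ≠ ⊤ := ENNReal.natCast_ne_top _
  rw [ENNReal.div_le_iff (by simp) (by simp), ENNReal.div_eq_inv_mul, mul_assoc,
    ← ENNReal.div_eq_inv_mul, ENNReal.le_div_iff_mul_le (Or.inl hb) (Or.inl hb')]
  simp only [Finset.coe_sort_coe, Fintype.card_coe, Fintype.card_pi, Fintype.card_fin,
    Finset.prod_const, Finset.card_univ]
  exact_mod_cast hcard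

end Prog

/-! ## Null spaces -/

namespace Prog

section kernelFn

variable {K : Type u} [Field K] {m : ℕ}

theorem linearIndependent_get_cons {V : Type v} [AddCommGroup V] [Module K V] {x : V} {l : List V} :
    LinearIndependent K (x :: l).get ↔
      LinearIndependent K l.get ∧ x ∉ Submodule.span K {y | y ∈ l} := by
  have : (x :: l).get = (Fin.cons x l.get : Fin (l.length + 1) → V) := by
    funext i
    exact Fin.cases rfl (fun _ => rfl) i
  rw [← Set.range_list_get, ← linearIndependent_finCons, ← this]

theorem linearIndependent_get_map {V V' : Type*} [AddCommGroup V'] [Module K V'] (f : V → V')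
    (l : List V) : LinearIndependent K (l.map f).get ↔ LinearIndependent K (f ∘ l.get) := by
  rw [← linearIndependent_equiv (finCongr (List.length_map f).symm)]
  have : (l.map f).get ∘ finCongr (List.length_map f).symm = f ∘ l.get :=
    funext fun i => List.getElem_map f
  rw [this]

open scoped Classical in
/-- The result of imposing one linear equation, see `Prog.kernelStep`. -/
noncomputable def kernelStepFn (w : Fin m → K) : List (Fin m → K) → List (Fin m → K)
  | [] => []
  | v :: V => if w ⬝ᵥ v = 0 then v :: kernelStepFn w V
      else V.map fun u i => u i - (w ⬝ᵥ u) / (w ⬝ᵥ v) * v i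

/-- The result of imposing linear equations, see `Prog.kernelFrom`. -/
noncomputable def kernelFromFn (W V : List (Fin m → K)) : List (Fin m → K) :=
  W.foldl (fun V w => kernelStepFn w V) V

/-- The basis of the null space that is computed by `Prog.kernel`. -/
noncomputable def kernelFn (W : List (Fin m → K)) : List (Fin m → K) :=
  kernelFromFn W ((List.finRange m).map fun i => Pi.single i 1)

theorem length_kernelStepFn_le (w : Fin m → K) (V : List (Fin m → K)) :
    (kernelStepFn w V).length ≤ V.length := by
  induction V with
  | nil => simp [kernelStepFn]
  | cons v V ih =>
    rw [kernelStepFn]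
    split_ifs <;> simp [ih]

theorem span_cons {V : Type v} [AddCommGroup V] [Module K V] (x : V) (l : List V) :
    Submodule.span K {y | y ∈ x :: l} = Submodule.span K {x} ⊔ Submodule.span K {y | y ∈ l} := by
  rw [← Submodule.span_union]
  congr 1
  ext y
  simp

/-- A head orthogonal to `w` is kept. At the first `v` with `w ⬝ᵥ v ≠ 0`, the remaining vectors are
projected to `ker w` along `v`. The projection has kernel in the line of `v`, which meets their span
trivially, so they stay independent. -/
theorem kernelStepFn_spec (w : Fin m → K) (V : List (Fin m → K)) (hV : LinearIndependent K V.get) :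
    LinearIndependent K (kernelStepFn w V).get ∧
      Submodule.span K {x | x ∈ kernelStepFn w V} =
        Submodule.span K {x | x ∈ V} ⊓ LinearMap.ker (dotProductBilin K K w) := by
  induction V with
  | nil => simp [kernelStepFn]
  | cons v V ih =>
    obtain ⟨hV', hv⟩ := linearIndependent_get_cons.1 hV
    obtain ⟨h1, h2⟩ := ih hV'
    by_cases h : w ⬝ᵥ v = 0
    · rw [show kernelStepFn w (v :: V) = v :: kernelStepFn w V from if_pos h]
      refine ⟨linearIndependent_get_cons.2 ⟨h1, fun hm => hv ?_⟩, ?_⟩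
      · rw [h2] at hm
        exact hm.1
      · rw [span_cons, span_cons, h2]
        -- The modular law, applicable because `v` lies in `ker w`.
        refine (sup_inf_assoc_of_le (Submodule.span K {x | x ∈ V}) ?_).symm
        rw [Submodule.span_singleton_le_iff_mem]
        simpa using h
    · set T : (Fin m → K) →ₗ[K] (Fin m → K) :=
        LinearMap.id - ((w ⬝ᵥ v)⁻¹ • (dotProductBilin K K w)).smulRight v with hT
      have hTa (u : Fin m → K) : T u = fun i => u i - (w ⬝ᵥ u) / (w ⬝ᵥ v) * v i := by
        funext i
        simp [hT, div_eq_inv_mul]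
      have hmap : (V.map fun u i => u i - (w ⬝ᵥ u) / (w ⬝ᵥ v) * v i) = V.map T :=
        List.map_congr_left fun u _ => (hTa u).symm
      have hset : {x | x ∈ V.map T} = T '' {x | x ∈ V} := by ext; simp
      have hker : LinearMap.ker T ≤ Submodule.span K {v} := by
        intro u hu
        rw [LinearMap.mem_ker, hTa] at hu
        refine Submodule.mem_span_singleton.2 ⟨(w ⬝ᵥ u) / (w ⬝ᵥ v), funext fun i => ?_⟩
        simpa using (sub_eq_zero.1 (congrFun hu i)).symm
      have hdis : Disjoint (Submodule.span K (Set.range V.get)) (LinearMap.ker T) := by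
        refine Disjoint.mono_right hker ?_
        rw [Set.range_list_get, Submodule.disjoint_span_singleton]
        exact fun hm => absurd hm hv
      have hTw (u : Fin m → K) : w ⬝ᵥ T u = 0 := by
        rw [show T u = u - ((w ⬝ᵥ u) / (w ⬝ᵥ v)) • v from by rw [hTa]; rfl, dotProduct_sub,
          dotProduct_smul, smul_eq_mul, div_mul_cancel₀ _ h, sub_self]
      rw [show kernelStepFn w (v :: V) = V.map T from (if_neg h).trans hmap]
      constructor
      · exact (linearIndependent_get_map _ _).2 (hV'.map hdis)
      · rw [hset, Submodule.span_image, span_cons]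
        apply le_antisymm
        · rintro _ ⟨u, hu, rfl⟩
          refine ⟨?_, by simpa using hTw u⟩
          rw [show T u = u - ((w ⬝ᵥ u) / (w ⬝ᵥ v)) • v from by rw [hTa]; rfl]
          exact sub_mem (Submodule.mem_sup_right hu) (Submodule.mem_sup_left
            (Submodule.smul_mem _ _ (Submodule.mem_span_singleton_self v)))
        · rintro x ⟨hx, hxw⟩
          obtain ⟨y, hy, z, hz, rfl⟩ := Submodule.mem_sup.1 hx
          obtain ⟨c, rfl⟩ := Submodule.mem_span_singleton.1 hy
          refine ⟨z, hz, ?_⟩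
          have hTv : T v = 0 := by
            rw [hTa]; funext i; simp [div_self h]
          -- The projection fixes `ker w` and kills `v`, so an element `c • v + z` of `ker w` is the
          -- image of `z` alone.
          have hTx : T (c • v + z) = c • v + z := by
            have : w ⬝ᵥ (c • v + z) = 0 := by simpa using hxw
            rw [hTa, this]
            funext i
            simp
          rw [← hTx, map_add, map_smul, hTv, smul_zero, zero_add]

theorem kernelFromFn_spec (W V : List (Fin m → K)) (hV : LinearIndependent K V.get) :
    LinearIndependent K (kernelFromFn W V).get ∧
      ∀ x, x ∈ Submodule.span K {x | x ∈ kernelFromFn W V} ↔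
        x ∈ Submodule.span K {x | x ∈ V} ∧ ∀ w ∈ W, w ⬝ᵥ x = 0 := by
  induction W generalizing V with
  | nil => simpa [kernelFromFn]
  | cons w W ih =>
    obtain ⟨h1, h2⟩ := kernelStepFn_spec w V hV
    obtain ⟨h3, h4⟩ := ih _ h1
    refine ⟨h3, fun x => (h4 x).trans ?_⟩
    rw [h2]
    simp [and_assoc]

theorem kernelFn_spec (W : List (Fin m → K)) :
    LinearIndependent K (kernelFn W).get ∧
      ∀ x, x ∈ Submodule.span K {x | x ∈ kernelFn W} ↔ ∀ w ∈ W, w ⬝ᵥ x = 0 := by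
  have hb : LinearIndependent K (fun i : Fin m => (Pi.single i 1 : Fin m → K)) :=
    Pi.linearIndependent_single_one (Fin m) K
  obtain ⟨h1, h2⟩ := kernelFromFn_spec W ((List.finRange m).map fun i => (Pi.single i 1 : Fin m → K))
    ((linearIndependent_get_map _ _).2 (hb.comp _ (List.nodup_iff_injective_get.1
      (List.nodup_finRange m))))
  refine ⟨h1, fun x => (h2 x).trans (and_iff_right ?_)⟩
  rw [show x = ∑ i, x i • (Pi.single i 1 : Fin m → K) from (pi_eq_sum_univ' x).trans (by congr 1)]
  exact Submodule.sum_mem _ fun i _ => Submodule.smul_mem _ _ (Submodule.subset_span (by simp))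

theorem mem_kernelFn (W : List (Fin m → K)) {x : Fin m → K} (hx : x ∈ kernelFn W) :
    ∀ w ∈ W, w ⬝ᵥ x = 0 :=
  ((kernelFn_spec W).2 x).1 (Submodule.subset_span hx)

/-- If the null space is a line, then its basis consists of one vector on this line. -/
theorem kernelFn_eq_singleton (W : List (Fin m → K)) {v : Fin m → K} (hv : v ≠ 0)
    (h : ∀ x, (∀ w ∈ W, w ⬝ᵥ x = 0) ↔ ∃ c : K, x = c • v) :
    ∃ c : K, c ≠ 0 ∧ kernelFn W = [c • v] := by
  obtain ⟨h1, h2⟩ := kernelFn_spec W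
  have hmem (x) (hx : x ∈ kernelFn W) : ∃ c : K, x = c • v := (h x).1 (mem_kernelFn W hx)
  have hspan : v ∈ Submodule.span K {x | x ∈ kernelFn W} := (h2 v).2 ((h v).2 ⟨1, by simp⟩)
  match hk : kernelFn W with
  | [] => simp [hk, hv] at hspan
  | [x] =>
    obtain ⟨c, rfl⟩ := hmem x (by simp [hk])
    refine ⟨c, fun hc => hv ?_, rfl⟩
    simpa [hk, hc] using hspan
  | x :: y :: l =>
    rw [hk] at h1
    obtain ⟨c, hc⟩ := hmem x (by simp [hk])
    obtain ⟨c', hc'⟩ := hmem y (by simp [hk])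
    obtain ⟨h3, h4⟩ := linearIndependent_get_cons.1 h1
    obtain ⟨h5, h6⟩ := linearIndependent_get_cons.1 h3
    have hy : c' ≠ 0 := by
      rintro rfl
      rw [hc', zero_smul] at h6
      exact h6 (Submodule.zero_mem _)
    refine absurd ?_ h4
    rw [hc, show c • v = (c / c') • y by rw [hc', smul_smul, div_mul_cancel₀ _ hy]]
    exact Submodule.smul_mem _ _ (Submodule.subset_span (by simp))

theorem kernelFn_eq_nil (W : List (Fin m → K)) :
    kernelFn W = [] ↔ ∀ x, (∀ w ∈ W, w ⬝ᵥ x = 0) → x = 0 := by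
  obtain ⟨h1, h2⟩ := kernelFn_spec W
  constructor
  · intro hk x hx
    simpa [hk] using (h2 x).2 hx
  · intro h
    match hk : kernelFn W with
    | [] => rfl
    | x :: l =>
      have := h x (mem_kernelFn W (by simp [hk]))
      rw [hk] at h1
      exact absurd this (h1.ne_zero (0 : Fin (l.length + 1)))

/-- Elimination consists of field operations and zero tests, and a field embedding respects both.
This is why a basis computed in `L` from data in `K` has its entries in `K`. -/
theorem kernelFn_map {L : Type v} [Field L] (φ : K →+* L) (W : List (Fin m → K)) :
    kernelFn (W.map fun w i => φ (w i)) = (kernelFn W).map fun w i => φ (w i) := by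
  have hdot (w v : Fin m → K) : (fun i => φ (w i)) ⬝ᵥ (fun i => φ (v i)) = φ (w ⬝ᵥ v) := by
    simp [dotProduct]
  have hstep (w : Fin m → K) (V : List (Fin m → K)) :
      kernelStepFn (fun i => φ (w i)) (V.map fun w i => φ (w i)) =
        (kernelStepFn w V).map fun w i => φ (w i) := by
    induction V with
    | nil => simp [kernelStepFn]
    | cons v V ih =>
      rw [List.map_cons, kernelStepFn, kernelStepFn, hdot, ih]
      by_cases h : w ⬝ᵥ v = 0
      · rw [if_pos h, if_pos (by rw [h, map_zero]), List.map_cons]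
      · rw [if_neg h, if_neg (by rwa [map_eq_zero]), List.map_map, List.map_map]
        refine List.map_congr_left fun u _ => funext fun i => ?_
        simp [hdot]
  have hfrom (W V : List (Fin m → K)) :
      kernelFromFn (W.map fun w i => φ (w i)) (V.map fun w i => φ (w i)) =
        (kernelFromFn W V).map fun w i => φ (w i) := by
    induction W generalizing V with
    | nil => simp [kernelFromFn]
    | cons w W ih =>
      have := ih (kernelStepFn w V)
      rw [← hstep] at this
      exact this
  rw [kernelFn, kernelFn, ← hfrom, List.map_map]
  congr 1
  refine List.map_congr_left fun i _ => funext fun j => ?_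
  by_cases h : j = i <;> simp [h]

end kernelFn

namespace Spec

variable {L : Type u} [Field L] {n m : ℕ} {O : (Fin n → L) → L}
  {E : (m : ℕ) → Matrix (Fin m) (Fin m) L → List L}

theorem kernelStep {w : Fin m → L} {V : List (Fin m → L)} :
    Spec O E (Prog.kernelStep w V) (V.length * (4 * m + 2)) 0 (· = kernelStepFn w V) := by
  classical
  induction V with
  | nil => exact ret rfl
  | cons v V ih =>
    refine (dot.bind₀ (s' := V.length * (4 * m + 2) + 1) fun c hc => isZero fun b hb => ?_).steps_le
      (by simp; ring_nf; omega)
    rw [kernelStepFn]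
    subst hc
    cases b with
    | true =>
      simp only [if_true]
      rw [if_pos (hb.1 rfl)]
      exact (ih.bind₀ fun V' hV' => ret (s := 0) (by rw [hV'])).steps_le (by simp)
    | false =>
      simp only [Bool.false_eq_true, if_false]
      rw [if_neg (by simpa using hb)]
      refine (mapList (s := 4 * m + 2) fun u _ => (dot.bind₀ (s' := m * 2 + 1) fun c' hc' =>
        op ?_).steps_le (by omega))
      subst hc'
      exact tabulate fun i => op (op (ret rfl))

theorem kernelFrom {W V : List (Fin m → L)} :
    Spec O E (Prog.kernelFrom W V) (W.length * (V.length * (4 * m + 2))) 0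
      (· = kernelFromFn W V) := by
  induction W generalizing V with
  | nil => exact ret rfl
  | cons w W ih =>
    refine (kernelStep.bind₀ (s' := W.length * (V.length * (4 * m + 2))) fun V' hV' =>
      (ih (V := V')).mono ?_ le_rfl ?_).steps_le (by simp; ring_nf; rfl)
    · subst hV'
      gcongr
      exact length_kernelStepFn_le w V
    · rintro _ rfl
      rw [hV']
      rfl

theorem kernel {W : List (Fin m → L)} :
    Spec O E (Prog.kernel W) (m * m + W.length * (m * (4 * m + 2))) 0 (· = kernelFn W) := by
  have h1 : Spec O E (Prog.mapList (fun i : Fin m => Prog.tabulate m fun j =>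
      (.lit (if i = j then 1 else 0) .ret : Prog L n L)) (List.finRange m)) (m * (m * (0 + 1))) 0
      (· = (List.finRange m).map fun i => Pi.single i 1) := by
    refine (mapList fun i _ => tabulate fun j => lit (ret (s := 0) ?_)).steps_le (by simp)
    by_cases h : i = j <;> simp [h, eq_comm]
  refine (h1.bind₀ (s' := W.length * (m * (4 * m + 2))) (R := (· = kernelFn W))
    fun V hV => ?_).steps_le (by simp)
  subst hV
  exact kernelFrom.steps_le (by simp)

end Spec
end Prog

/-! ## The test for diagonalizability -/

namespace Prog

section minpoly

open Polynomial

variable {L : Type u} [Field L] {m k : ℕ}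

/-- A minimal polynomial of smaller degree would be a relation among these powers with leading
coefficient `1`. -/
theorem le_natDegree_minpoly {M : Matrix (Fin m) (Fin m) L}
    (hI : LinearIndependent L fun l : Fin k => M ^ (l : ℕ)) : k ≤ (minpoly L M).natDegree := by
  by_contra! hlt
  have h0 := minpoly.aeval L M
  rw [aeval_eq_sum_range' hlt, ← Fin.sum_univ_eq_sum_range
    (fun i => (minpoly L M).coeff i • M ^ i)] at h0
  have := Fintype.linearIndependent_iff.1 hI _ h0 ⟨_, hlt⟩
  rw [coeff_natDegree, (minpoly.monic (Matrix.isIntegral M)).leadingCoeff] at this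
  exact one_ne_zero this

theorem mulVec_eq_zero_imp_iff {D : Matrix (Fin m) (Fin m) L} :
    (∀ x, D.mulVec x = 0 → x = 0) ↔ IsUnit D := by
  rw [← Matrix.mulVec_injective_iff_isUnit, ← Matrix.coe_mulVecLin, injective_iff_map_eq_zero]

/-- Let `g` be the gcd and `minpoly = g * s`. Then `q(M) s(M) = 0`, so if `q(M)` is invertible,
`minpoly` divides `s` and `g` is a unit. The other direction is Bézout evaluated at `M`. -/
theorem isUnit_aeval_iff {M : Matrix (Fin m) (Fin m) L} {q : L[X]} :
    IsUnit (aeval M q) ↔ IsCoprime (minpoly L M) q := by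
  classical
  constructor
  · intro h
    rw [← EuclideanDomain.gcd_isUnit_iff]
    obtain ⟨s, hs⟩ := EuclideanDomain.gcd_dvd_left (minpoly L M) q
    obtain ⟨t, ht⟩ := EuclideanDomain.gcd_dvd_right (minpoly L M) q
    set g := EuclideanDomain.gcd (minpoly L M) q
    have hmon := minpoly.monic (Matrix.isIntegral (R := L) M)
    have h1 : aeval M q * aeval M s = 0 := by
      rw [ht, ← map_mul, show g * t * s = t * (g * s) by ring, ← hs, map_mul, minpoly.aeval,
        mul_zero]
    have h2 : aeval M s = 0 := (h.mul_right_eq_zero).1 h1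
    have hs0 : s ≠ 0 := by
      rintro rfl
      exact hmon.ne_zero (by rw [hs, mul_zero])
    have hd : minpoly L M ∣ s := minpoly.dvd L M h2
    obtain ⟨u, hu⟩ := hd
    refine IsUnit.of_mul_eq_one u ?_
    have : s * (g * u) = s * 1 := by
      calc s * (g * u) = (g * s) * u := by ring
        _ = s * 1 := by rw [← hs, ← hu, mul_one]
    exact mul_left_cancel₀ hs0 this
  · rintro ⟨a, b, hab⟩
    have := congrArg (aeval M) hab
    rw [map_add, map_mul, map_mul, minpoly.aeval, mul_zero, zero_add, map_one] at this
    exact IsUnit.of_mul_eq_one_right _ this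

/-- The relation is a nonzero polynomial `p` of degree at most `k` that kills `M`, while
independence of the first `k` powers forces the minimal polynomial to have degree at least `k`. So
`p` is a scalar multiple of it, and the sum in question is `p'(M)`. -/
theorem isUnit_iff_separable_minpoly {M : Matrix (Fin m) (Fin m) L}
    (hI : LinearIndependent L fun l : Fin k => M ^ (l : ℕ)) {c : Fin (k + 1) → L} (hc : c ≠ 0)
    (h : ∑ l, c l • M ^ (l : ℕ) = 0) :
    IsUnit (∑ l : Fin k, (((l : ℕ) + 1 : ℕ) * c l.succ) • M ^ (l : ℕ)) ↔
      (minpoly L M).Separable := by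
  set p : L[X] := ∑ l, C (c l) * X ^ (l : ℕ) with hp
  have hpc (l : Fin (k + 1)) : p.coeff l = c l := by
    rw [hp, finsetSum_coeff]
    simp [coeff_X_pow, Fin.val_inj]
  have hp0 : p ≠ 0 := fun h0 => hc (funext fun l => by rw [← hpc, h0]; simp)
  have hpM : aeval M p = 0 := by
    rw [← h, hp, map_sum]
    exact Finset.sum_congr rfl fun l _ => by
      rw [map_mul, aeval_C, map_pow, aeval_X, Algebra.smul_def]
  have hdeg : p.natDegree ≤ k := natDegree_sum_le_of_forall_le _ _ fun l _ =>
    (natDegree_C_mul_X_pow_le _ _).trans (Nat.lt_succ_iff.1 l.2)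
  have hmon := minpoly.monic (Matrix.isIntegral (R := L) M)
  have hpm : p = C p.leadingCoeff * minpoly L M :=
    eq_leadingCoeff_mul_of_monic_of_dvd_of_natDegree_le hmon (minpoly.dvd L M hpM)
      (hdeg.trans (le_natDegree_minpoly hI))
  have hD : ∑ l : Fin k, (((l : ℕ) + 1 : ℕ) * c l.succ) • M ^ (l : ℕ) = aeval M (derivative p) := by
    rw [hp, Fin.sum_univ_succ, map_add, map_add, map_sum, map_sum]
    simp only [Fin.val_zero, pow_zero, mul_one, derivative_C, map_zero, zero_add]
    refine Finset.sum_congr rfl fun l _ => ?_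
    rw [derivative_C_mul_X_pow, map_mul, aeval_C, map_pow, aeval_X, Algebra.smul_def,
      Fin.val_succ, Nat.add_sub_cancel, mul_comm (c l.succ)]
  have hu : IsUnit (C p.leadingCoeff) := isUnit_C.2 (isUnit_iff_ne_zero.2 (by simpa using hp0))
  rw [hD, isUnit_aeval_iff, hpm, derivative_C_mul, isCoprime_mul_unit_left_right hu]
  rfl

end minpoly

/-- A bound for the cost of `Prog.diagonalizableTest`. -/
def diagonalizableCost (m : ℕ) : ℕ :=
  (m + 1) * (m + 1) + m * m * ((m + 1) * (4 * (m + 1) + 2)) + m * (m * (m * 4 + 1)) +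
    (m * m + m * (m * (4 * m + 2))) + m * (m * (m * 2 + 1))

/-- Unfolds the recursion once with the match on the null space outside the match on the fuel, so
that one round can be analysed for all values of the fuel. -/
theorem diagonalizableFrom_eq {F : Type u} {n m : ℕ} (M : Matrix (Fin m) (Fin m) F) (fuel k : ℕ)
    (P : Fin (k + 1) → Matrix (Fin m) (Fin m) F) :
    (diagonalizableFrom M fuel k P : Prog F n Bool) =
      (kernel ((List.finRange m).flatMap fun i =>
        (List.finRange m).map fun j => fun l => P l i j)).bind fun V =>
        match V with
        | c :: _ =>
          (tabulate m fun i => tabulate m fun j => sum k fun l =>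
            .lit (l.val + 1) fun z => .op .mul z (c l.succ) fun z =>
              .op .mul z (P l.castSucc i j) .ret).bind fun D : Fin m → Fin m → F =>
          (kernel (List.ofFn D)).bind fun V' => .ret V'.isEmpty
        | [] => match fuel with
          | 0 => .ret false
          | fuel + 1 => (matMul (P (Fin.last k)) M).bind fun Q =>
            diagonalizableFrom M fuel (k + 1)
              (Fin.snoc (α := fun _ => Matrix (Fin m) (Fin m) F) P Q) := by
  have key {p : Prog F n (List (Fin (k + 1) → F))} {f g : List (Fin (k + 1) → F) → Prog F n Bool}
      (h : ∀ V, f V = g V) : p.bind f = p.bind g := congrArg _ (funext h)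
  cases fuel with
  | zero =>
    delta diagonalizableFrom
    refine (key fun V => ?_ : Prog.bind _ _ = _)
    cases V <;> rfl
  | succ fuel =>
    delta diagonalizableFrom
    dsimp only [Nat.brecOn]
    refine key fun V => ?_
    cases V <;> rfl

namespace Spec

variable {L : Type u} [Field L] {n m : ℕ} {O : (Fin n → L) → L}
  {E : (m : ℕ) → Matrix (Fin m) (Fin m) L → List L}

/-- One round of the search. A relation found now is the first one, since the lower powers are
independent, and it decides the test; if none is found, one more power is independent and `hnext`
takes over. -/
theorem diagonalizableFrom_step {M : Matrix (Fin m) (Fin m) L} {fuel k t : ℕ}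
    {P : Fin (k + 1) → Matrix (Fin m) (Fin m) L} (hP : ∀ l, P l = M ^ (l : ℕ)) (hk : k ≤ m)
    (hI : LinearIndependent L fun l : Fin k => M ^ (l : ℕ))
    (hnext : (LinearIndependent L fun l : Fin (k + 1) => M ^ (l : ℕ)) →
      Spec O E (match fuel with
        | 0 => .ret false
        | fuel + 1 => (Prog.matMul (P (Fin.last k)) M).bind fun Q =>
          Prog.diagonalizableFrom M fuel (k + 1)
            (Fin.snoc (α := fun _ => Matrix (Fin m) (Fin m) L) P Q) : Prog L n Bool)
        (m * (m * (m * 2 + 1)) + t) 0 (fun b => b = true ↔ (minpoly L M).Separable)) :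
    Spec O E (Prog.diagonalizableFrom M fuel k P) (t + diagonalizableCost m) 0
      (fun b => b = true ↔ (minpoly L M).Separable) := by
  have hdot (c : Fin (k + 1) → L) (i j) :
      (fun l => P l i j) ⬝ᵥ c = (∑ l, c l • M ^ (l : ℕ)) i j := by
    simp [dotProduct, Matrix.sum_apply, hP, mul_comm]
  rw [diagonalizableFrom_eq]
  refine (kernel.bind₀ (s' := m * (m * (m * 4 + 1)) + (m * m + m * (m * (4 * m + 2))) +
    (m * (m * (m * 2 + 1)) + t)) fun V hV => ?_).steps_le ?_
  · match V with
    | c :: _ =>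
      have hc : ∑ l, c l • M ^ (l : ℕ) = 0 := by
        have := mem_kernelFn (K := L) _ (x := c) (by rw [← hV]; simp)
        ext i j
        rw [← hdot]
        exact this _ (by simp)
      have hc0 : c ≠ 0 := by
        have h1 := (kernelFn_spec ((List.finRange m).flatMap fun i =>
          (List.finRange m).map fun j => fun l => P l i j)).1
        rw [← hV] at h1
        exact h1.ne_zero (0 : Fin (_ + 1))
      have hD : Spec O E (Prog.tabulate m fun i => Prog.tabulate m fun j => Prog.sum k fun l =>
          (.lit (l.val + 1) fun z => .op .mul z (c l.succ) fun z =>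
            .op .mul z (P l.castSucc i j) .ret : Prog L n L)) (m * (m * (k * (0 + 1 + 1 + 1 + 1) + 1)))
          0 (· = fun i j => ∑ l : Fin k, ((l.val + 1 : ℕ) : L) * c l.succ * P l.castSucc i j) :=
        tabulate fun i => tabulate fun j => sum fun l => lit (op (op (ret rfl)))
      refine (hD.bind₀ (s' := m * m + m * (m * (4 * m + 2))) fun D hD =>
        (kernel.bind₀ fun V' hV' => ret (s := 0) ?_).steps_le (by simp)).steps_le ?_
      · rw [List.isEmpty_iff, hV', kernelFn_eq_nil, ← isUnit_iff_separable_minpoly hI hc0 hc,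
          ← mulVec_eq_zero_imp_iff]
        have hDM : D = ∑ l : Fin k, (((l : ℕ) + 1 : ℕ) * c l.succ) • M ^ (l : ℕ) := by
          rw [hD]
          ext i j
          simp [Matrix.sum_apply, hP]
        refine forall_congr' fun x => imp_congr_left ?_
        rw [← hDM, List.forall_mem_ofFn_iff, funext_iff]
        rfl
      · have : m * (m * (k * (0 + 1 + 1 + 1 + 1) + 1)) ≤ m * (m * (m * 4 + 1)) := by gcongr
        omega
    | [] =>
      refine (hnext ?_).steps_le (by omega)
      rw [Fintype.linearIndependent_iff]
      intro c hc
      refine congrFun ((kernelFn_eq_nil _).1 hV.symm c fun w hw => ?_)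
      simp only [List.mem_flatMap, List.mem_map] at hw
      obtain ⟨i, -, j, -, rfl⟩ := hw
      rw [hdot, hc]
      rfl
  · have h1 : ((List.finRange m).flatMap fun i =>
        (List.finRange m).map fun j => fun l => P l i j).length = m * m := by simp
    have h2 : (k + 1) * (k + 1) ≤ (m + 1) * (m + 1) := by gcongr
    have h3 : m * m * ((k + 1) * (4 * (k + 1) + 2)) ≤ m * m * ((m + 1) * (4 * (m + 1) + 2)) := by
      gcongr
    rw [h1, diagonalizableCost]
    omega

theorem diagonalizableFrom {M : Matrix (Fin m) (Fin m) L} (fuel : ℕ) : ∀ (k : ℕ)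
    (P : Fin (k + 1) → Matrix (Fin m) (Fin m) L), fuel + k = m → (∀ l, P l = M ^ (l : ℕ)) →
    (LinearIndependent L fun l : Fin k => M ^ (l : ℕ)) →
    Spec O E (Prog.diagonalizableFrom M fuel k P) ((fuel + 1) * diagonalizableCost m) 0
      (fun b => b = true ↔ (minpoly L M).Separable) := by
  induction fuel with
  | zero =>
    intro k P hk hP hI
    refine (diagonalizableFrom_step (t := 0) hP (by omega) hI fun hI' => ret ?_).steps_le (by omega)
    -- The answer given when the fuel runs out is never reached: `m + 1` independent powers would
    -- contradict Cayley–Hamilton.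
    have h1 := le_natDegree_minpoly hI'
    have h2 := Polynomial.natDegree_le_of_dvd (Matrix.minpoly_dvd_charpoly M)
      (Matrix.charpoly_monic M).ne_zero
    rw [Matrix.charpoly_natDegree_eq_dim, Fintype.card_fin] at h2
    omega
  | succ fuel ih =>
    intro k P hk hP hI
    refine (diagonalizableFrom_step (t := (fuel + 1) * diagonalizableCost m) hP (by omega) hI
      fun hI' => ?_).steps_le (by ring_nf; rfl)
    refine matMul.bind₀ fun Q hQ => ih (k + 1) _ (by omega) (fun l => ?_) hI'
    refine Fin.lastCases ?_ (fun l => ?_) l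
    · rw [Fin.snoc_last, hQ, hP, Fin.val_last, Fin.val_last, pow_succ]
    · rw [Fin.snoc_castSucc, hP, Fin.val_castSucc]

/-- The test succeeds if and only if the minimal polynomial has only simple roots. -/
theorem diagonalizableTest {M : Matrix (Fin m) (Fin m) L} :
    Spec O E (Prog.diagonalizableTest M) (m * m + (m + 1) * diagonalizableCost m) 0
      (fun b => b = true ↔ (minpoly L M).Separable) := by
  have h1 : Spec O E (Prog.tabulate m fun i => Prog.tabulate m fun j =>
      (.lit (if i = j then 1 else 0) .ret : Prog L n L)) (m * (m * (0 + 1))) 0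
      (· = (1 : Matrix (Fin m) (Fin m) L)) := by
    refine tabulate fun i => tabulate fun j => lit (ret (s := 0) ?_)
    by_cases h : i = j <;> simp [h, Matrix.one_apply]
  refine (h1.bind₀ fun I hI => ?_).steps_le (by simp; rfl)
  refine diagonalizableFrom m 0 _ rfl (fun l => ?_) linearIndependent_empty_type
  simp [hI]

end Spec
end Prog

/-! ## The Lie algebra of a polynomial -/

section LieDer

open MvPolynomial

variable {R : Type u} [CommRing R] {n : ℕ}

theorem linForm_add (a b : Fin n → R) : linForm (a + b) = linForm a + linForm b := by
  simp [linForm, add_mul, Finset.sum_add_distrib]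

theorem linForm_smul (c : R) (a : Fin n → R) : linForm (c • a) = C c * linForm a := by
  simp [linForm, Finset.mul_sum, mul_assoc]

theorem linForm_sum {ι : Type*} (s : Finset ι) (a : ι → Fin n → R) :
    linForm (∑ i ∈ s, a i) = ∑ i ∈ s, linForm (a i) := by
  classical
  induction s using Finset.induction_on with
  | empty => simp [linForm]
  | insert i s hi ih => rw [Finset.sum_insert hi, Finset.sum_insert hi, linForm_add, ih]

theorem linForm_single (i : Fin n) (c : R) : linForm (Pi.single i c) = C c * X i := by
  rw [linForm, Finset.sum_eq_single i] <;> simp +contextual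

theorem map_linForm {S : Type v} [CommRing S] (φ : R →+* S) (a : Fin n → R) :
    map φ (linForm a) = linForm fun i => φ (a i) := by
  simp [linForm]

theorem eval_linForm (a x : Fin n → R) : eval x (linForm a) = a ⬝ᵥ x := by
  simp [linForm, dotProduct]

/-- The derivation `∑ i j, a_ij * x_j * ∂ / ∂x_i`. -/
noncomputable def lieDer (A : Matrix (Fin n) (Fin n) R) :
    Derivation R (MvPolynomial (Fin n) R) (MvPolynomial (Fin n) R) :=
  mkDerivation R fun i => linForm (A i)

@[simp]
theorem lieDer_X (A : Matrix (Fin n) (Fin n) R) (i : Fin n) : lieDer A (X i) = linForm (A i) :=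
  mkDerivation_X _ _ _

theorem lieDer_C (A : Matrix (Fin n) (Fin n) R) (c : R) : lieDer A (C c) = 0 := by
  rw [← algebraMap_eq, Derivation.map_algebraMap]

theorem lieDer_apply (A : Matrix (Fin n) (Fin n) R) (f : MvPolynomial (Fin n) R) :
    lieDer A f = ∑ i, ∑ j, C (A i j) * (X j * pderiv i f) := by
  have hsum (s : Finset (Fin n)) (D : Fin n → Derivation R (MvPolynomial (Fin n) R)
      (MvPolynomial (Fin n) R)) (g) : (∑ i ∈ s, D i) g = ∑ i ∈ s, D i g := by
    classical
    induction s using Finset.induction_on with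
    | empty => simp
    | insert i s hi ih => rw [Finset.sum_insert hi, Finset.sum_insert hi, Derivation.add_apply, ih]
  -- Both sides are derivations, so it suffices to compare them on the variables.
  have h : lieDer A = ∑ i, linForm (A i) • pderiv i := by
    refine derivation_ext fun j => ?_
    rw [lieDer_X, hsum, Finset.sum_eq_single j] <;>
      simp +contextual [pderiv_X]
  rw [h, hsum]
  refine Finset.sum_congr rfl fun i _ => ?_
  rw [Derivation.smul_apply, smul_eq_mul, linForm, Finset.sum_mul]
  exact Finset.sum_congr rfl fun j _ => mul_assoc _ _ _

theorem lieDer_map {S : Type v} [CommRing S] (φ : R →+* S) (A : Matrix (Fin n) (Fin n) R)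
    (f : MvPolynomial (Fin n) R) : lieDer (A.map φ) (map φ f) = map φ (lieDer A f) := by
  simp [lieDer_apply, pderiv_map]

theorem lieDer_linForm (A : Matrix (Fin n) (Fin n) R) (a : Fin n → R) :
    lieDer A (linForm a) = linForm (Matrix.vecMul a A) := by
  have h : Matrix.vecMul a A = ∑ i, a i • A i := by
    ext j
    simp [Matrix.vecMul, dotProduct]
  rw [h, linForm_sum, linForm, map_sum]
  refine Finset.sum_congr rfl fun i _ => ?_
  rw [linForm_smul, Derivation.leibniz, lieDer_X, lieDer_C, smul_zero, add_zero, smul_eq_mul]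

/-- The matrices `A` with `∑ i j, a_ij * x_j * ∂f / ∂x_i = 0`. -/
noncomputable def lieSubmodule (f : MvPolynomial (Fin n) R) :
    Submodule R (Matrix (Fin n) (Fin n) R) where
  carrier := {A | lieDer A f = 0}
  add_mem' {A B} hA hB := by
    simp only [Set.mem_ofPred_eq, lieDer_apply] at *
    simp [add_mul, Finset.sum_add_distrib, hA, hB]
  zero_mem' := by simp [lieDer_apply]
  smul_mem' c A hA := by
    simp only [Set.mem_ofPred_eq, lieDer_apply] at *
    simp [mul_assoc, ← Finset.mul_sum, hA]

theorem mem_lieSubmodule {f : MvPolynomial (Fin n) R} {A : Matrix (Fin n) (Fin n) R} :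
    A ∈ lieSubmodule f ↔ lieDer A f = 0 := Iff.rfl

/-- First-order Taylor expansion: as `ε² = 0`, substituting `1 + εA` changes `f` by `ε` times its
derivative along `A`, and the `ε`-part of each coefficient can be read off. -/
theorem lieAlgebraOf_eq {K : Type u} [Field K] (f : MvPolynomial (Fin n) K) :
    lieAlgebraOf f = (lieSubmodule f : Set (Matrix (Fin n) (Fin n) K)) := by
  ext A
  have heps : (C DualNumber.eps : MvPolynomial (Fin n) (DualNumber K)) * C DualNumber.eps = 0 := by
    rw [← C_mul, DualNumber.eps_mul_eps, C_0]
  set M : Matrix (Fin n) (Fin n) (DualNumber K) :=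
    1 + A.map fun a => a • (DualNumber.eps : DualNumber K) with hM
  have hrow (i : Fin n) : linForm (M i) =
      X i + C (DualNumber.eps : DualNumber K) * map (algebraMap K (DualNumber K)) (linForm (A i)) := by
    have h1 : M i = (Pi.single i 1 : Fin n → DualNumber K) + (DualNumber.eps : DualNumber K) • fun j =>
        algebraMap K (DualNumber K) (A i j) := by
      funext j
      by_cases hij : i = j <;> simp [hM, hij, eq_comm, Algebra.smul_def, mul_comm]
    rw [h1, linForm_add, linForm_smul, linForm_single, map_linForm, C_1, one_mul]
  have key : substMatrix f M = map (algebraMap K (DualNumber K)) f +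
      C DualNumber.eps * map (algebraMap K (DualNumber K)) (lieDer A f) := by
    rw [substMatrix]
    induction f using MvPolynomial.induction_on with
    | C c => simp
    | add p q hp hq =>
      rw [map_add, hp, hq, map_add, map_add, map_add]
      ring
    | mul_X p i hp =>
      rw [map_mul, hp, aeval_X, hrow, Derivation.leibniz, lieDer_X, smul_eq_mul, smul_eq_mul,
        map_mul, map_X, map_add, map_mul, map_mul, map_X]
      linear_combination (map (algebraMap K (DualNumber K)) (lieDer A p) *
        map (algebraMap K (DualNumber K)) (linForm (A i))) * heps
  rw [lieAlgebraOf, Set.mem_ofPred_eq, key, add_eq_left, SetLike.mem_coe, mem_lieSubmodule]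
  constructor
  · intro h
    ext s
    have := congrArg (fun p => TrivSqZeroExt.snd (coeff s p)) h
    simp only [coeff_C_mul, coeff_map, coeff_zero, TrivSqZeroExt.snd_zero,
      TrivSqZeroExt.algebraMap_eq_inl, DualNumber.eps] at this
    simpa using this
  · intro h
    rw [h, map_zero, mul_zero]

/-- The linear change of variables `x ↦ P.x`. -/
noncomputable def linSubst (P : Matrix (Fin n) (Fin n) R) :
    MvPolynomial (Fin n) R →ₐ[R] MvPolynomial (Fin n) R :=
  aeval fun i => linForm (P i)

theorem linSubst_linForm (P : Matrix (Fin n) (Fin n) R) (a : Fin n → R) :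
    linSubst P (linForm a) = linForm (Matrix.vecMul a P) := by
  have h : Matrix.vecMul a P = ∑ i, a i • P i := by
    ext j
    simp [Matrix.vecMul, dotProduct]
  rw [h, linForm_sum, linForm, map_sum]
  refine Finset.sum_congr rfl fun i _ => ?_
  rw [linForm_smul, map_mul, linSubst, aeval_C, aeval_X, algebraMap_eq]

theorem linSubst_linSubst (P Q : Matrix (Fin n) (Fin n) R) (f : MvPolynomial (Fin n) R) :
    linSubst P (linSubst Q f) = linSubst (Q * P) f := by
  have : (linSubst P).comp (linSubst Q) = linSubst (Q * P) := by
    refine algHom_ext fun i => ?_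
    rw [AlgHom.comp_apply, linSubst, linSubst, linSubst, aeval_X, aeval_X]
    exact linSubst_linForm P (Q i)
  exact DFunLike.congr_fun this f

theorem linSubst_one (f : MvPolynomial (Fin n) R) : linSubst 1 f = f := by
  have : linSubst (1 : Matrix (Fin n) (Fin n) R) = AlgHom.id R _ := by
    refine algHom_ext fun i => ?_
    rw [linSubst, aeval_X, show (1 : Matrix (Fin n) (Fin n) R) i = Pi.single i 1 from by
      ext j; simp [Matrix.one_apply, Pi.single_apply, eq_comm], linForm_single]
    simp
  rw [this, AlgHom.id_apply]

/-- The Lie algebra is conjugated by a linear change of variables. -/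
theorem lieDer_linSubst {M N P : Matrix (Fin n) (Fin n) R} (h : M * P = P * N)
    (f : MvPolynomial (Fin n) R) : lieDer N (linSubst P f) = linSubst P (lieDer M f) := by
  induction f using MvPolynomial.induction_on with
  | C c => simp [linSubst, algebraMap_eq]
  | add p q hp hq => simp [hp, hq]
  | mul_X p i hp =>
    have hX : linSubst P (X i) = linForm (P i) := by rw [linSubst, aeval_X]
    have : Matrix.vecMul (P i) N = Matrix.vecMul (M i) P := by
      have := congrFun h i
      rw [Matrix.mul_apply_eq_vecMul, Matrix.mul_apply_eq_vecMul] at this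
      exact this.symm
    rw [map_mul, Derivation.leibniz, hp, hX, lieDer_linForm, Derivation.leibniz, lieDer_X, this,
      smul_eq_mul, smul_eq_mul, smul_eq_mul, smul_eq_mul, map_add, map_mul, map_mul, hX,
      linSubst_linForm]

theorem linSubst_isHomogeneous {P : Matrix (Fin n) (Fin n) R} {f : MvPolynomial (Fin n) R} {d : ℕ}
    (hf : f.IsHomogeneous d) : (linSubst P f).IsHomogeneous d := by
  have h := hf.aeval (fun i => linForm (P i)) (n := 1) fun i =>
    IsHomogeneous.sum _ _ _ fun j _ => isHomogeneous_C_mul_X _ _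
  rwa [one_mul] at h

end LieDer

/-! ### Monomials characterized by their Lie algebras, and simultaneous diagonalization. -/

section Structure

open MvPolynomial Module

variable {L : Type u} [Field L] {n : ℕ}

/-- Monomials are eigenvectors of a diagonal derivation, since `x_i ∂_i` multiplies a monomial by
its exponent at `i`. -/
theorem lieDer_diagonal_coeff (q : Fin n → L) (g : MvPolynomial (Fin n) L) (m : Fin n →₀ ℕ) :
    coeff m (lieDer (Matrix.diagonal q) g) = (∑ i, q i * m i) * coeff m g := by
  have h1 (f : MvPolynomial (Fin n) L) : lieDer (Matrix.diagonal q) f =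
      ∑ i, C (q i) * (X i * pderiv i f) := by
    rw [lieDer_apply]
    refine Finset.sum_congr rfl fun i _ => ?_
    rw [Finset.sum_eq_single i] <;> simp +contextual [eq_comm]
  induction g using MvPolynomial.induction_on' with
  | add p p' hp hp' => rw [map_add, coeff_add, hp, hp', coeff_add, mul_add]
  | monomial s a =>
    rw [h1]
    simp only [X_mul_pderiv_monomial, coeff_sum, coeff_C_mul, coeff_smul, coeff_monomial]
    split_ifs with h
    · subst h
      simp [Finset.sum_mul, mul_assoc]
    · simp

/-- The operator `x_l ∂_k` moves one unit of the exponent from `k` to `l`. An off-diagonal target is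
hit by one pair only; positivity of the exponents ensures that the truncated subtraction really
lowers the entry. -/
theorem lieDer_monomial_coeff (N : Matrix (Fin n) (Fin n) L) {s : Fin n →₀ ℕ} (hs : ∀ i, 1 ≤ s i)
    (c : L) {i j : Fin n} (hij : i ≠ j) :
    coeff (s - Finsupp.single i 1 + Finsupp.single j 1) (lieDer N (monomial s c)) =
      N i j * (c * s i) := by
  have h1 (k l : Fin n) : C (N k l) * (X l * pderiv k (monomial s c)) =
      monomial (s - Finsupp.single k 1 + Finsupp.single l 1) (N k l * (c * s k)) := by
    rw [pderiv_monomial, X, monomial_mul, C_mul_monomial, one_mul, add_comm]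
  have h2 (k l : Fin n) (h : s - Finsupp.single k 1 + Finsupp.single l 1 =
      s - Finsupp.single i 1 + Finsupp.single j 1) : k = i ∧ l = j := by
    have hk : k = i := by
      by_contra hki
      have := DFunLike.congr_fun h i
      have hi := hs i
      simp only [Finsupp.add_apply, Finsupp.tsub_apply, Finsupp.single_apply, hki, hij.symm,
        if_true, if_false] at this
      omega
    subst hk
    have h3 := add_left_cancel h
    exact ⟨rfl, (Finsupp.single_left_inj one_ne_zero).1 h3⟩
  rw [lieDer_apply]
  simp only [h1, coeff_sum, coeff_monomial]
  rw [Finset.sum_eq_single i, Finset.sum_eq_single j]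
  · simp
  · exact fun l _ hl => if_neg fun h => hl (h2 _ _ h).2
  · simp
  · exact fun k _ hk => Finset.sum_eq_zero fun l _ => if_neg fun h => hk (h2 _ _ h).1
  · simp

/-- The Lie algebra of a monomial in which all variables occur. -/
theorem mem_lieSubmodule_monomial [CharZero L] {s : Fin n →₀ ℕ} (hs : ∀ i, 1 ≤ s i) {c : L}
    (hc : c ≠ 0) {N : Matrix (Fin n) (Fin n) L} :
    N ∈ lieSubmodule (monomial s c) ↔ ∃ q, N = Matrix.diagonal q ∧ ∑ i, q i * (s i : L) = 0 := by
  rw [mem_lieSubmodule]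
  constructor
  · intro h
    have hN : N = Matrix.diagonal fun i => N i i := by
      ext i j
      by_cases hij : i = j
      · simp [hij]
      · have h1 := lieDer_monomial_coeff N hs c hij
        rw [h, coeff_zero] at h1
        have h2 : (s i : L) ≠ 0 := Nat.cast_ne_zero.2 (by have := hs i; omega)
        simpa [hij, hc, h2] using h1.symm
    refine ⟨_, hN, ?_⟩
    have h1 := lieDer_diagonal_coeff (fun i => N i i) (monomial s c) s
    rw [← hN, h] at h1
    simpa [hc] using h1.symm
  · rintro ⟨q, rfl, hq⟩
    ext m
    rw [lieDer_diagonal_coeff, coeff_monomial]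
    split_ifs with h
    · subst h
      simp [hq]
    · simp

theorem linSubst_injective {A : Matrix (Fin n) (Fin n) L} (hA : IsUnit A) :
    Function.Injective (linSubst A) := by
  have := hA.invertible
  intro f g h
  have := congrArg (linSubst A⁻¹) h
  rwa [linSubst_linSubst, linSubst_linSubst, Matrix.mul_inv_of_invertible, linSubst_one,
    linSubst_one] at this

theorem mem_lieSubmodule_linSubst {A M N : Matrix (Fin n) (Fin n) L} (hA : IsUnit A)
    (h : N * A = A * M) (g : MvPolynomial (Fin n) L) :
    M ∈ lieSubmodule (linSubst A g) ↔ N ∈ lieSubmodule g := by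
  rw [mem_lieSubmodule, mem_lieSubmodule, lieDer_linSubst h,
    map_eq_zero_iff _ (linSubst_injective hA)]

theorem linSubst_monomial (A : Matrix (Fin n) (Fin n) L) (e : Fin n → ℕ) (c : L) :
    linSubst A (monomial (Finsupp.equivFunOnFinite.symm e) c) =
      C c * ∏ i, linForm (A i) ^ e i := by
  rw [monomial_eq, map_mul, linSubst, aeval_C, algebraMap_eq, Finsupp.prod_fintype _ _ (by simp),
    map_prod]
  simp

/-- The Lie algebra of a product of powers of independent linear forms. -/
theorem mem_lieSubmodule_prod [CharZero L] {A : Matrix (Fin n) (Fin n) L} (hA : IsUnit A)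
    {e : Fin n → ℕ} (he : ∀ i, 1 ≤ e i) {c : L} (hc : c ≠ 0) {M : Matrix (Fin n) (Fin n) L} :
    M ∈ lieSubmodule (C c * ∏ i, linForm (A i) ^ e i) ↔
      ∃ q, A * M = Matrix.diagonal q * A ∧ ∑ i, q i * (e i : L) = 0 := by
  have := hA.invertible
  rw [← linSubst_monomial, mem_lieSubmodule_linSubst (N := A * M * A⁻¹) hA
    (by rw [Matrix.inv_mul_cancel_right_of_invertible]), mem_lieSubmodule_monomial he hc]
  refine exists_congr fun q => and_congr_left' ?_
  constructor
  · intro h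
    rw [← h, Matrix.inv_mul_cancel_right_of_invertible]
  · intro h
    rw [h, Matrix.mul_inv_cancel_right_of_invertible]

theorem finrank_orthogonal {a : Fin n → L} (ha : a ≠ 0) :
    finrank L (LinearMap.ker (dotProductBilin L L a)) + 1 = n := by
  have h : dotProductBilin L L a ≠ 0 := by
    intro h
    refine ha (funext fun i => ?_)
    simpa using DFunLike.congr_fun h (Pi.single i 1)
  simpa using Module.Dual.finrank_ker_add_one_of_ne_zero h

/-- The linear map `q ↦ A⁻¹ * diag (q) * A`. -/
noncomputable def conjDiagonal (A : Matrix (Fin n) (Fin n) L) :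
    (Fin n → L) →ₗ[L] Matrix (Fin n) (Fin n) L where
  toFun q := A⁻¹ * Matrix.diagonal q * A
  map_add' q q' := by
    rw [← Matrix.add_mul, ← Matrix.mul_add, Matrix.diagonal_add]; rfl
  map_smul' c q := by simp [Matrix.diagonal_smul]

theorem conjDiagonal_injective {A : Matrix (Fin n) (Fin n) L} (hA : IsUnit A) :
    Function.Injective (conjDiagonal A) := by
  have := hA.invertible
  intro q q' h
  have := congrArg (fun M => A * M * A⁻¹) (show A⁻¹ * Matrix.diagonal q * A =
    A⁻¹ * Matrix.diagonal q' * A from h)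
  funext i
  simpa [Matrix.mul_assoc, funext_iff] using congrFun (congrFun this i) i

theorem eq_conjDiagonal_iff {A M : Matrix (Fin n) (Fin n) L} (hA : IsUnit A) {q : Fin n → L} :
    conjDiagonal A q = M ↔ A * M = Matrix.diagonal q * A := by
  have := hA.invertible
  change A⁻¹ * Matrix.diagonal q * A = M ↔ _
  constructor
  · rintro rfl
    rw [← Matrix.mul_assoc, ← Matrix.mul_assoc, Matrix.mul_inv_of_invertible, Matrix.one_mul]
  · intro h
    rw [Matrix.mul_assoc, ← h, Matrix.inv_mul_cancel_left_of_invertible]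

theorem lieSubmodule_prod_eq [CharZero L] {A : Matrix (Fin n) (Fin n) L} (hA : IsUnit A)
    {e : Fin n → ℕ} (he : ∀ i, 1 ≤ e i) {c : L} (hc : c ≠ 0) :
    lieSubmodule (C c * ∏ i, linForm (A i) ^ e i) =
      (LinearMap.ker (dotProductBilin L L fun i => (e i : L))).map (conjDiagonal A) := by
  ext M
  rw [mem_lieSubmodule_prod hA he hc]
  simp only [Submodule.mem_map, LinearMap.mem_ker, eq_conjDiagonal_iff hA]
  refine exists_congr fun q => ?_
  rw [and_comm]
  simp [dotProduct, mul_comm]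

theorem finrank_lieSubmodule_prod [CharZero L] {A : Matrix (Fin n) (Fin n) L} (hA : IsUnit A)
    {e : Fin n → ℕ} (he : ∀ i, 1 ≤ e i) {c : L} (hc : c ≠ 0) (hn : 0 < n) :
    finrank L (lieSubmodule (C c * ∏ i, linForm (A i) ^ e i)) + 1 = n := by
  rw [lieSubmodule_prod_eq hA he hc,
    ← (Submodule.equivMapOfInjective _ (conjDiagonal_injective hA) _).finrank_eq]
  refine finrank_orthogonal fun h => ?_
  have h1 : (e ⟨0, hn⟩ : L) = 0 := congrFun h ⟨0, hn⟩
  have h2 := he ⟨0, hn⟩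
  rw [Nat.cast_eq_zero] at h1
  omega

/-- If the Lie algebra consists of diagonal matrices and has dimension `n - 1`, then the polynomial
is a monomial in which all variables occur. -/
theorem eq_monomial_of_lieSubmodule [CharZero L] {g : MvPolynomial (Fin n) L} {d : ℕ}
    (hg : g.IsHomogeneous d) (hdiag : ∀ N ∈ lieSubmodule g, ∃ q, N = Matrix.diagonal q)
    (hrank : finrank L (lieSubmodule g) + 1 = n) :
    ∃ (e : Fin n → ℕ) (c : L), (∀ i, 1 ≤ e i) ∧ c ≠ 0 ∧
      g = monomial (Finsupp.equivFunOnFinite.symm e) c := by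
  set Q : Submodule L (Fin n → L) := (lieSubmodule g).comap (Matrix.diagonalLinearMap (Fin n) L L)
  have hmap : Q.map (Matrix.diagonalLinearMap (Fin n) L L) = lieSubmodule g := by
    refine le_antisymm (Submodule.map_comap_le _ _) fun N hN => ?_
    obtain ⟨q, rfl⟩ := hdiag N hN
    exact ⟨q, hN, rfl⟩
  have hQ : finrank L Q + 1 = n := by
    rw [(Submodule.equivMapOfInjective (Matrix.diagonalLinearMap (Fin n) L L)
      Matrix.diagonal_injective Q).finrank_eq, hmap, hrank]
  -- Each coefficient of `g` is scaled separately, so `diag(q)` kills `g` exactly if `q` is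
  -- orthogonal to every exponent vector in the support.
  have hQmem (q : Fin n → L) : q ∈ Q ↔ ∀ m ∈ g.support, ∑ i, q i * (m i : L) = 0 := by
    have : q ∈ Q ↔ lieDer (Matrix.diagonal q) g = 0 := Iff.rfl
    rw [this, MvPolynomial.ext_iff]
    simp only [lieDer_diagonal_coeff, coeff_zero, mul_eq_zero, MvPolynomial.mem_support_iff]
    exact forall_congr' fun m => or_iff_not_imp_right
  have hQtop : Q ≠ ⊤ := by
    intro h
    rw [h, finrank_top, Module.finrank_fin_fun] at hQ
    omega
  have hg0 : g.support.Nonempty := by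
    by_contra h
    rw [Finset.not_nonempty_iff_eq_empty] at h
    exact hQtop (eq_top_iff.2 fun q _ => (hQmem q).2 (by simp [h]))
  obtain ⟨s, hs⟩ := hg0
  have hdeg (m) (hm : m ∈ g.support) : ∑ i, (m i : L) = d := by
    rw [hg.degree_eq_sum_deg_support hm, ← Nat.cast_sum]
    congr 1
    exact (Finset.sum_subset (Finset.subset_univ _) (by simp)).symm
  -- In degree `0` all exponents vanish and every diagonal matrix would lie in the Lie algebra,
  -- against the dimension `n - 1`.
  have hd : (d : L) ≠ 0 := by
    intro h
    refine hQtop (eq_top_iff.2 fun q _ => (hQmem q).2 fun m hm => ?_)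
    have h1 := hdeg m hm
    rw [h, ← Nat.cast_sum, Nat.cast_eq_zero, Finset.sum_eq_zero_iff] at h1
    exact Finset.sum_eq_zero fun i hi => by rw [h1 i hi, Nat.cast_zero, mul_zero]
  have hs0 : (fun i => (s i : L)) ≠ 0 := by
    intro h
    refine hd ?_
    rw [← hdeg s hs]
    exact Finset.sum_eq_zero fun i _ => congrFun h i
  have hker : Q = LinearMap.ker (dotProductBilin L L fun i => (s i : L)) := by
    refine Submodule.eq_of_le_of_finrank_eq (fun q hq => ?_) ?_
    · simpa [dotProduct, mul_comm] using (hQmem q).1 hq s hs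
    · have := finrank_orthogonal hs0
      omega
  -- Testing `m` on the vectors `s_i e_j - s_j e_i` of the hyperplane `s^⊥` shows that `m` is
  -- proportional to `s`; the common degree `d` then gives equality.
  have hprop (m) (hm : m ∈ g.support) (i j : Fin n) : (s i : L) * m j = s j * m i := by
    have hq : Pi.single j (s i : L) - Pi.single i (s j : L) ∈ Q := by
      rw [hker]
      simp [dotProduct_sub, mul_comm]
    have := (hQmem _).1 hq m hm
    simp only [Pi.sub_apply, sub_mul, Finset.sum_sub_distrib, Pi.single_apply, ite_mul, zero_mul,
      Finset.sum_ite_eq', Finset.mem_univ, if_true] at this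
    exact sub_eq_zero.1 this
  have huniq (m) (hm : m ∈ g.support) : m = s := by
    ext i
    have h1 : (s i : L) * d = d * m i := by
      rw [← hdeg m hm, Finset.mul_sum, Finset.sum_congr rfl fun j _ => hprop m hm i j,
        ← Finset.sum_mul, hdeg s hs, hdeg m hm]
    rw [mul_comm] at h1
    exact_mod_cast (mul_left_cancel₀ hd h1).symm
  have hgs : g = monomial s (coeff s g) := by
    ext m
    rw [coeff_monomial]
    split_ifs with h
    · rw [h]
    · by_contra h'
      exact h (huniq m (MvPolynomial.mem_support_iff.2 h')).symm
  refine ⟨s, coeff s g, fun i => ?_, MvPolynomial.mem_support_iff.1 hs, ?_⟩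
  · by_contra hi
    have hi0 : s i = 0 := by omega
    obtain ⟨j, hj⟩ := Function.ne_iff.1 hs0
    have hij : i ≠ j := by
      rintro rfl
      exact hj (by simp [hi0])
    -- If `x_i` does not occur in `g`, then `x_j ∂_i` kills `g`, an off-diagonal element of the Lie
    -- algebra.
    have hN : Matrix.single i j (1 : L) ∈ lieSubmodule g := by
      rw [mem_lieSubmodule, lieDer_apply]
      refine Finset.sum_eq_zero fun k _ => Finset.sum_eq_zero fun l _ => ?_
      by_cases hk : i = k
      · subst hk
        rw [hgs, pderiv_monomial, hi0]
        simp
      · simp [hk]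
    obtain ⟨q, hq⟩ := hdiag _ hN
    have := congrFun (congrFun hq i) j
    simp [hij] at this
  · rw [show Finsupp.equivFunOnFinite.symm (s : Fin n → ℕ) = s from by simp]
    exact hgs

/-- If the matrices in the Lie algebra are all diagonalized by `A`, and its dimension is `n - 1`,
then the polynomial is a product of powers of the linear forms in the rows of `A`. -/
theorem eq_prod_of_lieSubmodule [CharZero L] {f : MvPolynomial (Fin n) L} {d : ℕ}
    (hf : f.IsHomogeneous d) {A : Matrix (Fin n) (Fin n) L} (hA : IsUnit A)
    (hdiag : ∀ M ∈ lieSubmodule f, ∃ q, A * M = Matrix.diagonal q * A)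
    (hrank : finrank L (lieSubmodule f) + 1 = n) :
    ∃ (e : Fin n → ℕ) (c : L), (∀ i, 1 ≤ e i) ∧ c ≠ 0 ∧ f = C c * ∏ i, linForm (A i) ^ e i := by
  have := hA.invertible
  have hfg : linSubst A (linSubst A⁻¹ f) = f := by
    rw [linSubst_linSubst, Matrix.inv_mul_of_invertible, linSubst_one]
  set g := linSubst A⁻¹ f with hg
  have hmem (N : Matrix (Fin n) (Fin n) L) : A⁻¹ * N * A ∈ lieSubmodule f ↔ N ∈ lieSubmodule g := by
    rw [← hfg]
    refine mem_lieSubmodule_linSubst hA ?_ g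
    rw [← Matrix.mul_assoc, ← Matrix.mul_assoc, Matrix.mul_inv_of_invertible, Matrix.one_mul]
  let φ : Matrix (Fin n) (Fin n) L →ₗ[L] Matrix (Fin n) (Fin n) L :=
    LinearMap.mulLeft L A⁻¹ ∘ₗ LinearMap.mulRight L A
  have hφ (N) : φ N = A⁻¹ * N * A := by simp [φ, Matrix.mul_assoc]
  have hφi : Function.Injective φ := by
    intro N N' h
    rw [hφ, hφ] at h
    have := congrArg (fun M => A * M * A⁻¹) h
    simpa [Matrix.mul_assoc] using this
  have hmap : (lieSubmodule g).map φ = lieSubmodule f := by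
    ext M
    rw [Submodule.mem_map]
    constructor
    · rintro ⟨N, hN, rfl⟩
      rw [hφ]
      exact (hmem N).2 hN
    · intro hM
      have h1 : A⁻¹ * (A * M * A⁻¹) * A = M := by simp [Matrix.mul_assoc]
      exact ⟨A * M * A⁻¹, (hmem _).1 (by rwa [h1]), by rw [hφ, h1]⟩
  have hgd (N) (hN : N ∈ lieSubmodule g) : ∃ q, N = Matrix.diagonal q := by
    obtain ⟨q, hq⟩ := hdiag _ ((hmem N).2 hN)
    refine ⟨q, ?_⟩
    have := congrArg (fun M => M * A⁻¹) hq
    simpa [Matrix.mul_assoc] using this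
  have hgr : finrank L (lieSubmodule g) + 1 = n := by
    rw [(Submodule.equivMapOfInjective _ hφi _).finrank_eq, hmap, hrank]
  obtain ⟨e, c, he, hc, hgm⟩ := eq_monomial_of_lieSubmodule (linSubst_isHomogeneous hf) hgd hgr
  refine ⟨e, c, he, hc, ?_⟩
  rw [← linSubst_monomial, ← hgm, hfg]

/-- Commuting matrices whose minimal polynomials have only simple roots can be diagonalized
simultaneously. -/
theorem exists_simultaneous_diagonalization [IsAlgClosed L] {ι : Type*}
    (B : ι → Matrix (Fin n) (Fin n) L) (hcomm : ∀ i j, B i * B j = B j * B i)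
    (hsep : ∀ i, (minpoly L (B i)).Separable) :
    ∃ A : Matrix (Fin n) (Fin n) L, IsUnit A ∧ ∀ i, ∃ q, A * B i = Matrix.diagonal q * A := by
  let T (i : ι) : Module.End L (Fin n → L) := Matrix.toLin' (B i)
  -- A squarefree annihilating polynomial makes each map semisimple, so that generalized eigenspaces
  -- are eigenspaces and the joint ones consist of common eigenvectors.
  have hss (i : ι) : (T i).IsFinitelySemisimple := by
    refine Module.End.IsSemisimple.isFinitelySemisimple ?_
    refine Module.End.isSemisimple_of_squarefree_aeval_eq_zero (p := minpoly L (T i)) ?_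
      (minpoly.aeval L _)
    rw [Matrix.minpoly_toLin']
    exact (hsep i).squarefree
  have htop := Module.End.iSup_iInf_maxGenEigenspace_eq_top_of_iSup_maxGenEigenspace_eq_top_of_commute
    T (fun i j _ => by
      change T i * T j = T j * T i
      rw [Module.End.mul_eq_comp, Module.End.mul_eq_comp, ← Matrix.toLin'_mul, hcomm,
        Matrix.toLin'_mul]) fun i => Module.End.iSup_maxGenEigenspace_eq_top (T i)
  set S : Set (Fin n → L) := {v | ∀ i, ∃ c : L, (B i).mulVec v = c • v}
  have hS : ⊤ ≤ Submodule.span L S := by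
    rw [← htop]
    refine iSup_le fun χ v hv => Submodule.subset_span fun i => ⟨χ i, ?_⟩
    rw [Submodule.mem_iInf] at hv
    have := hv i
    rw [(hss i).maxGenEigenspace_eq_eigenspace, Module.End.mem_eigenspace_iff] at this
    exact this
  -- The common eigenvectors span, so a basis can be chosen among them. They become the columns of
  -- `P`, and `P⁻¹` is the diagonalizing matrix.
  let b := Module.Basis.ofSpan hS
  let b' := b.reindex (b.indexEquiv (Pi.basisFun L (Fin n)))
  have hb (j : Fin n) : b' j ∈ S := by
    refine Module.Basis.ofSpan_subset hS ?_
    rw [Module.Basis.reindex_apply]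
    exact Set.mem_range_self _
  set P : Matrix (Fin n) (Fin n) L := Matrix.of fun i j => b' j i with hP
  have hPu : IsUnit P := Matrix.linearIndependent_cols_iff_isUnit.1 b'.linearIndependent
  have := hPu.invertible
  refine ⟨P⁻¹, by rw [Matrix.isUnit_nonsing_inv_iff]; exact hPu, fun i => ?_⟩
  choose q hq using fun j => hb j i
  refine ⟨q, ?_⟩
  have h1 : B i * P = P * Matrix.diagonal q := by
    ext k j
    rw [Matrix.mul_diagonal]
    exact (congrFun (hq j) k).trans (mul_comm _ _)
  have h2 := congrArg (fun M => P⁻¹ * M * P⁻¹) h1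
  simpa [Matrix.mul_assoc] using h2

/-- A conjugate of a diagonal matrix has a minimal polynomial with only simple roots. -/
theorem separable_minpoly_of_diagonalized {A M : Matrix (Fin n) (Fin n) L} (hA : IsUnit A)
    {q : Fin n → L} (h : A * M = Matrix.diagonal q * A) : (minpoly L M).Separable := by
  have := hA.invertible
  have key (p : Polynomial L) : A * Polynomial.aeval M p =
      Matrix.diagonal (fun i => p.eval (q i)) * A := by
    have hpow (k : ℕ) : A * M ^ k = Matrix.diagonal (fun i => q i ^ k) * A := by
      induction k with
      | zero => simp
      | succ k ih =>
        rw [pow_succ, ← Matrix.mul_assoc, ih, Matrix.mul_assoc, h, ← Matrix.mul_assoc,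
          Matrix.diagonal_mul_diagonal]
        simp only [pow_succ]
    induction p using Polynomial.induction_on' with
    | add p p' hp hp' =>
      simp only [map_add, Matrix.mul_add, hp, hp', Polynomial.eval_add, ← Matrix.add_mul,
        Matrix.diagonal_add]
    | monomial k a =>
      rw [Polynomial.aeval_monomial, ← Algebra.smul_def, Matrix.mul_smul, hpow, ← Matrix.smul_mul,
        ← Matrix.diagonal_smul]
      congr 2
      funext i
      simp
  classical
  -- Each eigenvalue is taken once, which makes `p` separable while it still kills `M`.
  set p : Polynomial L := ∏ μ ∈ Finset.univ.image q, (Polynomial.X - Polynomial.C μ)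
  have hp : p.Separable := Polynomial.separable_prod_X_sub_C_iff'.2 fun _ _ _ _ h => h
  refine hp.of_dvd (minpoly.dvd L M ?_)
  have h0 : A * Polynomial.aeval M p = 0 := by
    rw [key, show (fun i => p.eval (q i)) = 0 from funext fun i => ?_]
    · simp
    · rw [Polynomial.eval_prod]
      exact Finset.prod_eq_zero (Finset.mem_image_of_mem q (Finset.mem_univ i)) (by simp)
  have := congrArg (fun M => A⁻¹ * M) h0
  simpa using this

end Structure

/-! ## Interpolation on lines -/

section Interpolation

variable {L : Type u} [Field L] {n : ℕ}

/-- The coefficients computed by `Prog.weights`. -/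
noncomputable def weightsFn (L : Type u) [Field L] (d : ℕ) (k : Fin d) : L :=
  ∏ j : Fin d, if j = k then 1 / ((k.val + 1 : ℕ) : L)
    else ((j.val + 1 : ℕ) : L) / (((j.val + 1 : ℕ) : L) - ((k.val + 1 : ℕ) : L))

open Polynomial in
-- The quotient `h = (p - p(0)) / X` has degree less than `d` and `h(0) = p'(0)`, so Lagrange
-- interpolation of `h` at the nodes `1, …, d` suffices. The factor `1 / (k + 1)` in the weight
-- comes from `h(k + 1) = (p(k + 1) - p(0)) / (k + 1)`.
theorem eval_zero_derivative [CharZero L] {p : L[X]} {d : ℕ} (hp : p.natDegree ≤ d) :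
    p.derivative.eval 0 =
      ∑ k : Fin d, weightsFn L d k * (p.eval ((k.val + 1 : ℕ) : L) - p.eval 0) := by
  set h := p.divX with hh
  have hph : h * X + C (p.coeff 0) = p := divX_mul_X_add p
  have hev (t : L) : p.eval t - p.eval 0 = t * h.eval t := by
    rw [← hph]
    simp
    ring
  have hder : p.derivative.eval 0 = h.eval 0 := by
    rw [← hph]
    simp
  have hdeg : h.degree < ((Finset.univ : Finset (Fin d)).card : WithBot ℕ) := by
    rw [Finset.card_univ, Fintype.card_fin]
    rcases eq_or_ne p 0 with rfl | hp0
    · simp [hh]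
    · exact (degree_divX_lt hp0).trans_le (degree_le_of_natDegree_le hp)
  have hinj : Set.InjOn (fun k : Fin d => ((k.val + 1 : ℕ) : L)) (Finset.univ : Finset (Fin d)) := by
    intro a _ b _ hab
    have : a.val + 1 = b.val + 1 := Nat.cast_injective hab
    exact Fin.ext (by omega)
  rw [hder, Lagrange.eq_interpolate hinj hdeg, Lagrange.interpolate_apply, eval_finsetSum]
  refine Finset.sum_congr rfl fun k _ => ?_
  have hk : ((k.val + 1 : ℕ) : L) ≠ 0 := Nat.cast_ne_zero.2 (by omega)
  rw [hev, weightsFn,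
    ← Finset.mul_prod_erase _ _ (Finset.mem_univ k), if_pos rfl, eval_mul, eval_C, Lagrange.basis,
    eval_prod]
  have : ∏ j ∈ Finset.univ.erase k, eval 0 (Lagrange.basisDivisor ((k.val + 1 : ℕ) : L)
      ((j.val + 1 : ℕ) : L)) = ∏ j ∈ Finset.univ.erase k, (if j = k then 1 / ((k.val + 1 : ℕ) : L)
      else ((j.val + 1 : ℕ) : L) / (((j.val + 1 : ℕ) : L) - ((k.val + 1 : ℕ) : L))) := by
    refine Finset.prod_congr rfl fun j hj => ?_
    rw [if_neg (Finset.ne_of_mem_erase hj), Lagrange.basisDivisor, eval_mul, eval_C, eval_sub,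
      eval_X, eval_C, zero_sub, mul_neg, ← neg_mul, neg_inv, neg_sub, div_eq_inv_mul]
  rw [this]
  field_simp

open MvPolynomial in
theorem eval_pderiv_eq_sum [CharZero L] {g : MvPolynomial (Fin n) L} {d : ℕ}
    (hg : g.totalDegree ≤ d) (a : Fin n → L) (i : Fin n) :
    eval a (pderiv i g) = ∑ k : Fin d, weightsFn L d k *
      (eval (fun j => if j = i then a j + ((k.val + 1 : ℕ) : L) else a j) g - eval a g) := by
  set φ : Fin n → Polynomial L := fun j =>
    if j = i then Polynomial.C (a j) + Polynomial.X else Polynomial.C (a j) with hφ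
  have hev (t : L) (f : MvPolynomial (Fin n) L) : (aeval φ f).eval t =
      eval (fun j => if j = i then a j + t else a j) f := by
    induction f using MvPolynomial.induction_on with
    | C c => simp
    | add p q hp hq => simp [hp, hq]
    | mul_X p j hp =>
      rw [map_mul, Polynomial.eval_mul, hp, map_mul, aeval_X, eval_X, hφ]
      by_cases h : j = i <;> simp [h]
  have hev0 (f : MvPolynomial (Fin n) L) : (aeval φ f).eval 0 = eval a f := by
    rw [hev]
    simp
  have hder (f : MvPolynomial (Fin n) L) :
      (aeval φ f).derivative.eval 0 = eval a (pderiv i f) := by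
    induction f using MvPolynomial.induction_on with
    | C c => simp
    | add p q hp hq => simp [hp, hq]
    | mul_X p j hp =>
      have hX : (φ j).derivative.eval 0 = eval a (pderiv i (X j)) := by
        rw [pderiv_X, hφ]
        by_cases h : j = i <;> simp [h]
      rw [map_mul, Polynomial.derivative_mul, Polynomial.eval_add, Polynomial.eval_mul,
        Polynomial.eval_mul, hp, hev0, aeval_X, hX, Derivation.leibniz, smul_eq_mul, smul_eq_mul,
        map_add, map_mul, map_mul, ← hev0 (X j), aeval_X, hev0 p]
      ring
  have hdeg : (aeval φ g).natDegree ≤ d := by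
    refine (aeval_natDegree_le (n := 1) g hg φ fun j => ?_).trans (by simp)
    rw [hφ]
    dsimp only
    split_ifs
    · rw [add_comm]; exact (Polynomial.natDegree_X_add_C _).le
    · simp
  rw [← hder, eval_zero_derivative hdeg]
  simp only [hev, add_zero, ite_self]

end Interpolation

/-! ## Random evaluation points -/

section RandomPoints

open MvPolynomial

variable {L : Type u} [Field L] {n m d : ℕ}

theorem totalDegree_det_le {σ : Type*} {r : ℕ} (M : Matrix (Fin r) (Fin r) (MvPolynomial σ L))
    (h : ∀ i j, (M i j).totalDegree ≤ d) : M.det.totalDegree ≤ r * d := by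
  rw [Matrix.det_apply]
  refine totalDegree_finsetSum_le fun π _ => ?_
  refine le_trans ?_ ((totalDegree_finsetProd Finset.univ fun i => M (π i) i).trans
    ((Finset.sum_le_sum fun i _ => h (π i) i).trans (by simp)))
  rcases Int.units_eq_one_or (Equiv.Perm.sign π) with h | h
  · rw [h, one_smul]
  · rw [h, Units.neg_smul, one_smul, totalDegree_neg]

/-- At `m` points outside of a hypersurface, the only linear relations between the values of `m`
polynomials are the linear relations between these polynomials. -/
theorem exists_polynomial_relations [CharZero L] (p : Fin m → MvPolynomial (Fin n) L)
    (hp : ∀ i, (p i).totalDegree ≤ d) :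
    ∃ D : MvPolynomial (Fin (m * n)) L, D ≠ 0 ∧ D.totalDegree ≤ m * d ∧ ∀ x, eval x D ≠ 0 →
      ∀ v : Fin m → L, (∀ k, ∑ i, v i * eval (fun l => x (finProdFinEquiv (k, l))) (p i) = 0) →
        ∑ i, C (v i) * p i = 0 := by
  set ev : (Fin n → L) → Fin m → L := fun a i => eval a (p i) with hev
  set U : Submodule L (Fin m → L) := Submodule.span L (Set.range ev) with hU
  obtain ⟨r, hr, b, hb, hbi⟩ : ∃ r : ℕ, r = Module.finrank L U ∧ ∃ b : Fin r → Fin m → L,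
      (∀ k, b k ∈ Set.range ev) ∧ LinearIndependent L b := by
    obtain ⟨b, hb, -, hbi⟩ := Submodule.exists_fun_fin_finrank_span_eq L (Set.range ev)
    exact ⟨_, rfl, b, hb, hbi⟩
  choose a ha using hb
  have hrm : r ≤ m := by simpa [hr] using Submodule.finrank_le U
  obtain ⟨π, hπ⟩ := LinearMap.exists_leftInverse_of_injective (Fintype.linearCombination L b)
    (LinearMap.ker_eq_bot.2 hbi.fintypeLinearCombination_injective)
  have hπb (k : Fin r) : π (b k) = Pi.single k 1 := by
    have := DFunLike.congr_fun hπ (Pi.single k 1)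
    simpa [Fintype.linearCombination_apply_single] using this
  -- The coordinates, with respect to the basis `b` of all evaluation vectors, of the evaluation
  -- vectors at the first `r` of the `m` generic points; its determinant is the polynomial sought.
  set Q : Matrix (Fin r) (Fin r) (MvPolynomial (Fin (m * n)) L) := Matrix.of fun k j =>
    ∑ i, C (π (Pi.single i 1) j) *
      rename (fun l => finProdFinEquiv (Fin.castLE hrm k, l)) (p i) with hQ
  have hevQ (x : Fin (m * n) → L) (k j : Fin r) : eval x (Q k j) =
      π (ev fun l => x (finProdFinEquiv (Fin.castLE hrm k, l))) j := by
    rw [hQ, Matrix.of_apply, map_sum]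
    conv_rhs => rw [pi_eq_sum_univ' (ev _), map_sum, Finset.sum_apply]
    refine Finset.sum_congr rfl fun i _ => ?_
    rw [map_smul, map_mul, eval_C, eval_rename, Pi.smul_apply, smul_eq_mul, mul_comm]
    rfl
  have hdet (x : Fin (m * n) → L) : eval x Q.det = (Matrix.of fun k =>
      π (ev fun l => x (finProdFinEquiv (Fin.castLE hrm k, l)))).det := by
    rw [RingHom.map_det]
    congr 1
    ext k j
    exact hevQ x k j
  refine ⟨Q.det, fun h => ?_, (totalDegree_det_le Q fun k j => ?_).trans
    (Nat.mul_le_mul_right d hrm), fun x hx v hv => ?_⟩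
  -- At the points `a k`, whose evaluation vectors are the basis `b`, the matrix becomes the
  -- identity; the points after the first `r` are irrelevant and set to `0`.
  · set x : Fin (m * n) → L := fun t =>
      if h : (finProdFinEquiv.symm t).1.val < r then a ⟨_, h⟩ (finProdFinEquiv.symm t).2 else 0
      with hx
    have hxa (k : Fin r) : (fun l => x (finProdFinEquiv (Fin.castLE hrm k, l))) = a k := by
      funext l
      rw [hx]
      dsimp only
      rw [Equiv.symm_apply_apply]
      exact dif_pos k.2
    have h1 := hdet x
    simp only [hxa, ha, hπb] at h1
    rw [h, map_zero, show (Matrix.of fun k : Fin r => (Pi.single k 1 : Fin r → L)) = 1 from by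
      ext i j; simp [Matrix.one_apply, Pi.single_apply, eq_comm], Matrix.det_one] at h1
    exact zero_ne_one h1
  · rw [hQ, Matrix.of_apply]
    refine totalDegree_finsetSum_le fun i _ => (totalDegree_mul _ _).trans ?_
    rw [totalDegree_C, zero_add]
    exact (totalDegree_rename_le _ _).trans (hp i)
  · set c : Fin r → Fin m → L := fun k => ev fun l => x (finProdFinEquiv (Fin.castLE hrm k, l))
      with hc
    have hci : LinearIndependent L c := by
      refine LinearIndependent.of_comp π ?_
      have := Matrix.linearIndependent_rows_iff_isUnit.2
        ((Matrix.isUnit_iff_isUnit_det _).2 (isUnit_iff_ne_zero.2 (hdet x ▸ hx)))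
      exact this
    -- Nonvanishing of the determinant makes the `r` sampled vectors independent, hence spanning. So
    -- a relation at these points is a relation at every point, and `L` is infinite.
    have hcU : Submodule.span L (Set.range c) = U := by
      refine Submodule.eq_of_le_of_finrank_eq ?_ ?_
      · refine Submodule.span_mono ?_
        rintro _ ⟨k, rfl⟩
        exact Set.mem_range_self _
      · rw [finrank_span_eq_card hci, Fintype.card_fin, hr]
    have hUv : U ≤ LinearMap.ker (dotProductBilin L L v) := by
      rw [← hcU, Submodule.span_le]
      rintro _ ⟨k, rfl⟩
      exact hv (Fin.castLE hrm k)
    refine MvPolynomial.funext fun y => ?_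
    have := hUv (Submodule.subset_span (Set.mem_range_self y))
    simpa [dotProduct, hev] using this

end RandomPoints

/-! ## Step 1: the Lie algebra -/

open MvPolynomial in
theorem totalDegree_pderiv_le {R σ : Type*} [CommSemiring R] (i : σ) (g : MvPolynomial σ R) :
    (pderiv i g).totalDegree ≤ g.totalDegree := by
  classical
  conv_lhs => rw [← support_sum_monomial_coeff g, map_sum]
  refine totalDegree_finsetSum_le fun s hs => ?_
  rw [pderiv_monomial]
  refine (totalDegree_monomial_le _ _).trans (le_trans ?_ (le_totalDegree hs))
  have h : s - Finsupp.single i 1 ≤ s := tsub_le_self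
  exact (Finsupp.sum_le_sum_index h (fun _ _ _ _ h => h) fun _ _ => rfl)

namespace Prog

open MvPolynomial

variable {L : Type u} [Field L] {n : ℕ} {O : (Fin n → L) → L}
  {E : (m : ℕ) → Matrix (Fin m) (Fin m) L → List L}

/-- At points with natural coordinates, `O` returns the values of `g`. -/
def AgreesAtNat (O : (Fin n → L) → L) (g : MvPolynomial (Fin n) L) : Prop :=
  ∀ x : Fin n → ℕ, O (fun i => (x i : L)) = eval (fun i => (x i : L)) g

/-- The values of the polynomials `x_j * ∂g / ∂x_i` at a point. -/
noncomputable def lieRowFn (g : MvPolynomial (Fin n) L) (a : Fin n → L) : Fin (n * n) → L :=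
  fun p => a (finProdFinEquiv.symm p).2 * eval a (pderiv (finProdFinEquiv.symm p).1 g)

/-- The matrix with the given list of entries. -/
def toMatrix {α : Type v} (a : Fin (n * n) → α) : Matrix (Fin n) (Fin n) α :=
  Matrix.of fun i j => a (finProdFinEquiv (i, j))

theorem lieDer_toMatrix (g : MvPolynomial (Fin n) L) (v : Fin (n * n) → L) :
    lieDer (toMatrix v) g = ∑ p, C (v p) *
      (X (finProdFinEquiv.symm p).2 * pderiv (finProdFinEquiv.symm p).1 g) := by
  rw [lieDer_apply, ← Equiv.sum_comp finProdFinEquiv, Fintype.sum_prod_type]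
  simp only [Equiv.symm_apply_apply]
  rfl

theorem eval_lieDer_toMatrix (g : MvPolynomial (Fin n) L) (a : Fin n → L) (v : Fin (n * n) → L) :
    eval a (lieDer (toMatrix v) g) = lieRowFn g a ⬝ᵥ v := by
  rw [lieDer_toMatrix, map_sum, dotProduct]
  refine Finset.sum_congr rfl fun p _ => ?_
  rw [map_mul, map_mul, eval_C, eval_X, mul_comm, lieRowFn]

/-- The rows of the linear system for the Lie algebra that belong to given points. -/
noncomputable def lieRows (g : MvPolynomial (Fin n) L) (x : Fin (n * n * n) → L) :
    List (Fin (n * n) → L) :=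
  List.ofFn fun p => lieRowFn g fun j => x (finProdFinEquiv (p, j))

/-- The matrices computed by `Prog.lieBasis` from given points. -/
noncomputable def lieBasisFn (g : MvPolynomial (Fin n) L) (x : Fin (n * n * n) → L) :
    List (Matrix (Fin n) (Fin n) L) :=
  (kernelFn (lieRows g x)).map toMatrix

/-- A bound for the cost of `Prog.lieRow`. -/
def lieRowCost (n d : ℕ) : ℕ :=
  n * (d * (n * 2 + 3 + 1) + 1) + n * n * 1 + 1

/-- A bound for the cost of `Prog.lieBasis`. -/
def lieBasisCost (n d : ℕ) : ℕ :=
  d * (d * (4 + 1) + 1) + (n * n * lieRowCost n d +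
    (n * n * (n * n) + n * n * (n * n * (4 * (n * n) + 2))) + n * n * n)

namespace Spec

theorem weights {d : ℕ} : Spec O E (Prog.weights d) (d * (d * (4 + 1) + 1)) 0
    (· = weightsFn L d) := by
  refine tabulate fun k => prod fun j => ?_
  split_ifs with h
  · exact (lit (lit (op (ret (s := 0) (by simp [ArithOp.eval]))))).steps_le (by omega)
  · exact lit (lit (op (op (ret (s := 0) rfl))))

theorem partialDeriv [CharZero L] {g : MvPolynomial (Fin n) L} {d : ℕ} (hg : g.totalDegree ≤ d)
    (hO : AgreesAtNat O g) (x : Fin n → ℕ) (i : Fin n) :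
    Spec O E (Prog.partialDeriv (weightsFn L d) (fun j => (x j : L))
      (eval (fun j => (x j : L)) g) i) (d * (n * 2 + 3 + 1) + 1) 0
      (· = eval (fun j => (x j : L)) (pderiv i g)) := by
  rw [eval_pderiv_eq_sum hg]
  refine sum fun k => ?_
  -- The interpolation nodes are integers, so the queried points keep natural coordinates, where the
  -- black box is known to be right.
  have h1 : Spec O E (Prog.tabulate n fun j => if j = i then
      .lit (k.val + 1) fun t => .op .add (x j : L) t .ret else (.ret (x j : L) : Prog L n L))
      (n * 2) 0
      (· = fun j => ((if j = i then x j + (k.val + 1) else x j : ℕ) : L)) := by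
    refine tabulate fun j => ?_
    split_ifs with h
    · exact lit (op (ret (by simp [ArithOp.eval])))
    · exact ret rfl
  refine h1.bind₀ fun y hy => query (op (op (ret (s := 0) ?_)))
  rw [hy, hO, ArithOp.eval, ArithOp.eval]
  congr 4
  funext j
  split_ifs <;> simp

theorem lieRow [CharZero L] {g : MvPolynomial (Fin n) L} {d : ℕ} (hg : g.totalDegree ≤ d)
    (hO : AgreesAtNat O g) (x : Fin n → ℕ) :
    Spec O E (Prog.lieRow (weightsFn L d) (fun j => (x j : L))) (lieRowCost n d) 0
      (· = lieRowFn g (fun j => (x j : L))) := by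
  refine query ?_
  rw [hO]
  refine (tabulate fun i => partialDeriv hg hO x i).bind₀ fun D hD => ?_
  subst hD
  exact tabulate fun p => op (ret (s := 0) rfl)

end Spec

section lieBasis

variable [CharZero L] {g : MvPolynomial (Fin n) L} {d N : ℕ}

/-- After the draw the computation is deterministic. This description is used both for the cost of
all runs and for the failure probability. -/
theorem spec_lieBasis_continuation (hg : g.totalDegree ≤ d) (hO : AgreesAtNat O g)
    (r : Fin (n * n * n) → Fin (N + 1)) :
    Spec O E (((tabulate (n * n) fun p => lieRow (weightsFn L d) fun j =>
        ((r (finProdFinEquiv (p, j)) : ℕ) : L)).bind fun W =>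
      (kernel (List.ofFn W)).bind fun V =>
        .ret (V.map fun a => Matrix.of fun i j => a (finProdFinEquiv (i, j)))) :
          Prog L n (List (Matrix (Fin n) (Fin n) L)))
      (n * n * lieRowCost n d + (n * n * (n * n) + n * n * (n * n * (4 * (n * n) + 2)))) 0
      (· = lieBasisFn g fun i => ((r i : ℕ) : L)) := by
  refine (Spec.tabulate fun p => Spec.lieRow hg hO _).bind₀ fun W hW =>
    (Spec.kernel.bind₀ fun V hV => Spec.ret (s := 0) ?_).steps_le (by simp)
  subst hW
  rw [hV]
  rfl

theorem Spec.lieBasis (hg : g.totalDegree ≤ d) (hO : AgreesAtNat O g) :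
    Spec O E (Prog.lieBasis d N) (lieBasisCost n d) 0
      (fun B => ∃ r : Fin (n * n * n) → Fin (N + 1), B = lieBasisFn g fun i => ((r i : ℕ) : L)) := by
  refine Spec.weights.bind₀ fun w hw => ?_
  subst hw
  exact Spec.rand fun r => (spec_lieBasis_continuation hg hO r).post fun B hB => ⟨r, hB⟩

/-- Most random points define a linear system whose solutions are the Lie algebra. -/
theorem lieBasis_failProb_le (hg : g.totalDegree ≤ d) (hO : AgreesAtNat O g) :
    failProb O E (Prog.lieBasis d N : Prog L n _) (fun B => ∃ r : Fin (n * n * n) → ℕ,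
      B = lieBasisFn g (fun i => (r i : L)) ∧ ∀ v : Fin (n * n) → L,
        (∀ w ∈ lieRows g (fun i => (r i : L)), w ⬝ᵥ v = 0) ↔ toMatrix v ∈ lieSubmodule g) ≤
      ((n * n * (d + 1) : ℕ) : ENNReal) / ((N + 1 : ℕ) : ENNReal) := by
  obtain ⟨D, hD0, hD, hDx⟩ := exists_polynomial_relations (d := d + 1)
    (fun p : Fin (n * n) => X (finProdFinEquiv.symm p).2 * pderiv (finProdFinEquiv.symm p).1 g)
    fun p => by
      refine (totalDegree_mul _ _).trans ?_
      rw [totalDegree_X, add_comm]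
      exact Nat.add_le_add_right ((totalDegree_pderiv_le _ g).trans hg) 1
  refine Spec.weights.failProb_bind_le fun w hw => ?_
  subst hw
  rw [← add_zero (_ / _)]
  refine failProb_rand_le _ (uniform_eval_eq_zero_le hD0 hD) fun r hr =>
    ((spec_lieBasis_continuation hg hO r).post ?_).failProb_le 0
  rintro B rfl
  refine ⟨fun i => r i, rfl, fun v => ?_⟩
  rw [lieRows, List.forall_mem_ofFn_iff, mem_lieSubmodule]
  constructor
  · intro h
    rw [lieDer_toMatrix]
    refine hDx _ hr v fun k => ?_
    rw [← h k, dotProduct]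
    refine Finset.sum_congr rfl fun p _ => ?_
    rw [map_mul, eval_X, mul_comm]
    rfl
  · intro h k
    rw [← eval_lieDer_toMatrix, h, map_zero]

end lieBasis

end Prog

/-! ## Steps 2 and 3: the decision -/

section Decision

open MvPolynomial

variable {L : Type u} [Field L] {n : ℕ}

/-- `g` is a product of a nonzero scalar and powers, with positive exponents, of the linear forms in
the rows of an invertible matrix. -/
def HasScaledFactorization (g : MvPolynomial (Fin n) L) : Prop :=
  ∃ (A : Matrix (Fin n) (Fin n) L) (e : Fin n → ℕ) (c : L), IsUnit A ∧ (∀ i, 1 ≤ e i) ∧ c ≠ 0 ∧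
    g = C c * ∏ i, linForm (A i) ^ e i

/-- The linear forms can absorb the scalar. -/
theorem exists_scaling [IsAlgClosed L] (hn : 0 < n) (A : Matrix (Fin n) (Fin n) L) {e : Fin n → ℕ}
    (he : ∀ i, 1 ≤ e i) {c : L} (hc : c ≠ 0) :
    ∃ t : Fin n → L, (∀ i, t i ≠ 0) ∧ C c * ∏ i, linForm (A i) ^ e i =
      ∏ i, linForm (fun j => t i * A i j) ^ e i := by
  set i0 : Fin n := ⟨0, hn⟩
  -- Scaling a single form by a root of `c` of order `e i0 ≥ 1` is enough.
  obtain ⟨z, hz⟩ := IsAlgClosed.exists_pow_nat_eq c (he i0)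
  have hz0 : z ≠ 0 := by
    rintro rfl
    rw [zero_pow (by have := he i0; omega)] at hz
    exact hc hz.symm
  refine ⟨fun i => if i = i0 then z else 1, fun i => ?_, ?_⟩
  · dsimp only
    split_ifs <;> simp [hz0]
  · have h1 (i : Fin n) : linForm (fun j => (if i = i0 then z else 1) * A i j) ^ e i =
        (if i = i0 then C c else 1) * linForm (A i) ^ e i := by
      have : (fun j => (if i = i0 then z else 1) * A i j) = (if i = i0 then z else 1) • A i := rfl
      rw [this, linForm_smul, mul_pow]
      congr 1
      split_ifs with h
      · rw [h, ← C_pow, hz]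
      · simp
    simp only [h1, Finset.prod_mul_distrib, Finset.prod_ite_eq', Finset.mem_univ, if_true]

theorem hasIndependentFactorization_iff {K : Type v} [Field K] [Algebra K L] [IsAlgClosed L]
    (hn : 0 < n) (f : MvPolynomial (Fin n) K) :
    HasIndependentFactorization L f ↔ HasScaledFactorization (map (algebraMap K L) f) := by
  constructor
  · rintro ⟨l, e, hl, he, hf⟩
    exact ⟨Matrix.of l, e, 1, Matrix.linearIndependent_rows_iff_isUnit.1 hl, he, one_ne_zero,
      by rw [hf, C_1, one_mul]; rfl⟩
  · rintro ⟨A, e, c, hA, he, hc, hf⟩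
    obtain ⟨t, ht, h⟩ := exists_scaling hn A he hc
    refine ⟨fun i j => t i * A i j, e, ?_, he, hf.trans h⟩
    have := Matrix.linearIndependent_rows_iff_isUnit.2 hA
    exact this.units_smul fun i => Units.mk0 (t i) (ht i)

/-- The list `B` is a basis of the Lie algebra of `g`. -/
def IsBasisOfLie (B : List (Matrix (Fin n) (Fin n) L)) (g : MvPolynomial (Fin n) L) : Prop :=
  LinearIndependent L B.get ∧ Submodule.span L {M | M ∈ B} = lieSubmodule g

namespace IsBasisOfLie

variable {B : List (Matrix (Fin n) (Fin n) L)} {g : MvPolynomial (Fin n) L} {d : ℕ}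

theorem finrank_eq (hB : IsBasisOfLie B g) : Module.finrank L (lieSubmodule g) = B.length := by
  rw [← hB.2, ← Set.range_list_get, finrank_span_eq_card hB.1, Fintype.card_fin]

/-- The matrices diagonalized by `A` form a linear subspace, the range of `conjDiagonal A`, so it is
enough to check the basis. -/
theorem diagonal_of_mem (hB : IsBasisOfLie B g) {A : Matrix (Fin n) (Fin n) L} (hA : IsUnit A)
    (hBA : ∀ M ∈ B, ∃ q, A * M = Matrix.diagonal q * A) :
    ∀ M ∈ lieSubmodule g, ∃ q, A * M = Matrix.diagonal q * A := by
  have h : lieSubmodule g ≤ LinearMap.range (conjDiagonal A) := by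
    rw [← hB.2, Submodule.span_le]
    intro M hM
    obtain ⟨q, hq⟩ := hBA M hM
    exact ⟨q, (eq_conjDiagonal_iff hA).2 hq⟩
  intro M hM
  obtain ⟨q, hq⟩ := h hM
  exact ⟨q, (eq_conjDiagonal_iff hA).1 hq⟩

/-- The criterion for the existence of a factorization. -/
theorem criterion [CharZero L] [IsAlgClosed L] (hn : 0 < n) (hg : g.IsHomogeneous d)
    (hB : IsBasisOfLie B g) :
    (B.length + 1 = n ∧ (∀ M ∈ B, ∀ M' ∈ B, M * M' = M' * M) ∧
      ∀ M ∈ B, (minpoly L M).Separable) ↔ HasScaledFactorization g := by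
  constructor
  · rintro ⟨hlen, hcomm, hsep⟩
    obtain ⟨A, hA, hAB⟩ := exists_simultaneous_diagonalization B.get
      (fun i j => hcomm _ (B.get_mem i) _ (B.get_mem j)) fun i => hsep _ (B.get_mem i)
    have hBA (M) (hM : M ∈ B) : ∃ q, A * M = Matrix.diagonal q * A := by
      obtain ⟨i, rfl⟩ := List.get_of_mem hM
      exact hAB i
    obtain ⟨e, c, he, hc, h⟩ := eq_prod_of_lieSubmodule hg hA (hB.diagonal_of_mem hA hBA)
      (by rw [hB.finrank_eq, hlen])
    exact ⟨A, e, c, hA, he, hc, h⟩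
  · rintro ⟨A, e, c, hA, he, hc, rfl⟩
    have hBA (M) (hM : M ∈ B) : ∃ q, A * M = Matrix.diagonal q * A := by
      have : M ∈ lieSubmodule (C c * ∏ i, linForm (A i) ^ e i) :=
        hB.2 ▸ Submodule.subset_span hM
      obtain ⟨q, hq, -⟩ := (mem_lieSubmodule_prod hA he hc).1 this
      exact ⟨q, hq⟩
    refine ⟨?_, fun M hM M' hM' => ?_, fun M hM => ?_⟩
    · rw [← hB.finrank_eq, finrank_lieSubmodule_prod hA he hc hn]
    · obtain ⟨q, hq⟩ := hBA M hM
      obtain ⟨q', hq'⟩ := hBA M' hM'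
      refine hA.mul_left_cancel ?_
      rw [← Matrix.mul_assoc, hq, Matrix.mul_assoc, hq', ← Matrix.mul_assoc (A), hq',
        Matrix.mul_assoc, hq, ← Matrix.mul_assoc, ← Matrix.mul_assoc, Matrix.diagonal_mul_diagonal,
        Matrix.diagonal_mul_diagonal]
      simp only [mul_comm]
    · obtain ⟨q, hq⟩ := hBA M hM
      exact separable_minpoly_of_diagonalized hA hq

end IsBasisOfLie

end Decision

/-! ## Step 4: simultaneous diagonalization -/

namespace Prog

variable {L : Type u} [Field L] {n : ℕ} {O : (Fin n → L) → L}
  {E : (m : ℕ) → Matrix (Fin m) (Fin m) L → List L}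

/-- A bound for the cost of `Prog.decisionTest`. -/
def decisionCost (n : ℕ) : ℕ :=
  n * (n * (2 * (n * (n * (n * 2 + 1))) + n * (n * 2))) + n * (n * n + (n + 1) * diagonalizableCost n)

theorem Spec.decisionTest (B : List (Matrix (Fin n) (Fin n) L)) :
    Spec O E (Prog.decisionTest B) (decisionCost n) 0 (fun b => b = true ↔
      B.length + 1 = n ∧ (∀ M ∈ B, ∀ M' ∈ B, M * M' = M' * M) ∧
        ∀ M ∈ B, (minpoly L M).Separable) := by
  rw [Prog.decisionTest]
  split_ifs with h
  · have hl : B.length ≤ n := by omega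
    refine ((allList fun M _ => allList fun M' _ => commuteTest).bind₀
      (s' := n * (n * n + (n + 1) * diagonalizableCost n)) fun b hb => ?_).steps_le
      (by unfold decisionCost; gcongr)
    cases b with
    | true =>
      refine ((allList fun M _ => diagonalizableTest).post fun b' hb' => ?_).steps_le (by gcongr)
      rw [hb']
      exact ⟨fun h' => ⟨h, hb.1 rfl, h'⟩, fun h' => h'.2.2⟩
    | false =>
      exact ret (by simp only [Bool.false_eq_true, false_iff] at hb ⊢; exact fun h' => hb h'.2.1)
  · exact ret (by simp [h])

/-- The combination of the matrices in `B` with the coefficients `r`. -/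
def combination (B : List (Matrix (Fin n) (Fin n) L)) (r : Fin B.length → L) :
    Matrix (Fin n) (Fin n) L :=
  fun i j => ∑ t, r t * B.get t i j

/-- The matrix whose null space is the left eigenspace of `R` for `mu`. -/
def eigenMatrix (R : Matrix (Fin n) (Fin n) L) (mu : L) : Fin n → Fin n → L :=
  fun i j => if i = j then R j i - mu else R j i

theorem eigenMatrix_dotProduct (R : Matrix (Fin n) (Fin n) L) (mu : L) (v : Fin n → L) (i : Fin n) :
    eigenMatrix R mu i ⬝ᵥ v = Matrix.vecMul v R i - mu * v i := by
  have h (j : Fin n) : eigenMatrix R mu i j * v j = v j * R j i - if i = j then mu * v j else 0 := by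
    rw [eigenMatrix]
    split_ifs <;> ring
  simp only [dotProduct, h, Finset.sum_sub_distrib, Finset.sum_ite_eq, Finset.mem_univ, if_true]
  rfl

/-- The bases of the left eigenspaces of `R`. -/
noncomputable def eigenBases (E : (m : ℕ) → Matrix (Fin m) (Fin m) L → List L)
    (R : Matrix (Fin n) (Fin n) L) : List (List (Fin n → L)) :=
  (E n R).map fun mu => kernelFn (List.ofFn (eigenMatrix R mu))

/-- Eigenvectors for distinct eigenvalues are independent. This bounds the loop over the eigenvalues
on every run, also for unlucky combinations. -/
theorem length_eigenvalues_le (hE : IsEigenvalueSolver E) (R : Matrix (Fin n) (Fin n) L) :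
    (E n R).length ≤ n := by
  obtain ⟨hnd, hmem⟩ := hE n R
  choose v hv using fun i : Fin (E n R).length =>
    ((hmem _).1 ((E n R).get_mem i)).exists_hasEigenvector
  have := (Module.End.eigenvectors_linearIndependent' _ _ (List.nodup_iff_injective_get.1 hnd) v
    hv).fintype_card_le_finrank
  simpa using this

/-- A bound for the cost of `Prog.simulDiag` for at most `n` matrices. -/
def simulDiagCost (n : ℕ) : ℕ :=
  n * (n * (n * 2 + 1)) + (n * (n * (n * 1) + (n * n + n * (n * (4 * n + 2)))) + n * n) + n

theorem spec_simulDiag_continuation (hE : IsEigenvalueSolver E)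
    (B : List (Matrix (Fin n) (Fin n) L)) (hB : B.length ≤ n) (r : Fin B.length → L) :
    Spec O E (((tabulate n fun i => tabulate n fun j => sum B.length fun t =>
        .op .mul (r t) (B.get t i j) .ret).bind fun R : Fin n → Fin n → L =>
      .eig n (Matrix.of R) fun mus =>
      (mapList (fun mu =>
        (tabulate n fun i => tabulate n fun j =>
          if i = j then .op .sub (R j i) mu .ret else .ret (R j i)).bind fun S : Fin n → Fin n → L =>
        kernel (List.ofFn S)) mus).bind fun Vs =>
      if h : Vs.flatten.length = n then
        .ret (some (Matrix.of fun i => Vs.flatten.get (i.cast h.symm)))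
      else .ret none) : Prog L n (Option (Matrix (Fin n) (Fin n) L)))
      (n * (n * (n * 2 + 1)) + (n * (n * (n * 1) + (n * n + n * (n * (4 * n + 2)))) + n * n)) 1
      (fun A? => A? = if h : (eigenBases E (combination B r)).flatten.length = n then
        some (Matrix.of fun i => (eigenBases E (combination B r)).flatten.get (i.cast h.symm))
        else none) := by
  have h1 : Spec O E (tabulate n fun i => tabulate n fun j => sum B.length fun t =>
        (.op .mul (r t) (B.get t i j) .ret : Prog L n L)) (n * (n * (n * 2 + 1))) 0
        (· = combination B r) :=
    (Spec.tabulate fun i => Spec.tabulate fun j => Spec.sum fun t =>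
      Spec.op (Spec.ret (s := 0) rfl)).steps_le (by simp only [zero_add]; gcongr)
  refine h1.bind₀ fun R hR => ?_
  subst hR
  refine Spec.eig (e := 0) ?_
  have h2 : Spec O E (mapList (fun mu =>
        (tabulate n fun i => tabulate n fun j =>
          if i = j then .op .sub (combination B r j i) mu .ret
          else (.ret (combination B r j i) : Prog L n L)).bind fun S : Fin n → Fin n → L =>
        kernel (List.ofFn S)) (E n (combination B r)))
        (n * (n * (n * 1) + (n * n + n * (n * (4 * n + 2))))) 0
        (· = eigenBases E (combination B r)) := by
    refine (Spec.mapList fun mu _ => ?_).steps_le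
      (Nat.mul_le_mul_right _ (length_eigenvalues_le hE (combination B r)))
    have h3 : Spec O E (tabulate n fun i => tabulate n fun j =>
          if i = j then .op .sub (combination B r j i) mu .ret
          else (.ret (combination B r j i) : Prog L n L)) (n * (n * 1)) 0
          (· = eigenMatrix (combination B r) mu) := by
      refine Spec.tabulate fun i => Spec.tabulate fun j => ?_
      rw [eigenMatrix]
      split_ifs with h
      · exact Spec.op (Spec.ret (s := 0) rfl)
      · exact Spec.ret rfl
    refine h3.bind₀ fun S hS => ?_
    subst hS
    exact Spec.kernel.steps_le (by rw [List.length_ofFn])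
  refine (h2.bind₀ (s' := 0) fun Vs hVs => ?_)
  subst hVs
  split_ifs with h
  · exact Spec.ret rfl
  · exact Spec.ret rfl

theorem Spec.simulDiag {N : ℕ} (hE : IsEigenvalueSolver E) (B : List (Matrix (Fin n) (Fin n) L))
    (hB : B.length ≤ n) :
    Spec O E (Prog.simulDiag N B) (simulDiagCost n) 1 (fun _ => True) :=
  (Spec.rand fun r => (spec_simulDiag_continuation hE B hB _).post fun _ _ => trivial).steps_le
    (by unfold simulDiagCost; gcongr)

theorem mem_eigenvalues_iff (hE : IsEigenvalueSolver E) {A R : Matrix (Fin n) (Fin n) L}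
    (hA : IsUnit A) {ρ : Fin n → L} (hR : A * R = Matrix.diagonal ρ * A) (mu : L) :
    mu ∈ E n R ↔ ∃ k, ρ k = mu := by
  have := hA.invertible
  rw [(hE n R).2]
  constructor
  · intro h
    obtain ⟨v, hv⟩ := h.exists_hasEigenvector
    have hv1 : R.mulVec v = mu • v := hv.apply_eq_smul
    have hne : A.mulVec v ≠ 0 := fun h0 => hv.2 (mulVec_eq_zero_imp_iff.2 hA v h0)
    obtain ⟨k, hk⟩ := Function.ne_iff.1 hne
    refine ⟨k, ?_⟩
    have h1 : (Matrix.diagonal ρ).mulVec (A.mulVec v) = mu • A.mulVec v := by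
      rw [Matrix.mulVec_mulVec, ← hR, ← Matrix.mulVec_mulVec, hv1, Matrix.mulVec_smul]
    have h2 := congrFun h1 k
    rw [Matrix.mulVec_diagonal] at h2
    exact mul_right_cancel₀ hk h2
  · rintro ⟨k, rfl⟩
    refine Module.End.hasEigenvalue_of_hasEigenvector (x := A⁻¹.mulVec (Pi.single k 1))
      ⟨Module.End.mem_eigenspace_iff.2 ?_, fun h => ?_⟩
    · have h1 : R * A⁻¹ = A⁻¹ * Matrix.diagonal ρ := by
        have := congrArg (fun M => A⁻¹ * M * A⁻¹) hR
        simpa [Matrix.mul_assoc] using this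
      rw [Matrix.toLin'_apply, Matrix.mulVec_mulVec, h1, ← Matrix.mulVec_mulVec,
        ← Matrix.mulVec_smul]
      congr 1
      ext j
      rw [Matrix.mulVec_diagonal, Pi.smul_apply, smul_eq_mul]
      by_cases hj : j = k
      · rw [hj]
      · simp [hj]
    · have h1 := congrArg A.mulVec h
      rw [Matrix.mulVec_mulVec, Matrix.mul_inv_of_invertible, Matrix.one_mulVec,
        Matrix.mulVec_zero] at h1
      exact one_ne_zero (α := L) (by simpa using congrFun h1 k)

theorem vecMul_row {A R : Matrix (Fin n) (Fin n) L} {ρ : Fin n → L}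
    (hR : A * R = Matrix.diagonal ρ * A) (k : Fin n) : Matrix.vecMul (A k) R = ρ k • A k := by
  have := congrFun hR k
  rw [Matrix.mul_apply_eq_vecMul] at this
  rw [this]
  ext j
  rw [Matrix.diagonal_mul]
  rfl

/-- In the coordinates `u = x * A⁻¹` a left eigenvector of `R` is one of `diag(ρ)`. As the entries
of `ρ` are distinct, only the `k`-th coordinate of `u` survives, so the eigenspace is the line of
the `k`-th row of `A`. -/
theorem kernelFn_eigenMatrix {A R : Matrix (Fin n) (Fin n) L} (hA : IsUnit A) {ρ : Fin n → L}
    (hρ : Function.Injective ρ) (hR : A * R = Matrix.diagonal ρ * A) (k : Fin n) :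
    ∃ c : L, c ≠ 0 ∧ kernelFn (List.ofFn (eigenMatrix R (ρ k))) = [c • A k] := by
  have := hA.invertible
  refine kernelFn_eq_singleton _ ((Matrix.linearIndependent_rows_iff_isUnit.2 hA).ne_zero k)
    fun x => ?_
  rw [List.forall_mem_ofFn_iff]
  simp only [eigenMatrix_dotProduct, sub_eq_zero]
  constructor
  · intro h
    have hx : Matrix.vecMul x R = ρ k • x := funext h
    set u := Matrix.vecMul x A⁻¹ with hu
    have hxu : x = Matrix.vecMul u A := by
      rw [hu, Matrix.vecMul_vecMul, Matrix.inv_mul_of_invertible, Matrix.vecMul_one]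
    have h1 : A⁻¹ * Matrix.diagonal ρ = R * A⁻¹ := by
      have := congrArg (fun M => A⁻¹ * M * A⁻¹) hR
      simpa [Matrix.mul_assoc] using this.symm
    have h2 : Matrix.vecMul u (Matrix.diagonal ρ) = ρ k • u := by
      rw [hu, Matrix.vecMul_vecMul, h1, ← Matrix.vecMul_vecMul, hx, Matrix.smul_vecMul]
    have h3 : u = Pi.single k (u k) := by
      ext j
      by_cases hj : j = k
      · rw [hj, Pi.single_eq_same]
      · rw [Pi.single_eq_of_ne hj]
        have h4 := congrFun h2 j
        rw [Matrix.vecMul_diagonal, Pi.smul_apply, smul_eq_mul, mul_comm] at h4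
        by_contra h0
        exact hj (hρ (mul_right_cancel₀ h0 h4))
    refine ⟨u k, ?_⟩
    rw [hxu, h3, Matrix.single_vecMul, Pi.single_eq_same]
    rfl
  · rintro ⟨c, rfl⟩ i
    rw [Matrix.smul_vecMul, vecMul_row hR, Pi.smul_apply, Pi.smul_apply, Pi.smul_apply,
      smul_eq_mul, smul_eq_mul, smul_eq_mul, mul_left_comm]

/-- If `R` has distinct eigenvalues, then the bases of its left eigenspaces form an invertible
matrix, and the rows of this matrix are multiples of the given eigenvectors. -/
theorem eigenBases_spec (hE : IsEigenvalueSolver E) {A R : Matrix (Fin n) (Fin n) L}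
    (hA : IsUnit A) {ρ : Fin n → L} (hρ : Function.Injective ρ)
    (hR : A * R = Matrix.diagonal ρ * A) :
    ∃ h : (eigenBases E R).flatten.length = n,
      IsUnit (Matrix.of fun i : Fin n => (eigenBases E R).flatten.get (i.cast h.symm)) ∧
      ∀ i : Fin n, ∃ k, ∃ c : L, (eigenBases E R).flatten.get (i.cast h.symm) = c • A k := by
  classical
  have hmem := mem_eigenvalues_iff hE hA hR
  -- The vector is chosen for all scalars, with junk value `0` off the spectrum, so that the
  -- concatenated bases become a plain `List.map` over the eigenvalues.
  have hex (mu : L) : ∃ v : Fin n → L, mu ∈ E n R →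
      kernelFn (List.ofFn (eigenMatrix R mu)) = [v] ∧ v ≠ 0 ∧ Matrix.vecMul v R = mu • v ∧
        ∃ k, ∃ c : L, v = c • A k := by
    by_cases hmu : mu ∈ E n R
    · obtain ⟨k, rfl⟩ := (hmem mu).1 hmu
      obtain ⟨c, hc, h⟩ := kernelFn_eigenMatrix hA hρ hR k
      refine ⟨c • A k, fun _ => ⟨h, smul_ne_zero hc
        ((Matrix.linearIndependent_rows_iff_isUnit.2 hA).ne_zero k), ?_, k, c, rfl⟩⟩
      rw [Matrix.smul_vecMul, vecMul_row hR, smul_comm]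
    · exact ⟨0, fun h => absurd h hmu⟩
  choose v hv using hex
  have hflat : (eigenBases E R).flatten = (E n R).map v := by
    rw [eigenBases, List.map_congr_left fun mu hmu => (hv mu hmu).1, ← List.flatMap_def,
      ← List.map_eq_flatMap]
  have hlen : (E n R).length = n := by
    rw [← List.toFinset_card_of_nodup (hE n R).1, show (E n R).toFinset = Finset.univ.image ρ from by
      ext mu; simp [hmem], Finset.card_image_of_injective _ hρ, Finset.card_univ, Fintype.card_fin]
  have h : (eigenBases E R).flatten.length = n := by rw [hflat, List.length_map, hlen]
  have hget (i : Fin n) : (eigenBases E R).flatten.get (i.cast h.symm) =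
      v ((E n R).get (i.cast hlen.symm)) := by
    simp [hflat]
  refine ⟨h, ?_, fun i => ?_⟩
  · rw [← Matrix.linearIndependent_rows_iff_isUnit]
    have hinj : Function.Injective fun i : Fin n => (E n R).get (i.cast hlen.symm) :=
      (List.nodup_iff_injective_get.1 (hE n R).1).comp (Fin.cast_injective _)
    refine Module.End.eigenvectors_linearIndependent' R.vecMulLinear _ hinj _ fun i => ?_
    have := hv _ ((E n R).get_mem (i.cast hlen.symm))
    refine ⟨Module.End.mem_eigenspace_iff.2 ?_, ?_⟩
    · change Matrix.vecMul ((eigenBases E R).flatten.get (i.cast h.symm)) R =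
        _ • (eigenBases E R).flatten.get (i.cast h.symm)
      rw [hget]
      exact this.2.2.1
    · change (eigenBases E R).flatten.get (i.cast h.symm) ≠ 0
      rw [hget]
      exact this.2.1
  · rw [hget]
    exact (hv _ ((E n R).get_mem _)).2.2.2

/-! ### The probability that a random combination has distinct eigenvalues. -/

section simulDiagProb

open MvPolynomial

/-- A polynomial that vanishes at the combinations with repeated eigenvalues. -/
noncomputable def distinctPoly {b : ℕ} (β : Fin b → Fin n → L) : MvPolynomial (Fin b) L :=
  ∏ i, ∏ j, if i = j then 1 else ∑ t, C (β t i - β t j) * X t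

/-- Each factor is a linear form, and a unit vector at a separating index `t` shows that it is
nonzero. -/
theorem distinctPoly_ne_zero {b : ℕ} {β : Fin b → Fin n → L}
    (h : ∀ i j, i ≠ j → ∃ t, β t i ≠ β t j) : distinctPoly β ≠ 0 := by
  refine Finset.prod_ne_zero_iff.2 fun i _ => Finset.prod_ne_zero_iff.2 fun j _ => ?_
  split_ifs with hij
  · exact one_ne_zero
  · intro h0
    obtain ⟨t, ht⟩ := h i j hij
    have := congrArg (eval (Pi.single t 1)) h0
    simp [Pi.single_apply, sub_eq_zero, ht] at this

theorem totalDegree_distinctPoly_le {b : ℕ} (β : Fin b → Fin n → L) :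
    (distinctPoly β).totalDegree ≤ n * n := by
  refine (totalDegree_finsetProd _ _).trans ((Finset.sum_le_card_nsmul _ _ n fun i _ => ?_).trans
    (by simp))
  refine (totalDegree_finsetProd _ _).trans ((Finset.sum_le_card_nsmul _ _ 1 fun j _ => ?_).trans
    (by simp))
  split_ifs
  · simp
  · refine totalDegree_finsetSum_le fun t _ => (totalDegree_mul _ _).trans ?_
    rw [totalDegree_C, totalDegree_X]

theorem injective_of_eval_distinctPoly_ne_zero {b : ℕ} {β : Fin b → Fin n → L} {r : Fin b → L}
    (h : eval r (distinctPoly β) ≠ 0) : Function.Injective fun k => ∑ t, r t * β t k := by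
  intro i j hij
  by_contra hne
  rw [distinctPoly, map_prod] at h
  have h1 := Finset.prod_ne_zero_iff.1 h i (Finset.mem_univ i)
  rw [map_prod] at h1
  have h2 := Finset.prod_ne_zero_iff.1 h1 j (Finset.mem_univ j)
  rw [if_neg hne] at h2
  refine h2 ?_
  simp only [map_sum, map_mul, eval_C, eval_X, sub_mul, Finset.sum_sub_distrib, sub_eq_zero]
  simpa [mul_comm] using hij

theorem simulDiag_failProb_le [CharZero L] {N : ℕ} (hE : IsEigenvalueSolver E)
    {B : List (Matrix (Fin n) (Fin n) L)} (hB : B.length ≤ n) {A : Matrix (Fin n) (Fin n) L}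
    (hA : IsUnit A) {β : Fin B.length → Fin n → L}
    (hβ : ∀ t, A * B.get t = Matrix.diagonal (β t) * A)
    (hsep : ∀ i j, i ≠ j → ∃ t, β t i ≠ β t j) :
    failProb O E (Prog.simulDiag N B : Prog L n _) (fun A? => ∃ A, A? = some A ∧ IsUnit A ∧
      ∀ M ∈ B, ∃ q, A * M = Matrix.diagonal q * A) ≤
      ((n * n : ℕ) : ENNReal) / ((N + 1 : ℕ) : ENNReal) := by
  rw [← add_zero (_ / _)]
  refine failProb_rand_le _ (uniform_eval_eq_zero_le (distinctPoly_ne_zero hsep)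
    (totalDegree_distinctPoly_le β)) fun r hr =>
    ((spec_simulDiag_continuation hE B hB _).post ?_).failProb_le 0
  have hinj := injective_of_eval_distinctPoly_ne_zero hr
  set R := combination B fun i => ((r i : ℕ) : L) with hRdef
  have hRsum : R = ∑ t, ((r t : ℕ) : L) • B.get t := by
    ext i j
    simp [hRdef, combination, Matrix.sum_apply]
  have hR : A * R = Matrix.diagonal (fun k => ∑ t, ((r t : ℕ) : L) * β t k) * A := by
    rw [hRsum, Matrix.mul_sum]
    simp only [Matrix.mul_smul, hβ]
    ext i j
    simp [Matrix.sum_apply, Matrix.diagonal_mul, Finset.sum_mul, mul_assoc]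
  obtain ⟨h, hu, hrow⟩ := eigenBases_spec hE hA hinj hR
  rintro _ rfl
  rw [dif_pos h]
  refine ⟨_, rfl, hu, fun M hM => ?_⟩
  obtain ⟨t, rfl⟩ := List.get_of_mem hM
  -- Every row found is a multiple of a row of the given `A`, hence a left eigenvector of all
  -- matrices in `B` and not only of their combination.
  choose k c hkc using hrow
  refine ⟨fun i => β t (k i), ?_⟩
  ext i j
  rw [Matrix.diagonal_mul, Matrix.mul_apply_eq_vecMul]
  change Matrix.vecMul ((eigenBases E R).flatten.get (i.cast h.symm)) (B.get t) j =
    β t (k i) * (eigenBases E R).flatten.get (i.cast h.symm) j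
  rw [hkc, Matrix.smul_vecMul, vecMul_row (hβ t), smul_comm]
  rfl

end simulDiagProb

end Prog

/-! ## Steps 5 and 6: the exponents and the constant factor -/

namespace Prog

open MvPolynomial

variable {L : Type u} [Field L] {n : ℕ} {O : (Fin n → L) → L}
  {E : (m : ℕ) → Matrix (Fin m) (Fin m) L → List L}

open scoped Classical in
/-- The result of `Prog.ratio`. -/
noncomputable def ratioFn : List (L × L) → L
  | [] => 0
  | (x, y) :: l => if y = 0 then ratioFn l else x / y

theorem ratioFn_eq {q : L} : ∀ {l : List (L × L)}, (∀ p ∈ l, p.1 = q * p.2) →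
    (∃ p ∈ l, p.2 ≠ 0) → ratioFn l = q
  | [], _, h => by simp at h
  | (x, y) :: l, h, ⟨p, hp, hp0⟩ => by
    rw [ratioFn]
    split_ifs with hy
    · refine ratioFn_eq (fun p hp => h p (List.mem_cons_of_mem _ hp)) ⟨p, ?_, hp0⟩
      rcases List.mem_cons.1 hp with rfl | hp
      · exact absurd hy hp0
      · exact hp
    · have h1 : x = q * y := h (x, y) List.mem_cons_self
      rw [h1, mul_div_cancel_right₀ _ hy]

/-- The result of `Prog.diagonals` for one matrix. -/
noncomputable def diagonalFn (A M : Matrix (Fin n) (Fin n) L) (k : Fin n) : L :=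
  ratioFn (List.ofFn fun j => ((A * M) k j, A k j))

theorem diagonalFn_eq {A M : Matrix (Fin n) (Fin n) L} (hA : IsUnit A) {q : Fin n → L}
    (h : A * M = Matrix.diagonal q * A) : diagonalFn A M = q := by
  funext k
  refine ratioFn_eq ?_ ?_
  · rw [List.forall_mem_ofFn_iff]
    intro j
    rw [h, Matrix.diagonal_mul]
  · have h0 := (Matrix.linearIndependent_rows_iff_isUnit.2 hA).ne_zero k
    obtain ⟨j, hj⟩ := Function.ne_iff.1 h0
    exact ⟨_, List.mem_ofFn.2 ⟨j, rfl⟩, hj⟩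

/-- A bound for the cost of `Prog.exponents` for at most `n` vectors. -/
def exponentsCost (n d : ℕ) : ℕ :=
  n * n + n * (n * (4 * n + 2)) + (n * (0 + 1) + 1 + (n * (3 * d + 3) + 1))

namespace Spec

theorem ratio {l : List (L × L)} : Spec O E (Prog.ratio l) (l.length + 1) 0 (· = ratioFn l) := by
  induction l with
  | nil => exact lit (ret (by simp [ratioFn]))
  | cons p l ih =>
    obtain ⟨x, y⟩ := p
    refine isZero fun b hb => ?_
    rw [ratioFn]
    cases b with
    | true =>
      rw [if_pos (hb.1 rfl)]
      exact ih
    | false =>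
      simp only [Bool.false_eq_true, false_iff, if_false] at hb ⊢
      rw [if_neg hb]
      exact op (ret (s := l.length) rfl)

theorem diagonals (A : Matrix (Fin n) (Fin n) L) (B : List (Matrix (Fin n) (Fin n) L)) :
    Spec O E (Prog.diagonals A B) (B.length * (n * (n * (n * 2 + 1)) + n * (n + 1))) 0
      (· = B.map (diagonalFn A)) := by
  refine mapList fun M _ => matMul.bind₀ fun P hP => ?_
  subst hP
  exact tabulate fun k => ratio.steps_le (by simp)

theorem findNat [CharZero L] {x : L} {l : List ℕ} : Spec O E (Prog.findNat x l) (3 * l.length) 0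
    (fun e? => (∀ e, e? = some e → e ∈ l) ∧
      ∀ e : ℕ, x = (e : L) → e ∈ l → e? = some e) := by
  induction l with
  | nil => exact ret (by simp)
  | cons a l ih =>
    refine (lit (op (isZero (s := 3 * l.length) fun b hb => ?_))).steps_le (by simp; omega)
    rw [ArithOp.eval, sub_eq_zero] at hb
    cases b with
    | true =>
      refine ret ⟨by simp, fun e hx _ => ?_⟩
      have := hb.1 rfl
      rw [hx, Nat.cast_inj] at this
      rw [this]
    | false =>
      simp only [Bool.false_eq_true, false_iff, if_false] at hb ⊢
      refine ih.post fun e? h => ⟨fun e he => List.mem_cons_of_mem _ (h.1 e he), fun e hx he => ?_⟩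
      rcases List.mem_cons.1 he with rfl | he
      · exact absurd hx hb
      · exact h.2 e hx he

/-- The bound by `d` holds on every run, because exponents are only searched for in `1, …, d`; it
limits the cost of the later powers. In the good case the unknown factor `c` cancels when the sum is
normalized to `d`. -/
theorem exponents [CharZero L] (d : ℕ) (D : List (Fin n → L)) (hD : D.length ≤ n) :
    Spec O E (Prog.exponents d D) (exponentsCost n d) 0 (fun e? =>
      (∀ e, e? = some e → ∀ k, e k ≤ d) ∧
      ∀ (e : Fin n → ℕ) (c : L), 0 < n → c ≠ 0 → (∀ k, 1 ≤ e k) → ∑ k, e k = d →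
        kernelFn D = [fun k => c * e k] → e? = some e) := by
  refine (kernel.bind₀ (s' := n * (0 + 1) + 1 + (n * (3 * d + 3) + 1)) fun V hV => ?_).steps_le
    (by unfold exponentsCost; gcongr)
  subst hV
  rcases hk : kernelFn D with _ | ⟨a, _ | ⟨b, l⟩⟩
  · exact ret (by simp)
  · refine (sum fun k => ret (s := 0) rfl).bind₀ fun s hs => isZero fun b hb => ?_
    cases b with
    | true =>
      refine ret ⟨by simp, fun e c hn hc he hd h => ?_⟩
      have h1 : s = 0 := hb.1 rfl
      have h2 : a = fun k => c * (e k : L) := by simpa using h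
      rw [hs, h2, ← Finset.mul_sum, ← Nat.cast_sum, mul_eq_zero, Nat.cast_eq_zero,
        Finset.sum_eq_zero_iff] at h1
      have h3 := he ⟨0, hn⟩
      have h4 := h1.resolve_left hc ⟨0, hn⟩ (Finset.mem_univ _)
      omega
    | false =>
      simp only [Bool.false_eq_true, if_false]
      have h1 (k : Fin n) : Spec O E (.lit d fun z => .op .mul (a k) z fun z =>
          .op .div z s fun z => Prog.findNat z (List.range' 1 d) : Prog L n (Option ℕ))
          (3 * d + 3) 0 (fun e? => (∀ e, e? = some e → e ∈ List.range' 1 d) ∧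
            ∀ e : ℕ, a k * d / s = e → e ∈ List.range' 1 d → e? = some e) := by
        have h2 : Spec O E (Prog.findNat (a k * d / s) (List.range' 1 d) : Prog L n _) (3 * d) 0 _ :=
          findNat.steps_le (by simp)
        exact lit (s := 3 * d + 2) (op (s := 3 * d + 1) (op (s := 3 * d) h2))
      refine ((tabulate_pred h1).bind₀ (s' := 0) fun e? he? => ?_).steps_le (by omega)
      have key (e : Fin n → ℕ) (c : L) (hn : 0 < n) (hc : c ≠ 0) (he : ∀ k, 1 ≤ e k)
          (hd : ∑ k, e k = d) (h : [a] = [fun k => c * (e k : L)]) (k) : e? k = some (e k) := by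
        have hed : e k ≤ d := hd ▸ Finset.single_le_sum (fun _ _ => Nat.zero_le _)
          (Finset.mem_univ k)
        have ha : a = fun k => c * (e k : L) := by simpa using h
        refine (he? k).2 (e k) ?_ (List.mem_range'_1.2 ⟨he k, by omega⟩)
        have hd0 : (d : L) ≠ 0 := by
          have := he k
          exact Nat.cast_ne_zero.2 (by omega)
        rw [hs, ha, ← Finset.mul_sum, ← Nat.cast_sum, hd]
        field_simp
      split_ifs with hall
      · refine ret ⟨fun e he k => ?_, fun e c hn hc he hd h => ?_⟩
        · obtain ⟨x, hx⟩ := Option.isSome_iff_exists.1 (hall k)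
          have h1 := (he? k).1 x hx
          rw [List.mem_range'_1] at h1
          have h2 := congrFun (Option.some.inj he) k
          rw [hx, Option.getD_some] at h2
          omega
        · congr 1
          funext k
          rw [key e c hn hc he hd h k, Option.getD_some]
      · refine ret ⟨by simp, fun e c hn hc he hd h => absurd (fun k => ?_) hall⟩
        rw [key e c hn hc he hd h k, Option.isSome_some]
  · exact ret (by simp)

end Spec

/-- A bound for the cost of `Prog.constantFactor` for exponents that are at most `d`. -/
def constantFactorCost (n d : ℕ) : ℕ :=
  n * (n * 2 + 1) + (n * (d * (0 + 1) + 1 + 1) + 1 + (1 + 1)) + 1 + n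

theorem spec_constantFactor_continuation {d : ℕ} {A : Matrix (Fin n) (Fin n) L} {e : Fin n → ℕ}
    (he : ∀ k, e k ≤ d) (a : Fin n → L) :
    Spec O E ((.query a fun y => (tabulate n fun k => dot (A k) a).bind fun l =>
      (prod n fun k => prod (e k) fun _ => .ret (l k)).bind fun z =>
      .isZero z fun b => if b then .ret none else .op .div y z fun c => .ret (some c)) :
        Prog L n (Option L))
      (n * (n * 2 + 1) + (n * (d * (0 + 1) + 1 + 1) + 1 + (1 + 1)) + 1) 0
      (fun c? => ∏ k, (A k ⬝ᵥ a) ^ e k ≠ 0 → c? = some (O a / ∏ k, (A k ⬝ᵥ a) ^ e k)) := by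
  refine Spec.query ((Spec.tabulate fun k => Spec.dot).bind₀ fun l hl => ?_)
  subst hl
  refine (Spec.prod fun k => (Spec.prod fun _ => Spec.ret (s := 0) rfl).steps_le
    (by gcongr; exact he k)).bind₀ fun z hz => Spec.isZero fun b hb => ?_
  have hz' : z = ∏ k, (A k ⬝ᵥ a) ^ e k := by simpa using hz
  rw [hz'] at hb ⊢
  cases b with
  | true => exact Spec.ret fun h => absurd (hb.1 rfl) h
  | false => exact Spec.op (Spec.ret (s := 0) fun _ => rfl)

theorem Spec.constantFactor {d N : ℕ} (A : Matrix (Fin n) (Fin n) L) {e : Fin n → ℕ}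
    (he : ∀ k, e k ≤ d) :
    Spec O E (Prog.constantFactor N A e) (constantFactorCost n d) 0 (fun _ => True) :=
  Spec.rand fun _ => (spec_constantFactor_continuation he _).post fun _ _ => trivial

/-- Schwartz–Zippel is applied to `g` itself: where `g` does not vanish, neither does the product of
powers, and the quotient is `c`. -/
theorem constantFactor_failProb_le [CharZero L] {d N : ℕ} {A : Matrix (Fin n) (Fin n) L}
    {e : Fin n → ℕ} (he : ∀ k, e k ≤ d) {g : MvPolynomial (Fin n) L} (hg : g.totalDegree ≤ d)
    (hO : AgreesAtNat O g) {c : L} (hg0 : g ≠ 0)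
    (hgc : g = C c * ∏ i, linForm (A i) ^ e i) :
    failProb O E (Prog.constantFactor N A e) (· = some c) ≤
      (d : ENNReal) / ((N + 1 : ℕ) : ENNReal) := by
  rw [← add_zero (_ / _)]
  refine failProb_rand_le _ (uniform_eval_eq_zero_le hg0 hg) fun r hr =>
    ((spec_constantFactor_continuation he _).post ?_).failProb_le 0
  intro c? h
  have hev : eval (fun i => ((r i : ℕ) : L)) g =
      c * ∏ k, (A k ⬝ᵥ fun i => ((r i : ℕ) : L)) ^ e k := by
    rw [hgc]
    simp [eval_linForm]
  have hr' : eval (fun i => ((r i : ℕ) : L)) g ≠ 0 := hr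
  have hz : ∏ k, (A k ⬝ᵥ fun i => ((r i : ℕ) : L)) ^ e k ≠ 0 := by
    intro h0
    rw [hev, h0, mul_zero] at hr'
    exact hr' rfl
  rw [h hz, hO fun i => r i, hev, mul_div_cancel_right₀ _ hz]

end Prog

/-! ### Steps 4 to 6 together -/

section FactorizationFrom

open MvPolynomial Prog

variable {L : Type u} [Field L] {n : ℕ} {O : (Fin n → L) → L}
  {E : (m : ℕ) → Matrix (Fin m) (Fin m) L → List L}

/-- A bound for the cost of `factorizationFrom` for at most `n` matrices. -/
def factorizationCost (n d : ℕ) : ℕ :=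
  simulDiagCost n + (n * (n * (n * (n * 2 + 1)) + n * (n + 1)) +
    (exponentsCost n d + constantFactorCost n d))

theorem spec_factorizationFrom [CharZero L] (hE : IsEigenvalueSolver E) (d N : ℕ)
    (B : List (Matrix (Fin n) (Fin n) L)) (hB : B.length ≤ n) :
    Spec O E (factorizationFrom d N B) (factorizationCost n d) 1 (fun _ => True) := by
  refine (Spec.simulDiag hE B hB).bind (e' := 0) fun A? _ => ?_
  rcases A? with _ | A
  · exact Spec.ret trivial
  refine ((Spec.diagonals A B).steps_le (by gcongr)).bind₀ fun D hD => ?_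
  refine (Spec.exponents d D (by rw [hD, List.length_map]; exact hB)).bind₀ fun e? he => ?_
  rcases e? with _ | e
  · exact Spec.ret trivial
  · exact ((Spec.constantFactor A (he.1 e rfl)).bind₀ fun c? _ => Spec.ret (s := 0) trivial).steps_le
      (by simp)

theorem linForm_isHomogeneous (a : Fin n → L) : (linForm a).IsHomogeneous 1 :=
  IsHomogeneous.sum _ _ _ fun _ _ => isHomogeneous_C_mul_X _ _

/-- These test vectors of the hyperplane `e^⊥` both detect proportionality to `e` and separate the
coordinates `i` and `j`. -/
theorem single_sub_single_mem_ker (e : Fin n → ℕ) (i j : Fin n) :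
    Pi.single j (e i : L) - Pi.single i (e j : L) ∈
      LinearMap.ker (dotProductBilin L L fun i => (e i : L)) := by
  simp [dotProduct_sub, mul_comm]

section Product

variable {A : Matrix (Fin n) (Fin n) L} {e : Fin n → ℕ} {c : L}

theorem prod_linForm_ne_zero (hA : IsUnit A) (hc : c ≠ 0) :
    C c * ∏ i, linForm (A i) ^ e i ≠ 0 := by
  rw [← linSubst_monomial, Ne, map_eq_zero_iff _ (linSubst_injective hA), monomial_eq_zero]
  exact hc

theorem sum_exponents_eq (hA : IsUnit A) (hc : c ≠ 0) {d : ℕ}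
    (h : (C c * ∏ i, linForm (A i) ^ e i).IsHomogeneous d) : ∑ i, e i = d := by
  have h1 : (C c * ∏ i, linForm (A i) ^ e i).IsHomogeneous (∑ i, e i) :=
    (IsHomogeneous.prod _ _ _ fun i _ => by
      simpa using (linForm_isHomogeneous (A i)).pow (e i)).C_mul c
  exact h1.inj_right h (prod_linForm_ne_zero hA hc)

variable [CharZero L] {B : List (Matrix (Fin n) (Fin n) L)}

/-- If the vectors on the diagonals of the matrices `A * M * A⁻¹` with `M` in `B` lie in a subspace,
then so do all vectors that are orthogonal to the exponents. -/
theorem ker_le_of_diagonals (hA : IsUnit A) (he : ∀ i, 1 ≤ e i) (hc : c ≠ 0)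
    (hB : IsBasisOfLie B (C c * ∏ i, linForm (A i) ^ e i)) (S : Submodule L (Fin n → L))
    (hS : ∀ M ∈ B, ∃ q ∈ S, A * M = Matrix.diagonal q * A) :
    LinearMap.ker (dotProductBilin L L fun i => (e i : L)) ≤ S := by
  have h : (LinearMap.ker (dotProductBilin L L fun i => (e i : L))).map (conjDiagonal A) ≤
      S.map (conjDiagonal A) := by
    rw [← lieSubmodule_prod_eq hA he hc, ← hB.2, Submodule.span_le]
    intro M hM
    obtain ⟨q, hq, h⟩ := hS M hM
    exact ⟨q, hq, (eq_conjDiagonal_iff hA).2 h⟩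
  exact (Submodule.map_le_map_iff_of_injective (conjDiagonal_injective hA) _ _).1 h

/-- The exponents span the space that is orthogonal to the diagonals. -/
theorem orthogonal_diagonals_iff (hn : 0 < n) (hA : IsUnit A) (he : ∀ i, 1 ≤ e i) (hc : c ≠ 0)
    (hB : IsBasisOfLie B (C c * ∏ i, linForm (A i) ^ e i)) (x : Fin n → L) :
    (∀ w ∈ B.map (diagonalFn A), w ⬝ᵥ x = 0) ↔ ∃ t : L, x = t • fun i => (e i : L) := by
  have hdiag (M) (hM : M ∈ B) : A * M = Matrix.diagonal (diagonalFn A M) * A ∧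
      ∑ i, diagonalFn A M i * (e i : L) = 0 := by
    obtain ⟨q, hq, h⟩ := (mem_lieSubmodule_prod hA he hc).1
      (hB.2 ▸ Submodule.subset_span hM : M ∈ lieSubmodule _)
    rw [diagonalFn_eq hA hq]
    exact ⟨hq, h⟩
  rw [List.forall_mem_map]
  constructor
  · intro h
    -- With `S = x^⊥` this says `e^⊥ ≤ x^⊥`; comparing on the test vectors through a fixed index
    -- `i0` yields the factor `x i0 / e i0`.
    have hker := ker_le_of_diagonals hA he hc hB (LinearMap.ker (dotProductBilin L L x))
      fun M hM => ⟨_, by simpa [dotProduct_comm] using h M hM, (hdiag M hM).1⟩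
    set i0 : Fin n := ⟨0, hn⟩
    have h0 : (e i0 : L) ≠ 0 := Nat.cast_ne_zero.2 (by have := he i0; omega)
    refine ⟨x i0 / e i0, funext fun j => ?_⟩
    have := hker (single_sub_single_mem_ker e i0 j)
    rw [LinearMap.mem_ker] at this
    simp only [dotProductBilin_apply_apply, dotProduct_sub, dotProduct_single, sub_eq_zero] at this
    rw [Pi.smul_apply, smul_eq_mul, div_mul_eq_mul_div, ← this, mul_div_cancel_right₀ _ h0]
  · rintro ⟨t, rfl⟩ M hM
    rw [dotProduct_smul]
    have := (hdiag M hM).2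
    rw [dotProduct, this, smul_zero]

end Product

theorem factorizationFrom_failProb_le [CharZero L] (hE : IsEigenvalueSolver E) (hn : 0 < n)
    {d N : ℕ} {B : List (Matrix (Fin n) (Fin n) L)} {g : MvPolynomial (Fin n) L}
    (hg : g.IsHomogeneous d) (hO : AgreesAtNat O g) (hB : IsBasisOfLie B g)
    (hfac : HasScaledFactorization g) :
    failProb O E (factorizationFrom d N B) (fun fac? => ∃ fac, fac? = some fac ∧
      IsUnit fac.forms ∧ (∀ i, 1 ≤ fac.exponents i) ∧ fac.scalar ≠ 0 ∧
      g = C fac.scalar * ∏ i, linForm (fac.forms i) ^ fac.exponents i) ≤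
      ((n * n : ℕ) : ENNReal) / ((N + 1 : ℕ) : ENNReal) +
        (d : ENNReal) / ((N + 1 : ℕ) : ENNReal) := by
  obtain ⟨A₀, e₀, c₀, hA₀, he₀, hc₀, rfl⟩ := hfac
  have hrank := finrank_lieSubmodule_prod hA₀ he₀ hc₀ hn
  have hlen : B.length + 1 = n := by rw [← hB.finrank_eq, hrank]
  have hβ (t : Fin B.length) : ∃ q, A₀ * B.get t = Matrix.diagonal q * A₀ := by
    obtain ⟨q, hq, -⟩ := (mem_lieSubmodule_prod hA₀ he₀ hc₀).1
      (hB.2 ▸ Submodule.subset_span (B.get_mem t) : B.get t ∈ lieSubmodule _)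
    exact ⟨q, hq⟩
  choose β hβ using hβ
  -- Otherwise all of `e₀^⊥` would satisfy `q i = q j`; the test vector has the entries `-e₀ j` and
  -- `e₀ i` there, which would force `e₀ i + e₀ j = 0`.
  have hsep (i j : Fin n) (hij : i ≠ j) : ∃ t, β t i ≠ β t j := by
    by_contra! h
    have hker := ker_le_of_diagonals hA₀ he₀ hc₀ hB
      (LinearMap.eqLocus (LinearMap.proj (R := L) (φ := fun _ : Fin n => L) i) (LinearMap.proj j))
      fun M hM => by
        obtain ⟨t, rfl⟩ := List.get_of_mem hM
        exact ⟨β t, h t, hβ t⟩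
    have : (Pi.single j (e₀ i : L) - Pi.single i (e₀ j : L) : Fin n → L) i =
      (Pi.single j (e₀ i : L) - Pi.single i (e₀ j : L) : Fin n → L) j :=
      hker (single_sub_single_mem_ker e₀ i j)
    simp only [Pi.sub_apply, Pi.single_eq_same, Pi.single_eq_of_ne hij,
      Pi.single_eq_of_ne hij.symm, zero_sub, sub_zero] at this
    have h1 : ((e₀ j + e₀ i : ℕ) : L) = 0 := by
      push_cast
      linear_combination -this
    rw [Nat.cast_eq_zero] at h1
    have := he₀ i
    omega
  refine failProb_bind_le (simulDiag_failProb_le hE (by omega) hA₀ hβ hsep) ?_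
  rintro _ ⟨A, rfl, hA, hBA⟩
  -- The matrix `A` found need not be `A₀`, so a factorization into the rows of `A` is derived
  -- afresh; its exponents and scalar are the ones to be recovered.
  obtain ⟨e, c, he, hc, hgA⟩ := eq_prod_of_lieSubmodule hg hA (hB.diagonal_of_mem hA hBA) hrank
  rw [hgA] at hg hO hB ⊢
  have hsum := sum_exponents_eq hA hc hg
  have hed (k : Fin n) : e k ≤ d :=
    hsum ▸ Finset.single_le_sum (fun _ _ => Nat.zero_le _) (Finset.mem_univ k)
  refine (Spec.diagonals A B).failProb_bind_le fun D hD => ?_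
  subst hD
  refine (Spec.exponents d _ (by rw [List.length_map]; omega)).failProb_bind_le fun e? he? => ?_
  have hv : (fun i => (e i : L)) ≠ 0 := by
    intro h
    have h1 : (e ⟨0, hn⟩ : L) = 0 := congrFun h ⟨0, hn⟩
    have h2 := he ⟨0, hn⟩
    rw [Nat.cast_eq_zero] at h1
    omega
  obtain ⟨t, ht, hk⟩ := kernelFn_eq_singleton _ hv (orthogonal_diagonals_iff hn hA he hc hB)
  have := he?.2 e t hn ht he hsum hk
  subst this
  rw [← add_zero (_ / _)]
  refine failProb_bind_le (constantFactor_failProb_le hed hg.totalDegree_le hO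
    (prod_linForm_ne_zero hA hc) rfl) fun c? hc? => ?_
  subst hc?
  exact (Spec.ret (s := 0) (e := 0) ⟨_, rfl, hA, he, hc, rfl⟩).failProb_le 0

end FactorizationFrom

/-! ## Polynomial bounds -/

/-- The function `g` is bounded by a polynomial in `n + d`. -/
def IsPolyBounded (g : ℕ → ℕ → ℕ) : Prop :=
  ∃ C c : ℕ, ∀ n d, 0 < n → g n d ≤ C * (n + d) ^ c

namespace IsPolyBounded

variable {g h : ℕ → ℕ → ℕ}

theorem const (k : ℕ) : IsPolyBounded fun _ _ => k := ⟨k, 0, by simp⟩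

theorem left : IsPolyBounded fun n _ => n := ⟨1, 1, by simp⟩

theorem right : IsPolyBounded fun _ d => d := ⟨1, 1, by simp⟩

theorem add (hg : IsPolyBounded g) (hh : IsPolyBounded h) :
    IsPolyBounded fun n d => g n d + h n d := by
  obtain ⟨C, c, hC⟩ := hg
  obtain ⟨D, e, hD⟩ := hh
  refine ⟨C + D, c + e, fun n d hn => ?_⟩
  -- Raising the exponents to a common value needs a base of at least `1`.
  have h1 : 1 ≤ n + d := by omega
  calc g n d + h n d ≤ C * (n + d) ^ c + D * (n + d) ^ e := add_le_add (hC n d hn) (hD n d hn)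
    _ ≤ C * (n + d) ^ (c + e) + D * (n + d) ^ (c + e) := by
      gcongr <;> omega
    _ = (C + D) * (n + d) ^ (c + e) := by ring

theorem mul (hg : IsPolyBounded g) (hh : IsPolyBounded h) :
    IsPolyBounded fun n d => g n d * h n d := by
  obtain ⟨C, c, hC⟩ := hg
  obtain ⟨D, e, hD⟩ := hh
  refine ⟨C * D, c + e, fun n d hn => ?_⟩
  calc g n d * h n d ≤ C * (n + d) ^ c * (D * (n + d) ^ e) :=
      Nat.mul_le_mul (hC n d hn) (hD n d hn)
    _ = C * D * (n + d) ^ (c + e) := by ring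

end IsPolyBounded

/-- The step bound and the numerator of the failure probability are added, so that one pair of
constants serves both claims. -/
theorem isPolyBounded_cost : IsPolyBounded fun n d =>
    (Prog.lieBasisCost n d + (Prog.decisionCost n + factorizationCost n d)) +
      (n * n * (d + 1) + (n * n + d)) := by
  unfold Prog.lieBasisCost Prog.decisionCost factorizationCost Prog.lieRowCost
    Prog.simulDiagCost Prog.exponentsCost Prog.constantFactorCost Prog.diagonalizableCost
  repeat' first
    | exact .const _
    | exact .left
    | exact .right
    | refine .add ?_ ?_
    | refine .mul ?_ ?_

/-! ## The basis of the Lie algebra -/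

section LieBasis

open MvPolynomial Prog

variable {K : Type u} [Field K] {L : Type v} [Field L] {n : ℕ}

/-- A basis of the null space of the linear system is a basis of the Lie algebra, if all its
solutions are in the Lie algebra. -/
theorem isBasisOfLie_lieBasisFn {g : MvPolynomial (Fin n) L} {x : Fin (n * n * n) → L}
    (h : ∀ v : Fin (n * n) → L, (∀ w ∈ lieRows g x, w ⬝ᵥ v = 0) ↔ toMatrix v ∈ lieSubmodule g) :
    IsBasisOfLie (lieBasisFn g x) g := by
  let T : (Fin (n * n) → L) ≃ₗ[L] Matrix (Fin n) (Fin n) L :=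
    { toFun := toMatrix
      invFun := fun M p => M (finProdFinEquiv.symm p).1 (finProdFinEquiv.symm p).2
      map_add' := fun _ _ => rfl
      map_smul' := fun _ _ => rfl
      left_inv := fun v => funext fun p => by
        change v (finProdFinEquiv ((finProdFinEquiv.symm p).1, (finProdFinEquiv.symm p).2)) = v p
        rw [Prod.mk.eta, Equiv.apply_symm_apply]
      right_inv := fun M => by
        ext i j
        change M (finProdFinEquiv.symm (finProdFinEquiv (i, j))).1
          (finProdFinEquiv.symm (finProdFinEquiv (i, j))).2 = M i j
        rw [Equiv.symm_apply_apply] }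
  obtain ⟨h1, h2⟩ := kernelFn_spec (lieRows g x)
  refine ⟨(linearIndependent_get_map _ _).2 (h1.map' T.toLinearMap T.ker), ?_⟩
  have hset : {M | M ∈ lieBasisFn g x} = T.toLinearMap '' {v | v ∈ kernelFn (lieRows g x)} := by
    ext M
    simp only [lieBasisFn, List.mem_map, Set.mem_ofPred_eq, Set.mem_image]
    rfl
  rw [hset, Submodule.span_image]
  ext M
  rw [Submodule.mem_map]
  constructor
  · rintro ⟨v, hv, rfl⟩
    exact (h v).1 ((h2 v).1 hv)
  · intro hM
    refine ⟨T.symm M, (h2 _).2 ((h _).2 ?_), T.apply_symm_apply M⟩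
    rwa [← T.apply_symm_apply M] at hM

variable [Algebra K L]

theorem lieRowFn_map (f : MvPolynomial (Fin n) K) (a : Fin n → K) :
    lieRowFn (map (algebraMap K L) f) (fun i => algebraMap K L (a i)) =
      fun p => algebraMap K L (lieRowFn f a p) := by
  funext p
  simp only [lieRowFn, pderiv_map, map_mul]
  congr 1
  rw [eval_map]
  exact (eval₂_comp (algebraMap K L) a _).symm

theorem lieRows_map (f : MvPolynomial (Fin n) K) (x : Fin (n * n * n) → K) :
    lieRows (map (algebraMap K L) f) (fun i => algebraMap K L (x i)) =
      (lieRows f x).map fun w p => algebraMap K L (w p) := by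
  rw [lieRows, lieRows, List.map_ofFn]
  congr 1
  funext p
  exact lieRowFn_map f _

theorem lieBasisFn_map (f : MvPolynomial (Fin n) K) (x : Fin (n * n * n) → K) :
    lieBasisFn (map (algebraMap K L) f) (fun i => algebraMap K L (x i)) =
      (lieBasisFn f x).map fun M => M.map (algebraMap K L) := by
  rw [lieBasisFn, lieRows_map, kernelFn_map (algebraMap K L), lieBasisFn, List.map_map, List.map_map]
  rfl

/-- The correctness of the linear system over `L` descends to vectors over `K` because `algebraMap`
is injective, and elimination over `L` returns the image of the basis over `K`. -/
theorem isLieBasis_lieBasisFn {f : MvPolynomial (Fin n) K} {x : Fin (n * n * n) → K}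
    (h : ∀ v : Fin (n * n) → L,
      (∀ w ∈ lieRows (map (algebraMap K L) f) (fun i => algebraMap K L (x i)), w ⬝ᵥ v = 0) ↔
        toMatrix v ∈ lieSubmodule (map (algebraMap K L) f)) :
    IsLieBasis (lieBasisFn (map (algebraMap K L) f) fun i => algebraMap K L (x i)) f := by
  have hK : IsBasisOfLie (lieBasisFn f x) f := by
    refine isBasisOfLie_lieBasisFn fun v => ?_
    have hv := h fun p => algebraMap K L (v p)
    have h1 : toMatrix (fun p => algebraMap K L (v p)) ∈ lieSubmodule (map (algebraMap K L) f) ↔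
        toMatrix v ∈ lieSubmodule f := by
      rw [mem_lieSubmodule, mem_lieSubmodule,
        ← map_eq_zero_iff _ (map_injective _ (algebraMap K L).injective), ← lieDer_map]
      rfl
    rw [← h1, ← hv, lieRows_map, List.forall_mem_map]
    refine forall₂_congr fun w _ => ?_
    rw [← map_eq_zero_iff _ (algebraMap K L).injective]
    simp [dotProduct]
  refine ⟨_, lieBasisFn_map f x, hK.1, ?_⟩
  rw [lieAlgebraOf_eq, ← hK.2, Set.range_list_get]

end LieBasis

/-! ## The algorithm -/

theorem Factorization.isFor_of_isUnit {K : Type u} {L : Type v} [Field K] [Field L] [Algebra K L]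
    [IsAlgClosed L] {n : ℕ} (fac : Factorization L n) (hn : 0 < n) {f : MvPolynomial (Fin n) K}
    (hA : IsUnit fac.forms) (he : ∀ i, 1 ≤ fac.exponents i) (hc : fac.scalar ≠ 0)
    (h : MvPolynomial.map (algebraMap K L) f =
      MvPolynomial.C fac.scalar * ∏ i, linForm (fac.forms i) ^ fac.exponents i) :
    fac.IsFor f := by
  obtain ⟨t, ht, hs⟩ := exists_scaling hn fac.forms he hc
  exact ⟨hc, Matrix.linearIndependent_rows_iff_isUnit.2 hA, he, h, t, ht, h.trans hs⟩

section Algorithm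

open MvPolynomial Prog

variable {K : Type u} [Field K] {L : Type v} [Field L] [Algebra K L] {n d N : ℕ}
  {f : MvPolynomial (Fin n) K} {O : (Fin n → L) → L}
  {E : (m : ℕ) → Matrix (Fin m) (Fin m) L → List L}

theorem IsBlackBox.agreesAtNat (hO : IsBlackBox f O) : AgreesAtNat O (map (algebraMap K L) f) := by
  intro x
  have h := hO fun i => (x i : K)
  simp only [map_natCast] at h
  rw [h, eval_map, eval₂_comp]
  simp [Function.comp_def]

theorem spec_lieAlgorithm [CharZero L] {g : MvPolynomial (Fin n) L} (hg : g.totalDegree ≤ d)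
    (hO : AgreesAtNat O g) (hE : IsEigenvalueSolver E) :
    Spec O E (lieAlgorithm L n d N)
      (lieBasisCost n d + (decisionCost n + factorizationCost n d)) 1 (fun _ => True) := by
  refine (Spec.lieBasis hg hO).bind₀ fun B _ => (Spec.decisionTest B).bind₀ fun b hb => ?_
  cases b with
  | true =>
    have hlen := (hb.1 rfl).1
    exact (spec_factorizationFrom hE d N B (by omega)).bind (e' := 0) (s' := 0)
      fun _ _ => Spec.ret trivial
  | false => exact Spec.ret trivial

/-- The three terms belong to the sample points, the random combination and the evaluation point.
Given a correct basis the decision is deterministic and right, so a rejection carries no further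
risk. -/
theorem lieAlgorithm_failProb_le [CharZero L] [IsAlgClosed L] (hn : 0 < n)
    (hf : f.IsHomogeneous d) (hO : IsBlackBox f O) (hE : IsEigenvalueSolver E) :
    failProb O E (lieAlgorithm L n d N) (fun out => out.IsCorrect f) ≤
      ((n * n * (d + 1) + (n * n + d) : ℕ) : ENNReal) / ((N + 1 : ℕ) : ENNReal) := by
  have hg : (map (algebraMap K L) f).IsHomogeneous d := hf.map _
  rw [Nat.cast_add (n * n * (d + 1)), Nat.cast_add (n * n) d, ENNReal.add_div, ENNReal.add_div]
  refine failProb_bind_le (lieBasis_failProb_le hg.totalDegree_le hO.agreesAtNat) ?_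
  rintro B ⟨r, rfl, hr⟩
  have hB := isBasisOfLie_lieBasisFn hr
  have hBf : IsLieBasis (lieBasisFn (map (algebraMap K L) f) fun i => (r i : L)) f := by
    have := isLieBasis_lieBasisFn (f := f) (L := L) (x := fun i => (r i : K))
    simp only [map_natCast] at this
    exact this hr
  refine (Spec.decisionTest _).failProb_bind_le fun b hb => ?_
  rw [hB.criterion hn hg, ← hasIndependentFactorization_iff hn] at hb
  cases b with
  | true =>
    have hfac := hb.1 rfl
    simp only [if_true]
    rw [← add_zero (_ / _ + _ / _)]
    refine failProb_bind_le (factorizationFrom_failProb_le hE hn hg hO.agreesAtNat hB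
      ((hasIndependentFactorization_iff hn f).1 hfac)) fun fac? hfac? =>
        (Spec.ret (s := 0) (e := 0) ?_).failProb_le 0
    obtain ⟨fac, rfl, hA, he, hc, h⟩ := hfac?
    exact ⟨hBf, hb, fun _ => ⟨fac, rfl, fac.isFor_of_isUnit hn hA he hc h⟩, fun h => absurd hfac h⟩
  | false =>
    have hfac : ¬ HasIndependentFactorization L f := fun h => by simpa using hb.2 h
    exact (Spec.ret (s := 0) (e := 0) ⟨hBf, hb, fun h => absurd h hfac, fun _ => rfl⟩).failProb_le _

end Algorithm

theorem mainTheorem3 :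
    ∃ C c : ℕ, ∀ (K : Type u) [Field K] [CharZero K] (L : Type v) [Field L] [Algebra K L]
      [IsAlgClosure K L] (n d : ℕ) (f : MvPolynomial (Fin n) K) (O : (Fin n → L) → L)
      (E : (m : ℕ) → Matrix (Fin m) (Fin m) L → List L) (N : ℕ),
      0 < n → f.IsHomogeneous d → IsBlackBox f O → IsEigenvalueSolver E →
      (∀ r ∈ ((lieAlgorithm L n d N).run O E).support,
        r.steps ≤ C * (n + d) ^ c ∧ r.eigenCalls ≤ 1) ∧
      ((lieAlgorithm L n d N).run O E).toOuterMeasure {r | ¬ r.output.IsCorrect f} ≤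
        ((C * (n + d) ^ c : ℕ) : ENNReal) / ((N + 1 : ℕ) : ENNReal) := by
  obtain ⟨C, c, hC⟩ := isPolyBounded_cost
  refine ⟨C, c, fun K _ _ L _ _ _ n d f O E N hn hf hO hE => ?_⟩
  have : IsAlgClosed L := IsAlgClosure.isAlgClosed K
  have : CharZero L := charZero_of_injective_algebraMap (algebraMap K L).injective
  have h1 := hC n d hn
  beta_reduce at h1
  refine ⟨fun r hr => ?_, (lieAlgorithm_failProb_le hn hf hO hE).trans ?_⟩
  · obtain ⟨h2, h3, -⟩ :=
      spec_lieAlgorithm (hf.map (algebraMap K L)).totalDegree_le hO.agreesAtNat hE r hr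
    exact ⟨by omega, h3⟩
  · gcongr
    omega
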